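/- **Setting.** Let $b=\frac{dr^2}{1+r^2}+r^2\sigma$ be the hyperbolic metric on $\mathbb H^3\cong(0,\infty)\times\mathbb S^2$ (completed at $r=0$), where $\sigma$ is the round metric on $\mathbb S^2$. For a tensor $T$ on $\mathbb{H}^3$ defined near infinity, $T\in C^{k,\beta}_\tau(\mathbb H^3)$ means that, for all points $p$ with $r(p)$ large, the $C^{k,\beta}$ norm of $T$ on a ball of fixed size about $p$, in normalized coordinates obtained from fixed coordinates about the origin by a hyperbolic isometry taking the origin to $p$, is at most $C\,r(p)^{-\tau}$, with $C$ independent of $p$. Let $(M,g,K)$ be an initial data set: a smooth 3-manifold $M$, a Riemannian metric $g$ and a symmetric 2-tensor $K$. Put $2\mu=\mathrm{Scal}^g+(\mathrm{tr}^gK)^2-|K|_g^2$ and $J=\mathrm{div}^gK-d(\mathrm{tr}^gK)$. Let $l\ge 2$ be an integer, $0\le\beta<1$, $\tau_0>0$, and assume that $(M,g,K)$ is asymptotically hyperbolic of type $(l,\beta,3,\tau_0)$ with Wang's asymptotics. That is: $g\in C^{l,\beta}(M)$, $K\in C^{l-1,\beta}(M)$, and there are a compact set $\mathcal C\subset M$,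 a number $R>0$ and a diffeomorphism $\Phi:M\setminus\mathcal C\to(R,\infty)\times\mathbb S^2$ such that * $\Phi_*g-b\in C^{l,\beta}_3$, $\ \Phi_*(K-g)\in C^{l-1,\beta}_3$, $\ \Phi_*\mu\in C^{l-2,\beta}_{3+\tau_0}$, $\ \Phi_*J\in C^{l-2,\beta}_{3+\tau_0}$; * $\Phi_*g=b+r^{-1}\mathbf m+E_g$ and $\Phi_*(K-b)|_{T\mathbb S^2\times T\mathbb S^2}=r^{-1}\mathbf p+E_K$, where $\mathbf m\in C^{l,\beta}(\mathbb S^2)$ and $\mathbf p\in C^{l-1,\beta}(\mathbb S^2)$ are symmetric 2-tensors on $\mathbb S^2$, $E_g\in C^{l,\beta}_4$ has no radial components ($E_g(\partial_r,\cdot)=0$), and $E_K\in C^{l-1,\beta}_4$. Let $$\alpha=\frac1{8\pi}\int_{\mathbb S^2}(\mathrm{tr}^\sigma\mathbf m+2\,\mathrm{tr}^\sigma\mathbf p)\,d\mu^\sigma,$$ and let $\psi\in C^2(\mathbb S^2)$ be any solution of $\Delta^{\mathbb S^2}\psi=\tfrac12\mathrm{tr}^\sigma\mathbf m+\mathrm{tr}^\sigma\mathbf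 p-\alpha$. For a function $f$ write $$\mathcal J(f)=\Big(g^{ij}-\frac{f^if^j}{1+|df|_g^2}\Big)\Big(\frac{\mathrm{Hess}^g_{ij}f}{\sqrt{1+|df|_g^2}}-K_{ij}\Big),\qquad f^i=g^{ij}\partial_jf,$$ so that $\mathcal J(f)=0$ is the Jang equation. **Proposition 3.5.** For every $\varepsilon>0$ there exist $r_0>R$ and functions $f_+,f_-:\{r\ge r_0\}\to\mathbb R$ on the subset $\{r\ge r_0\}$ of $M$, continuous on $\{r\ge r_0\}$ and $C^2$ on $\{r>r_0\}$, such that: * $f_+$ is an upper barrier and $f_-$ a lower barrier for the Jang equation: $\mathcal J(f_+)<0$ and $\mathcal J(f_-)>0$ on $\{r>r_0\}$, and for each $(\theta,\varphi)\in\mathbb S^2$ one has $\partial_rf_+(r,\theta,\varphi)\to-\infty$ and $\partial_rf_-(r,\theta,\varphi)\to+\infty$ as $r\searrow r_0$; * as $r\to\infty$, uniformly in $(\theta,\varphi)$, $$f_\pm(r,\theta,\varphi)=\sqrt{1+r^2}+\alpha\ln r+\psi(\theta,\varphi)+O(r^{-1+\varepsilon});$$ * $f_-\le f_+$ on $\{r\ge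 r_0\}$. -/

import Mathlib

open Set Filter Topology MeasureTheory
open scoped Manifold ContDiff

noncomputable section

namespace Jang

/-- Euclidean 3-space `ℝ³`. It is the model space of 3-manifolds; the map
`x ↦ (√(1+|x|²), x)` also identifies it with the unit upper hyperboloid, and
`x ↦ (|x|, x/|x|)` identifies `{|x| > R}` with `(R, ∞) × S²`. -/
abbrev E3 : Type := EuclideanSpace ℝ (Fin 3)

/-- The unit sphere `S²` in `ℝ³`. -/
abbrev S2 : Type := Metric.sphere (0 : E3) 1

/-- The standard basis vectors `∂₁, ∂₂, ∂₃`. -/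
def stdVec (i : Fin 3) : E3 := EuclideanSpace.single i (1 : ℝ)

/-- Bilinear forms on `ℝ³`. -/
abbrev Bil : Type := E3 →L[ℝ] E3 →L[ℝ] ℝ

/-- The angular variable `x/|x| ∈ S²` of a point `x ≠ 0` (an arbitrary point at `x = 0`). -/
def sphereDir (x : E3) : S2 :=
  if h : x = 0 then ⟨stdVec 0, by simp [stdVec]⟩
  else ⟨‖x‖⁻¹ • x, by
    have hx : ‖x‖ ≠ 0 := norm_ne_zero_iff.mpr h
    simp [norm_smul, hx]⟩

/-! ### Riemannian geometry in local coordinates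

`G` and `K` are fields of bilinear forms on (an open subset of) `ℝ³`: the coordinate expressions
of the metric and of a symmetric 2-tensor. -/

/-- The partial derivative `∂ᵢ u`. -/
def pd (i : Fin 3) (u : E3 → ℝ) (x : E3) : ℝ := fderiv ℝ u x (stdVec i)

/-- The components `Tᵢⱼ` of a 2-tensor. -/
def comp (T : E3 → Bil) (i j : Fin 3) (x : E3) : ℝ := T x (stdVec i) (stdVec j)

/-- The components `gⁱʲ` of the inverse metric. -/
def ginv (G : E3 → Bil) (i j : Fin 3) (x : E3) : ℝ :=
  (Matrix.of fun a b => comp G a b x)⁻¹ i j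

/-- The Christoffel symbols `Γᵏᵢⱼ`. -/
def christoffel (G : E3 → Bil) (k i j : Fin 3) (x : E3) : ℝ :=
  (1 / 2) * ∑ m, ginv G k m x *
    (pd i (comp G j m) x + pd j (comp G i m) x - pd m (comp G i j) x)

/-- The components of the Hessian `∂ᵢ∂ⱼ f - Γᵏᵢⱼ ∂ₖ f`. -/
def hess (G : E3 → Bil) (f : E3 → ℝ) (i j : Fin 3) (x : E3) : ℝ :=
  pd i (pd j f) x - ∑ k, christoffel G k i j x * pd k f x

/-- The components `fⁱ = gⁱʲ ∂ⱼ f` of the gradient. -/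
def gradUp (G : E3 → Bil) (f : E3 → ℝ) (i : Fin 3) (x : E3) : ℝ :=
  ∑ j, ginv G i j x * pd j f x

/-- `|df|²_g = gⁱʲ ∂ᵢ f ∂ⱼ f`. -/
def normSqDf (G : E3 → Bil) (f : E3 → ℝ) (x : E3) : ℝ :=
  ∑ i, ∑ j, ginv G i j x * pd i f x * pd j f x

/-- The left hand side of the Jang equation,
`(gⁱʲ - fⁱ fʲ / (1 + |df|²)) (Hessᵢⱼ f / √(1 + |df|²) - Kᵢⱼ)`, in local coordinates. -/
def jang (G K : E3 → Bil) (f : E3 → ℝ) (x : E3) : ℝ :=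
  ∑ i, ∑ j, (ginv G i j x - gradUp G f i x * gradUp G f j x / (1 + normSqDf G f x)) *
    (hess G f i j x / Real.sqrt (1 + normSqDf G f x) - comp K i j x)

/-- The components of the Ricci tensor. -/
def ricci (G : E3 → Bil) (i j : Fin 3) (x : E3) : ℝ :=
  ∑ k, (pd k (christoffel G k i j) x - pd j (christoffel G k i k) x) +
    ∑ k, ∑ m, (christoffel G k k m x * christoffel G m i j x
      - christoffel G k j m x * christoffel G m i k x)

/-- The scalar curvature. -/
def scal (G : E3 → Bil) (x : E3) : ℝ := ∑ i, ∑ j, ginv G i j x * ricci G i j x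

/-- The trace of a 2-tensor with respect to the metric. -/
def trace (G T : E3 → Bil) (x : E3) : ℝ := ∑ i, ∑ j, ginv G i j x * comp T i j x

/-- The squared norm of a 2-tensor with respect to the metric. -/
def normSq (G T : E3 → Bil) (x : E3) : ℝ :=
  ∑ i, ∑ j, ∑ k, ∑ m, ginv G i k x * ginv G j m x * comp T i j x * comp T k m x

/-- The components `(∇ₖ T)ᵢⱼ` of the covariant derivative of a 2-tensor. -/
def covDeriv (G T : E3 → Bil) (k i j : Fin 3) (x : E3) : ℝ :=
  pd k (comp T i j) x - ∑ m, (christoffel G m k i x * comp T m j x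
    + christoffel G m k j x * comp T i m x)

/-- The local mass density: `2 μ = Scal + (tr K)² - |K|²`. -/
def massDensity (G K : E3 → Bil) (x : E3) : ℝ :=
  (1 / 2) * (scal G x + trace G K x ^ 2 - normSq G K x)

/-- The local current density `J = div K - d (tr K)`, a 1-form. -/
def currentDensity (G K : E3 → Bil) (x : E3) : E3 →L[ℝ] ℝ :=
  ∑ j, ((∑ i, ∑ k, ginv G i k x * covDeriv G K k i j x) - pd j (trace G K) x) •
    (EuclideanSpace.proj j : E3 →L[ℝ] ℝ)

/-! ### Hyperbolic space and weighted Hölder spaces -/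

/-- The Euclidean inner product of `ℝ³` as a bilinear form. -/
def innerBil : Bil := innerSL ℝ

/-- The hyperbolic metric `b = dr²/(1+r²) + r² σ` of the hyperboloidal model, in Cartesian
coordinates: `b(v, w) = ⟨v, w⟩ - ⟨x, v⟩⟨x, w⟩ / (1 + |x|²)`. -/
def hyp (x : E3) : Bil :=
  innerBil - (1 / (1 + ‖x‖ ^ 2)) • (innerSL ℝ x : E3 →L[ℝ] ℝ).smulRight (innerSL ℝ x : E3 →L[ℝ] ℝ)

/-- The Lorentz boost that takes the origin of the hyperboloid to the point `p`; an isometry of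
hyperbolic space. -/
def boost (p y : E3) : E3 :=
  y + Real.sqrt (1 + ‖y‖ ^ 2) • p + (inner ℝ p y / (1 + Real.sqrt (1 + ‖p‖ ^ 2))) • p

/-- The norm of `u` in `C^{k,β}` of the unit ball is controlled by `A`: `u` is `C^k` there, its
derivatives of order at most `k` are bounded by `A`, and so is the `β`-Hölder seminorm of its
`k`-th derivative. -/
def HolderBallBound {F : Type*} [NormedAddCommGroup F] [NormedSpace ℝ F]
    (k : ℕ) (β A : ℝ) (u : E3 → F) : Prop :=
  ContDiffOn ℝ k u (Metric.ball 0 1) ∧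
  (∀ j ≤ k, ∀ y ∈ Metric.ball (0 : E3) 1, ‖iteratedFDeriv ℝ j u y‖ ≤ A) ∧
  (∀ y ∈ Metric.ball (0 : E3) 1, ∀ z ∈ Metric.ball (0 : E3) 1,
    ‖iteratedFDeriv ℝ k u y - iteratedFDeriv ℝ k u z‖ ≤ A * ‖y - z‖ ^ β)

/-- A family `u p` (the expressions of one tensor field in the hyperbolic normalized coordinates
centered at `p`) has `C^{k,β}` norms on the unit ball of order `O(r(p)^{-τ})` as `r(p) = |p| → ∞`. -/
def WeightedDecay {F : Type*} [NormedAddCommGroup F] [NormedSpace ℝ F]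
    (k : ℕ) (β τ : ℝ) (u : E3 → E3 → F) : Prop :=
  ∃ A R : ℝ, ∀ p : E3, R ≤ ‖p‖ → HolderBallBound k β (A * ‖p‖ ^ (-τ)) (u p)

/-- A function defined near infinity belongs to the weighted Hölder space `C^{k,β}_τ(ℍ³)`. -/
def WeightedFun (k : ℕ) (β τ : ℝ) (u : E3 → ℝ) : Prop :=
  WeightedDecay k β τ fun p y => u (boost p y)

/-- A 1-form defined near infinity belongs to `C^{k,β}_τ(ℍ³)`. -/
def WeightedForm (k : ℕ) (β τ : ℝ) (a : E3 → E3 →L[ℝ] ℝ) : Prop :=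
  WeightedDecay k β τ fun p y => (a (boost p y)).comp (fderiv ℝ (boost p) y)

/-- A 2-tensor defined near infinity belongs to `C^{k,β}_τ(ℍ³)`. -/
def WeightedTensor (k : ℕ) (β τ : ℝ) (T : E3 → Bil) : Prop :=
  WeightedDecay k β τ fun p y =>
    (T (boost p y)).bilinearComp (fderiv ℝ (boost p) y) (fderiv ℝ (boost p) y)

/-- `u` is of class `C^{k,β}` locally on the open set `U`. -/
def LocallyHolder {F : Type*} [NormedAddCommGroup F] [NormedSpace ℝ F]
    (k : ℕ) (β : ℝ) (u : E3 → F) (U : Set E3) : Prop :=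
  ContDiffOn ℝ k u U ∧
  ∀ x ∈ U, ∃ A : ℝ, ∃ V ∈ 𝓝 x, ∀ y ∈ V, ∀ z ∈ V,
    ‖iteratedFDeriv ℝ k u y - iteratedFDeriv ℝ k u z‖ ≤ A * ‖y - z‖ ^ β

/-! ### Tensors and functions on the sphere -/

/-- A symmetric 2-tensor of class `C^{k,β}` on `S²`. A bilinear form on `T_θ S² = θ^⊥` is
represented by its extension to `ℝ³` that vanishes when one argument is `θ`; regularity on `S²` is
that of the extension to `ℝ³ \ {0}` which is constant along rays. -/
structure IsSphereTensor (k : ℕ) (β : ℝ) (m : S2 → Bil) : Prop where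
  symm : ∀ θ v w, m θ v w = m θ w v
  tangential : ∀ (θ : S2) v, m θ (θ : E3) v = 0
  regular : LocallyHolder k β (fun x => m (sphereDir x)) {0}ᶜ

/-- The trace `tr^σ m` with respect to the round metric `σ`. -/
def sphereTrace (m : S2 → Bil) (θ : S2) : ℝ := ∑ i, m θ (stdVec i) (stdVec i)

/-- The Laplacian `Δ^{S²} ψ` of the round sphere: the Euclidean Laplacian, at points of the sphere,
of the extension of `ψ` to `ℝ³ \ {0}` which is constant along rays. -/
def sphereLaplacian (ψ : S2 → ℝ) (θ : S2) : ℝ :=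
  Laplacian.laplacian (fun x : E3 => ψ (sphereDir x)) (θ : E3)

/-- `α = (1/8π) ∫_{S²} (tr^σ m + 2 tr^σ p) dμ^σ`. -/
def alpha (m p : S2 → Bil) : ℝ :=
  (1 / (8 * Real.pi)) *
    ∫ θ : S2, (sphereTrace m θ + 2 * sphereTrace p θ) ∂(volume : Measure E3).toSphere

/-- `ψ` is a `C²` solution of `Δ^{S²} ψ = ½ tr^σ m + tr^σ p - α` on `S²`. -/
def IsPsi (m p : S2 → Bil) (ψ : S2 → ℝ) : Prop :=
  ContDiffOn ℝ 2 (fun x : E3 => ψ (sphereDir x)) {0}ᶜ ∧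
  ∀ θ, sphereLaplacian ψ θ = (1 / 2) * sphereTrace m θ + sphereTrace p θ - alpha m p

/-! ### Initial data sets -/

variable {M : Type*} [TopologicalSpace M] [ChartedSpace E3 M]

variable (M) in
/-- A field of bilinear forms on the tangent spaces of `M`. -/
abbrev TensorField : Type _ :=
  (q : M) → TangentSpace 𝓘(ℝ, E3) q →L[ℝ] TangentSpace 𝓘(ℝ, E3) q →L[ℝ] ℝ

/-- The coordinate expression `e_* T` of a 2-tensor `T` in the chart `e`. -/
def pushTensor (e : OpenPartialHomeomorph M E3) (T : TensorField M) (x : E3) : Bil :=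
  let D : E3 →L[ℝ] E3 := mfderiv 𝓘(ℝ, E3) 𝓘(ℝ, E3) e.symm x
  let B : Bil := T (e.symm x)
  B.bilinearComp D D

/-- A 2-tensor on `M` is of class `C^{k,β}`: so are its expressions in all charts. -/
def IsHolderTensor (k : ℕ) (β : ℝ) (T : TensorField M) : Prop :=
  ∀ e ∈ IsManifold.maximalAtlas 𝓘(ℝ, E3) ∞ M, LocallyHolder k β (pushTensor e T) e.target

variable (M) in
/-- An initial data set `(M, g, K)`: a Riemannian metric and a symmetric 2-tensor. -/
structure InitialData where
  g : TensorField M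
  K : TensorField M
  g_symm : ∀ q v w, g q v w = g q w v
  g_pos : ∀ q v, v ≠ 0 → 0 < g q v v
  K_symm : ∀ q v w, K q v w = K q w v

variable (M) in
/-- A chart at infinity: a diffeomorphism `Φ` from the complement of a compact subset of `M` onto
`{x ∈ ℝ³ : |x| > R} = (R, ∞) × S²`, for some `R > 0`. -/
structure ChartAtInfinity where
  Φ : OpenPartialHomeomorph M E3
  smooth : Φ ∈ IsManifold.maximalAtlas 𝓘(ℝ, E3) ∞ M
  C : Set M
  isCompact : IsCompact C
  source_eq : Φ.source = Cᶜ
  R : ℝ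
  R_pos : 0 < R
  target_eq : Φ.target = {x | R < ‖x‖}

/-- The part `{r ≥ r₀}` of the end. -/
def ChartAtInfinity.outer (X : ChartAtInfinity M) (r₀ : ℝ) : Set M :=
  {q | q ∈ X.Φ.source ∧ r₀ ≤ ‖X.Φ q‖}

/-- The part `{r > r₀}` of the end. -/
def ChartAtInfinity.strictOuter (X : ChartAtInfinity M) (r₀ : ℝ) : Set M :=
  {q | q ∈ X.Φ.source ∧ r₀ < ‖X.Φ q‖}

/-- `(M, g, K)` is asymptotically hyperbolic of type `(l, β, τ, τ₀)` with respect to the chart at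
infinity `X`. -/
structure IsAsymptoticallyHyperbolic (D : InitialData M) (X : ChartAtInfinity M)
    (l : ℕ) (β τ τ₀ : ℝ) : Prop where
  two_le_l : 2 ≤ l
  beta_nonneg : 0 ≤ β
  beta_lt_one : β < 1
  tau_gt : 3 / 2 < τ
  tau_zero_pos : 0 < τ₀
  g_regular : IsHolderTensor l β D.g
  K_regular : IsHolderTensor (l - 1) β D.K
  g_decay : WeightedTensor l β τ fun x => pushTensor X.Φ D.g x - hyp x
  K_decay : WeightedTensor (l - 1) β τ fun x => pushTensor X.Φ D.K x - pushTensor X.Φ D.g x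
  mass_decay : WeightedFun (l - 2) β (3 + τ₀)
    (massDensity (pushTensor X.Φ D.g) (pushTensor X.Φ D.K))
  current_decay : WeightedForm (l - 2) β (3 + τ₀)
    (currentDensity (pushTensor X.Φ D.g) (pushTensor X.Φ D.K))

/-- The projection of `ℝ³ = T_x ℝ³` onto the tangent space `x^⊥` of the sphere through `x`. -/
def tanProj (x : E3) : E3 →L[ℝ] E3 :=
  ContinuousLinearMap.id ℝ E3 - (‖x‖ ^ 2)⁻¹ • (innerSL ℝ x : E3 →L[ℝ] ℝ).smulRight x

/-- The initial data set has Wang's asymptotics in the chart `X`, with leading coefficients the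
tensors `m`, `p` on `S²`:
`Φ_* g = dr²/(1+r²) + r² (σ + m r⁻³ + O^{l,β}(r⁻⁴))` and
`Φ_* (K - b) = p r⁻¹ + O^{l-1,β}(r⁻²)` on vectors tangent to the spheres `{r = const}`.
A tangent vector `v` of `ℝ³` at `x` projects to the tangent vector `tanProj x v / |x|` of `S²`,
hence the pullback to `ℝ³` of a tensor `m` on `S²` is `|x|⁻² m`, and `r⁻¹ m`, `r⁻¹ p` become
`|x|⁻³ m`, `|x|⁻³ p`. The remainder terms are those of sphere components `O(r⁻²)`, that is of
hyperbolic norm `O(r⁻⁴)`; the one of the metric has no radial components. -/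
structure HasWangAsymptotics (D : InitialData M) (X : ChartAtInfinity M)
    (l : ℕ) (β τ₀ : ℝ) (m p : S2 → Bil) : Prop where
  ah : IsAsymptoticallyHyperbolic D X l β 3 τ₀
  m_tensor : IsSphereTensor l β m
  p_tensor : IsSphereTensor (l - 1) β p
  g_radial : ∀ x, X.R < ‖x‖ → ∀ v, pushTensor X.Φ D.g x x v = hyp x x v
  g_expansion : WeightedTensor l β 4 fun x =>
    pushTensor X.Φ D.g x - hyp x - (‖x‖ ^ 3)⁻¹ • m (sphereDir x)
  K_expansion : WeightedTensor (l - 1) β 4 fun x =>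
    (pushTensor X.Φ D.K x - hyp x).bilinearComp (tanProj x) (tanProj x)
      - (‖x‖ ^ 3)⁻¹ • p (sphereDir x)

/-! ### Barriers -/

/-- The left hand side `𝒥(f)` of the Jang equation at the point `q`, computed in the coordinates
given by the chart at infinity. -/
def jangAt (D : InitialData M) (X : ChartAtInfinity M) (f : M → ℝ) (q : M) : ℝ :=
  jang (pushTensor X.Φ D.g) (pushTensor X.Φ D.K) (fun x => f (X.Φ.symm x)) (X.Φ q)

/-- The radial derivative `∂_r f` at the point with coordinates `(r, θ)`. -/
def radialDeriv (X : ChartAtInfinity M) (f : M → ℝ) (θ : S2) (r : ℝ) : ℝ :=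
  deriv (fun s : ℝ => f (X.Φ.symm (s • (θ : E3)))) r

/-- `f` is continuous on `{r ≥ r₀}` and `C²` on `{r > r₀}`. -/
def IsBarrierRegular (X : ChartAtInfinity M) (r₀ : ℝ) (f : M → ℝ) : Prop :=
  ContinuousOn f (X.outer r₀) ∧ ContMDiffOn 𝓘(ℝ, E3) 𝓘(ℝ, ℝ) 2 f (X.strictOuter r₀)

/-- Upper barriers: `∂_r f = -∞` at `r = r₀`, and `𝒥(f) < 0` for `r > r₀`. -/
structure IsUpperBarrier (D : InitialData M) (X : ChartAtInfinity M) (r₀ : ℝ) (f : M → ℝ) :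
    Prop where
  regular : IsBarrierRegular X r₀ f
  slope : ∀ θ : S2, Tendsto (radialDeriv X f θ) (𝓝[>] r₀) atBot
  strict : ∀ q ∈ X.strictOuter r₀, jangAt D X f q < 0

/-- Lower barriers: `∂_r f = +∞` at `r = r₀`, and `𝒥(f) > 0` for `r > r₀`. -/
structure IsLowerBarrier (D : InitialData M) (X : ChartAtInfinity M) (r₀ : ℝ) (f : M → ℝ) :
    Prop where
  regular : IsBarrierRegular X r₀ f
  slope : ∀ θ : S2, Tendsto (radialDeriv X f θ) (𝓝[>] r₀) atTop
  strict : ∀ q ∈ X.strictOuter r₀, 0 < jangAt D X f q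

/-- `f = √(1+r²) + α ln r + ψ(θ) + O(r^{-1+ε})` as `r → ∞`, uniformly in the angular variable
`θ ∈ S²`. -/
def HasBarrierAsymptotics (X : ChartAtInfinity M) (α : ℝ) (ψ : S2 → ℝ) (ε : ℝ) (f : M → ℝ) :
    Prop :=
  ∃ A r₁ : ℝ, ∀ q ∈ X.outer r₁,
    |f q - (Real.sqrt (1 + ‖X.Φ q‖ ^ 2) + α * Real.log ‖X.Φ q‖ + ψ (sphereDir (X.Φ q)))|
      ≤ A * ‖X.Φ q‖ ^ (-1 + ε)

end Jang

end

noncomputable section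

namespace Jang

/-! The barriers are graphs `f = φ(r) + ψ(θ)` with the given `ψ`, so only a radial profile has to be
found. Its slope is encoded in `k = u/√(1+u²)` with `u = √(1+r²) φ'`. A vertical slope is then the
finite value `k = ±1`, and the second-order Jang operator becomes a first-order expression in `k`.

Put `y = 1/r`, `z = √(1+r²)/r`, `s = √(1-k²)`, `k₁ = √(1+r²) k'`. In a metric-orthonormal frame
adapted to the spheres, `jang_estimate` yields `𝒥(f) = k₁ - s² + 2kz - 2 + s y² Δψ - y³ (½ tr m + tr
p) + O(y² (|k₁| + 1 - k) + y⁴)`. The hyperboloid `φ = √(1+r²)`, that is `k = 1/z`, annihilates `k₁ -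
s² + 2kz - 2` exactly. Adding `α y³` to `k` creates the term `α ln r` of `φ` and contributes `α y³`
to the operator. Since `s ≈ y`, the equation for `ψ` says precisely that the terms of order `y³`
cancel. For `k = 1/z + α y³ + d` there remains `r d' + 4d + d²`, up to `O(y⁴ + y|d|)`
(`radial_estimate`, `slope_error_le`).

Solutions of the linear equation `r d' + 4d = 0` decay like `r⁻⁴`. A `d` decaying like `r^(-4+ε)`
leaves a term `ε d` of definite sign, which beats the error once `r₀` is large. For the lower
barrier `d > 0` is a pure power and `d²` helps (`exists_lower_barrierSlope`). For the upper barrier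
`d < 0` is close to `-2` at `r₀` and `d²` has the wrong sign, so the power is replaced by a solution
of a logistic equation (`exists_upper_barrierSlope`). In both cases the amplitude is fixed by `k(r₀)
= ∓1`.

The profile is recovered by integrating its slope. As `k` reaches `±1` transversally, the slope
blows up only like `(r-r₀)^(-1/2)`, so `φ` stays continuous. At infinity the slope is `r/√(1+r²) +
α/r + O(r^(-2+ε))` (`slope_expansion`), and the integrable remainder is integrated from infinity.
Both barriers thus agree at infinity, and the ordering of their slopes orders the functions. -/

lemma innerSL_real (v w : E3) : (innerSL ℝ : Bil) v w = inner ℝ v w := rfl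

lemma innerBil_apply (v w : E3) : innerBil v w = inner ℝ v w := rfl

/-! ### The Jang operator in an orthonormal frame -/

lemma sum_smul_stdVec (v : E3) : ∑ i, v i • stdVec i = v := by
  ext j
  simp [stdVec, Fin.sum_univ_three]
  fin_cases j <;> simp

lemma form_sum (a : E3 →L[ℝ] ℝ) (v : E3) : a v = ∑ i, v i * a (stdVec i) := by
  conv_lhs => rw [← sum_smul_stdVec v]
  simp [map_sum]

lemma bil_sum (B : Bil) (v w : E3) :
    B v w = ∑ i, ∑ j, v i * w j * B (stdVec i) (stdVec j) := by
  have h1 : B v w = ∑ i, v i * B (stdVec i) w := by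
    conv_lhs => rw [← sum_smul_stdVec v]
    simp [map_sum]
  rw [h1]
  refine Finset.sum_congr rfl fun i _ => ?_
  rw [form_sum (B (stdVec i)) w, Finset.mul_sum]
  exact Finset.sum_congr rfl fun j _ => by ring

/-- A frame `n` of `ℝ³` that is orthonormal for the bilinear form `B`. -/
def IsFrame (B : Bil) (n : Fin 3 → E3) : Prop :=
  ∀ i j, B (n i) (n j) = if i = j then 1 else 0

/-- Orthonormality reads `P A Pᵀ = 1` for the matrix `P` of the frame. One-sided inverses of square
matrices are two-sided, so `A⁻¹ = Pᵀ P`. This turns every contraction with the inverse metric into a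
sum over the frame. -/
lemma ginv_eq_sum {G : E3 → Bil} {x : E3} {n : Fin 3 → E3} (h : IsFrame (G x) n) (a b : Fin 3) :
    ginv G a b x = ∑ i, n i a * n i b := by
  set P : Matrix (Fin 3) (Fin 3) ℝ := Matrix.of fun i a => n i a with hP
  set A : Matrix (Fin 3) (Fin 3) ℝ := Matrix.of fun a b => comp G a b x with hA
  have h1 : P * A * P.transpose = 1 := by
    ext i j
    have := h i j
    rw [bil_sum] at this
    rw [Matrix.one_apply, ← this]
    simp only [Matrix.mul_apply, Matrix.transpose_apply, hP, hA, Matrix.of_apply, comp,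
      Fin.sum_univ_three]
    ring
  have h2 : P.transpose * P * A = 1 := by
    rw [Matrix.mul_assoc]
    exact mul_eq_one_comm.mp h1
  have h3 : A⁻¹ = P.transpose * P := Matrix.inv_eq_left_inv h2
  change A⁻¹ a b = _
  rw [h3]
  simp [Matrix.mul_apply, hP]

lemma sum_ginv_mul {G : E3 → Bil} {x : E3} {n : Fin 3 → E3} (h : IsFrame (G x) n) (T : Bil) :
    ∑ a, ∑ b, ginv G a b x * T (stdVec a) (stdVec b) = ∑ i, T (n i) (n i) := by
  have h1 : ∀ i, T (n i) (n i) =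
      ∑ a, ∑ b, n i a * n i b * T (stdVec a) (stdVec b) := fun i => bil_sum T _ _
  simp only [h1, ginv_eq_sum h, Fin.sum_univ_three]
  ring

/-- The trace of a bilinear form does not depend on the orthonormal basis. -/
lemma sum_stdVec_eq_sum {n : Fin 3 → E3} (hn : Orthonormal ℝ n) (T : Bil) :
    ∑ a, T (stdVec a) (stdVec a) = ∑ i, T (n i) (n i) := by
  have h : IsFrame ((fun _ : E3 => innerBil) 0) n := by
    intro i j
    have := orthonormal_iff_ite.mp hn i j
    exact this
  have hs : IsFrame ((fun _ : E3 => innerBil) 0) stdVec := by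
    intro i j
    simp only [innerBil_apply, stdVec]
    fin_cases i <;> fin_cases j <;> simp [EuclideanSpace.inner_single_left]
  rw [← sum_ginv_mul (G := fun _ => innerBil) (x := 0) h T,
    ← sum_ginv_mul (G := fun _ => innerBil) (x := 0) hs T]

/-- The gradient of `f` with respect to the frame `n`. -/
def frameGrad (f : E3 → ℝ) (n : Fin 3 → E3) (x : E3) : E3 := ∑ i, fderiv ℝ f x (n i) • n i

/-- The Hessian of `f` as a bilinear form, where `Z` is the gradient of `f`. -/
def hessBil (G : E3 → Bil) (f : E3 → ℝ) (Z x : E3) : Bil :=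
  let A : Bil := (ContinuousLinearMap.compL ℝ E3 (E3 →L[ℝ] ℝ) ℝ
    (ContinuousLinearMap.apply ℝ ℝ Z)).comp (fderiv ℝ G x)
  fderiv ℝ (fderiv ℝ f) x - (1 / 2 : ℝ) • (A + A.flip - fderiv ℝ G x Z)

lemma hessBil_apply (G : E3 → Bil) (f : E3 → ℝ) (Z x v w : E3) : hessBil G f Z x v w =
    fderiv ℝ (fderiv ℝ f) x v w -
      (1 / 2) * (fderiv ℝ G x v w Z + fderiv ℝ G x w v Z - fderiv ℝ G x Z v w) := by
  simp [hessBil]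

/-- The derivative of a component of a field of bilinear forms. -/
lemma fderiv_bil_apply {G : E3 → Bil} {x : E3} (hG : DifferentiableAt ℝ G x) (z v w : E3) :
    fderiv ℝ (fun y => G y v w) x z = fderiv ℝ G x z v w := by
  have h1 := (hG.hasFDerivAt.clm_apply (hasFDerivAt_const v x)).clm_apply (hasFDerivAt_const w x)
  rw [h1.fderiv]
  simp

lemma fderiv_form_apply {a : E3 → E3 →L[ℝ] ℝ} {x : E3} (ha : DifferentiableAt ℝ a x) (z v : E3) :
    fderiv ℝ (fun y => a y v) x z = fderiv ℝ a x z v := by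
  rw [(ha.hasFDerivAt.clm_apply (hasFDerivAt_const v x)).fderiv]
  simp

lemma frameGrad_apply (f : E3 → ℝ) (n : Fin 3 → E3) (x : E3) (a : Fin 3) :
    frameGrad f n x a = ∑ i, fderiv ℝ f x (n i) * n i a := by
  simp [frameGrad]

lemma gradUp_eq_frameGrad {G : E3 → Bil} {f : E3 → ℝ} {x : E3} {n : Fin 3 → E3}
    (h : IsFrame (G x) n) (a : Fin 3) : gradUp G f a x = frameGrad f n x a := by
  rw [frameGrad_apply]
  have : ∀ i, fderiv ℝ f x (n i) = ∑ j, n i j * fderiv ℝ f x (stdVec j) :=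
    fun i => form_sum _ _
  simp only [gradUp, ginv_eq_sum h, pd, this, Fin.sum_univ_three]
  ring

lemma normSqDf_eq_sum {G : E3 → Bil} {f : E3 → ℝ} {x : E3} {n : Fin 3 → E3}
    (h : IsFrame (G x) n) : normSqDf G f x = ∑ i, fderiv ℝ f x (n i) ^ 2 := by
  have : ∀ i, fderiv ℝ f x (n i) = ∑ j, n i j * fderiv ℝ f x (stdVec j) :=
    fun i => form_sum _ _
  simp only [normSqDf, ginv_eq_sum h, pd, this, Fin.sum_univ_three]
  ring

lemma pd_comp {G : E3 → Bil} {x : E3} (hG : DifferentiableAt ℝ G x) (i j m : Fin 3) :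
    pd i (comp G j m) x = fderiv ℝ G x (stdVec i) (stdVec j) (stdVec m) :=
  fderiv_bil_apply hG _ _ _

lemma pd_pd {f : E3 → ℝ} {x : E3} (hf : DifferentiableAt ℝ (fderiv ℝ f) x) (i j : Fin 3) :
    pd i (pd j f) x = fderiv ℝ (fderiv ℝ f) x (stdVec i) (stdVec j) :=
  fderiv_form_apply hf _ _

/-- Raising the index of `df` uses up the inverse metric inside the Christoffel symbols, and only
first derivatives of `G` with `Z` in one slot remain. -/
lemma hess_eq_hessBil {G : E3 → Bil} {f : E3 → ℝ} {x : E3} {n : Fin 3 → E3}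
    (h : IsFrame (G x) n) (hG : DifferentiableAt ℝ G x)
    (hf : DifferentiableAt ℝ (fderiv ℝ f) x) (i j : Fin 3) :
    hess G f i j x = hessBil G f (frameGrad f n x) x (stdVec i) (stdVec j) := by
  set Z := frameGrad f n x with hZ
  have hZa : ∀ m, ∑ k, ginv G k m x * pd k f x = Z m := by
    intro m
    rw [hZ, ← gradUp_eq_frameGrad h m]
    refine Finset.sum_congr rfl fun k _ => ?_
    rw [ginv_eq_sum h, ginv_eq_sum h]
    simp only [mul_comm]
  have h1 : ∑ k, christoffel G k i j x * pd k f x = (1 / 2) * ∑ m, Z m *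
      (pd i (comp G j m) x + pd j (comp G i m) x - pd m (comp G i j) x) := by
    simp only [← hZa, christoffel, Fin.sum_univ_three]
    ring
  have h2 : fderiv ℝ G x Z (stdVec i) (stdVec j) =
      ∑ m, Z m * fderiv ℝ G x (stdVec m) (stdVec i) (stdVec j) := by
    conv_lhs => rw [← sum_smul_stdVec Z]
    simp [map_sum]
  rw [hess, h1, hessBil_apply, pd_pd hf, form_sum (fderiv ℝ G x (stdVec i) (stdVec j)) Z,
    form_sum (fderiv ℝ G x (stdVec j) (stdVec i)) Z, h2]
  simp only [pd_comp hG, Fin.sum_univ_three]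
  ring

/-- The Jang operator in a `g`-orthonormal frame: with `Z = ∇f`, `W² = 1 + |df|²` and
`T = Hess f / W - K`, it is `∑ T(nᵢ, nᵢ) - T(Z, Z) / W²`. -/
lemma jang_eq_frame {G K : E3 → Bil} {f : E3 → ℝ} {x : E3} {n : Fin 3 → E3}
    (h : IsFrame (G x) n) (hG : DifferentiableAt ℝ G x)
    (hf : DifferentiableAt ℝ (fderiv ℝ f) x) {W : ℝ} (hW : 0 < W)
    (hW2 : W ^ 2 = 1 + ∑ i, fderiv ℝ f x (n i) ^ 2) :
    jang G K f x =
      ∑ i, (hessBil G f (frameGrad f n x) x (n i) (n i) / W - K x (n i) (n i))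
      - (hessBil G f (frameGrad f n x) x (frameGrad f n x) (frameGrad f n x) / W
          - K x (frameGrad f n x) (frameGrad f n x)) / W ^ 2 := by
  set Z := frameGrad f n x with hZ
  set T : Bil := W⁻¹ • hessBil G f Z x - K x with hTdef
  have hT : ∀ v w, hessBil G f Z x v w / W - K x v w = T v w := fun v w => by
    simp [hTdef, div_eq_inv_mul]
  simp only [hT]
  rw [← sum_ginv_mul h T, bil_sum T Z Z]
  have hN : 1 + normSqDf G f x = W ^ 2 := by rw [normSqDf_eq_sum h, hW2]
  simp only [jang, hess_eq_hessBil h hG hf, gradUp_eq_frameGrad h, hN, Real.sqrt_sq hW.le, comp, ← hZ, hT,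
    Fin.sum_univ_three]
  ring

instance instIsBoundedSMulBil : IsBoundedSMul ℝ Bil :=
  IsBoundedSMul.of_norm_smul_le fun r x => (ContinuousLinearMap.opNorm_smul_le r x)

lemma hasFDerivAt_inner_left (v x : E3) :
    HasFDerivAt (fun y : E3 => (inner ℝ y v : ℝ)) ((innerSL ℝ : Bil) v) x := by
  have : (fun y : E3 => (inner ℝ y v : ℝ)) = fun y => (innerSL ℝ : Bil) v y :=
    funext fun y => real_inner_comm _ _
  rw [this]
  exact ((innerSL ℝ : Bil) v).hasFDerivAt

/-! ### The hyperbolic metric and the boosts -/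

lemma hyp_apply (x v w : E3) :
    hyp x v w = inner ℝ v w - inner ℝ x v * inner ℝ x w / (1 + ‖x‖ ^ 2) := by
  simp only [hyp, sub_apply, smul_apply, innerBil_apply,
    ContinuousLinearMap.smulRight_apply, innerSL_real, smul_eq_mul]
  ring

lemma contDiff_hyp : ContDiff ℝ ∞ hyp := by
  have h1 : ContDiff ℝ ∞ (fun y : E3 => (1 / (1 + ‖y‖ ^ 2) : ℝ)) :=
    contDiff_const.div (contDiff_const.add (contDiff_norm_sq ℝ)) fun y => by positivity
  have h2 : ContDiff ℝ ∞ (fun y : E3 => (innerSL ℝ : Bil) y) := (innerSL ℝ : Bil).contDiff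
  have h3 : ContDiff ℝ ∞ (fun y : E3 => ((innerSL ℝ : Bil) y).smulRight ((innerSL ℝ : Bil) y)) :=
    ContDiff.smulRight h2 h2
  exact ContDiff.sub (F := Bil) contDiff_const (ContDiff.smul (F := Bil) h1 h3)

lemma differentiableAt_hyp (x : E3) : DifferentiableAt ℝ hyp x :=
  contDiff_hyp.differentiable (by simp) x

lemma fderiv_hyp_apply (x z v w : E3) :
    fderiv ℝ hyp x z v w =
      - (inner ℝ z v * inner ℝ x w + inner ℝ x v * inner ℝ z w) / (1 + ‖x‖ ^ 2)
      + 2 * inner ℝ x z * inner ℝ x v * inner ℝ x w / (1 + ‖x‖ ^ 2) ^ 2 := by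
  have hx : (1 + ‖x‖ ^ 2 : ℝ) ≠ 0 := by positivity
  rw [← fderiv_bil_apply (differentiableAt_hyp x)]
  have ha := fun v : E3 => hasFDerivAt_inner_left v x
  have hn := (hasDerivAt_inv hx).comp_hasFDerivAt x
    ((hasStrictFDerivAt_norm_sq x).hasFDerivAt.const_add 1)
  have h := (((ha v).mul (ha w)).mul hn).const_sub (inner ℝ v w : ℝ)
  have he : (fun y => hyp y v w) = fun y => (inner ℝ v w : ℝ) - inner ℝ y v * inner ℝ y w *
      (1 + ‖y‖ ^ 2)⁻¹ := by
    funext y; rw [hyp_apply]; ring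
  rw [he]
  refine (DFunLike.congr_fun (HasFDerivAt.fderiv h) z).trans ?_
  simp [innerSL_real, real_inner_comm z]
  field_simp
  ring

lemma hasFDerivAt_boost (p y : E3) : HasFDerivAt (boost p)
    (ContinuousLinearMap.id ℝ E3
      + ((1 / (2 * √(1 + ‖y‖ ^ 2))) • (2 : ℕ) • (innerSL ℝ : Bil) y).smulRight p
      + ((1 + √(1 + ‖p‖ ^ 2))⁻¹ • (innerSL ℝ : Bil) p).smulRight p) y := by
  have hy : (1 + ‖y‖ ^ 2 : ℝ) ≠ 0 := by positivity
  have h1 := (((hasStrictFDerivAt_norm_sq y).hasFDerivAt.const_add 1).sqrt hy).smul_const p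
  have h2 := (((innerSL ℝ : Bil) p).hasFDerivAt (x := y)).mul_const (1 + √(1 + ‖p‖ ^ 2))⁻¹
  have := ((hasFDerivAt_id y).add h1).add (h2.smul_const p)
  exact this

lemma fderiv_boost_apply (p y v : E3) : fderiv ℝ (boost p) y v =
    v + (inner ℝ y v * (√(1 + ‖y‖ ^ 2))⁻¹) • p + (inner ℝ p v / (1 + √(1 + ‖p‖ ^ 2))) • p := by
  rw [(hasFDerivAt_boost p y).fderiv]
  simp only [add_apply, ContinuousLinearMap.smulRight_apply,
    smul_apply, innerSL_real, ContinuousLinearMap.id_apply, smul_eq_mul]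
  congr 2
  · congr 1
    simp
    field_simp
  · rw [div_eq_inv_mul]

lemma boost_zero (p : E3) : boost p 0 = p := by simp [boost]

/-- Only the term `√(1+|y|²) p` of the boost is nonlinear in `y`, and its second derivative at `0`
is `⟨v, ·⟩ p`. This is the correction term in the product rule for pulled back tensors. -/
lemma hasFDerivAt_fderiv_boost (p v : E3) :
    HasFDerivAt (fun y => fderiv ℝ (boost p) y v) (((innerSL ℝ : Bil) v).smulRight p) 0 := by
  have h0 : (1 + ‖(0 : E3)‖ ^ 2 : ℝ) ≠ 0 := by positivity
  have ha := hasFDerivAt_inner_left v 0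
  have hs := ((hasStrictFDerivAt_norm_sq (0 : E3)).hasFDerivAt.const_add 1).sqrt h0
  have hi := (hasDerivAt_inv (by simp)).comp_hasFDerivAt (0 : E3) hs
  have h := (((ha.mul hi).smul_const p).const_add v).add_const
    ((inner ℝ p v / (1 + √(1 + ‖p‖ ^ 2))) • p)
  have he : (fun y => fderiv ℝ (boost p) y v) = _ := funext fun y => fderiv_boost_apply p y v
  rw [he]
  refine HasFDerivAt.congr_fderiv h ?_
  ext1 z
  simp [innerSL_real]

/-- Together with `fderiv_boost_zero_self`: at the origin the boost fixes tangential vectors and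
stretches the radial one by `√(1+|p|²)`. It therefore carries a Euclidean orthonormal frame adapted
to `p` to a hyperbolic one, which makes weighted norms readable as component bounds. -/
lemma fderiv_boost_zero_tangent {p v : E3} (h : inner ℝ p v = 0) : fderiv ℝ (boost p) 0 v = v := by
  simp [fderiv_boost_apply, h]

lemma fderiv_boost_zero_self (p : E3) :
    fderiv ℝ (boost p) 0 p = √(1 + ‖p‖ ^ 2) • p := by
  rw [fderiv_boost_apply]
  have hs : √(1 + ‖p‖ ^ 2) ^ 2 = 1 + ‖p‖ ^ 2 := Real.sq_sqrt (by positivity)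
  have hp : 0 < 1 + √(1 + ‖p‖ ^ 2) := by positivity
  simp only [inner_zero_left, zero_mul, zero_smul, add_zero, real_inner_self_eq_norm_sq]
  rw [← one_smul ℝ p, smul_smul, ← add_smul, smul_smul]
  congr 1
  simp only [one_smul]
  field_simp
  linarith

/-- Values and first derivatives at `x` of a tensor in `C^{k,β}_n`, in the frame given by the
boost. -/
lemma WeightedTensor.bound {k : ℕ} {β : ℝ} {n : ℕ} {T : E3 → Bil}
    (h : WeightedTensor k β n T) : ∃ A R : ℝ, 0 ≤ A ∧ 1 ≤ R ∧ ∀ x : E3, R ≤ ‖x‖ → ∀ v w,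
      |T x (fderiv ℝ (boost x) 0 v) (fderiv ℝ (boost x) 0 w)| ≤ A * ‖x‖⁻¹ ^ n * ‖v‖ * ‖w‖ := by
  obtain ⟨A, R, h⟩ := h
  refine ⟨|A|, max R 1, abs_nonneg _, le_max_right _ _, fun x hx v w => ?_⟩
  obtain ⟨-, h1, -⟩ := h x ((le_max_left _ _).trans hx)
  have h2 := h1 0 (Nat.zero_le _) 0 (by simp)
  have hx0 : 0 < ‖x‖ := lt_of_lt_of_le one_pos ((le_max_right _ _).trans hx)
  rw [norm_iteratedFDeriv_zero] at h2
  beta_reduce at h2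
  rw [boost_zero, Real.rpow_neg hx0.le, Real.rpow_natCast, ← inv_pow] at h2
  have h3 := ContinuousLinearMap.le_opNorm₂ ((T x).bilinearComp (fderiv ℝ (boost x) 0)
    (fderiv ℝ (boost x) 0)) v w
  rw [ContinuousLinearMap.bilinearComp_apply, Real.norm_eq_abs] at h3
  refine h3.trans ?_
  have : A * ‖x‖⁻¹ ^ n ≤ |A| * ‖x‖⁻¹ ^ n := by gcongr; exact le_abs_self A
  gcongr
  exact h2.trans this

/-- The product rule for the pulled back tensor gives the wanted derivative plus two terms in which
the second derivative of the boost puts `x` into a slot of `T`. As `x` is the image of a vector of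
length at most `1`, these two are controlled by `WeightedTensor.bound`; hence the constant `|A| + 2
A₀`. -/
lemma WeightedTensor.fderiv_bound {k : ℕ} {β : ℝ} {n : ℕ} {T : E3 → Bil} (hk : 1 ≤ k)
    (h : WeightedTensor k β n T) {R₀ : ℝ} (hT : ∀ x : E3, R₀ < ‖x‖ → DifferentiableAt ℝ T x) :
    ∃ A R : ℝ, 0 ≤ A ∧ 1 ≤ R ∧ ∀ x : E3, R ≤ ‖x‖ → ∀ z v w,
      |fderiv ℝ T x (fderiv ℝ (boost x) 0 z) (fderiv ℝ (boost x) 0 v) (fderiv ℝ (boost x) 0 w)|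
        ≤ A * ‖x‖⁻¹ ^ n * ‖z‖ * ‖v‖ * ‖w‖ := by
  obtain ⟨A₀, R₁, hA₀, hR₁, h0⟩ := h.bound
  obtain ⟨A, R, h⟩ := h
  refine ⟨|A| + 2 * A₀, max (max R R₁) (R₀ + 1), by positivity,
    hR₁.trans ((le_max_right _ _).trans (le_max_left _ _)), fun x hx z v w => ?_⟩
  have hxR : R ≤ ‖x‖ := ((le_max_left _ _).trans (le_max_left _ _)).trans hx
  have hxR₁ : R₁ ≤ ‖x‖ := ((le_max_right _ _).trans (le_max_left _ _)).trans hx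
  have hx0 : 0 < ‖x‖ := by linarith
  have hTx := hT x (by linarith [(le_max_right _ _).trans hx])
  obtain ⟨hc, h1, -⟩ := h x hxR
  have h2 := h1 1 hk 0 (by simp)
  set u : E3 → Bil := fun y =>
    (T (boost x y)).bilinearComp (fderiv ℝ (boost x) y) (fderiv ℝ (boost x) y) with hu
  have hud : DifferentiableAt ℝ u 0 :=
    (hc.contDiffAt (Metric.ball_mem_nhds _ one_pos)).differentiableAt (by exact_mod_cast (by omega))
  rw [norm_iteratedFDeriv_one, Real.rpow_neg hx0.le, Real.rpow_natCast, ← inv_pow] at h2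
  have hT' : HasFDerivAt (fun y => T (boost x y))
      ((fderiv ℝ T x).comp (fderiv ℝ (boost x) 0)) 0 := by
    have hb : HasFDerivAt (boost x) (fderiv ℝ (boost x) 0) 0 :=
      (hasFDerivAt_boost x 0).differentiableAt.hasFDerivAt
    have hT0 : HasFDerivAt T (fderiv ℝ T x) (boost x 0) := by
      rw [boost_zero]
      exact hTx.hasFDerivAt
    exact HasFDerivAt.comp (F := E3) (G := Bil) (0 : E3) hT0 hb
  have h3 := (hT'.clm_apply (hasFDerivAt_fderiv_boost x v)).clm_apply
    (hasFDerivAt_fderiv_boost x w)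
  have h4 := fderiv_bil_apply hud z v w
  have hvw : (fun y => u y v w) = fun y => T (boost x y) (fderiv ℝ (boost x) y v)
    (fderiv ℝ (boost x) y w) := rfl
  rw [hvw, h3.fderiv] at h4
  simp only [add_apply, ContinuousLinearMap.comp_apply,
    ContinuousLinearMap.flip_apply, ContinuousLinearMap.smulRight_apply, innerSL_real,
    boost_zero, map_smul, smul_apply, smul_eq_mul] at h4
  have hself : ∃ a : E3, fderiv ℝ (boost x) 0 a = x ∧ ‖a‖ ≤ 1 := by
    have hs : 0 < √(1 + ‖x‖ ^ 2) := by positivity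
    refine ⟨(√(1 + ‖x‖ ^ 2))⁻¹ • x, ?_, ?_⟩
    · rw [map_smul, fderiv_boost_zero_self, smul_smul, inv_mul_cancel₀ hs.ne', one_smul]
    · rw [norm_smul, norm_inv, Real.norm_of_nonneg hs.le, inv_mul_le_iff₀ hs, mul_one]
      exact Real.le_sqrt_of_sq_le (by linarith)
  obtain ⟨a, ha, ha1⟩ := hself
  have h5 : |fderiv ℝ u 0 z v w| ≤ |A| * ‖x‖⁻¹ ^ n * ‖z‖ * ‖v‖ * ‖w‖ := by
    have e1 := ContinuousLinearMap.le_opNorm₂ (fderiv ℝ u 0 z) v w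
    have e2 := ContinuousLinearMap.le_opNorm (fderiv ℝ u 0) z
    rw [Real.norm_eq_abs] at e1
    have : A * ‖x‖⁻¹ ^ n ≤ |A| * ‖x‖⁻¹ ^ n := by gcongr; exact le_abs_self A
    refine e1.trans ?_
    gcongr
    refine e2.trans ?_
    gcongr
    exact h2.trans this
  have hb1 : |inner ℝ w z * T x (fderiv ℝ (boost x) 0 v) x| ≤ A₀ * ‖x‖⁻¹ ^ n * ‖z‖ * ‖v‖ * ‖w‖ := by
    have e1 := h0 x hxR₁ v a
    rw [ha] at e1
    rw [abs_mul]
    have e2 := abs_real_inner_le_norm w z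
    calc _ ≤ (‖w‖ * ‖z‖) * (A₀ * ‖x‖⁻¹ ^ n * ‖v‖ * ‖a‖) := by gcongr
      _ ≤ (‖w‖ * ‖z‖) * (A₀ * ‖x‖⁻¹ ^ n * ‖v‖ * 1) := by gcongr
      _ = _ := by ring
  have hb2 : |inner ℝ v z * T x x (fderiv ℝ (boost x) 0 w)| ≤ A₀ * ‖x‖⁻¹ ^ n * ‖z‖ * ‖v‖ * ‖w‖ := by
    have e1 := h0 x hxR₁ a w
    rw [ha] at e1
    rw [abs_mul]
    have e2 := abs_real_inner_le_norm v z
    calc _ ≤ (‖v‖ * ‖z‖) * (A₀ * ‖x‖⁻¹ ^ n * ‖a‖ * ‖w‖) := by gcongr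
      _ ≤ (‖v‖ * ‖z‖) * (A₀ * ‖x‖⁻¹ ^ n * 1 * ‖w‖) := by gcongr
      _ = _ := by ring
  have h6 : fderiv ℝ T x (fderiv ℝ (boost x) 0 z) (fderiv ℝ (boost x) 0 v)
      (fderiv ℝ (boost x) 0 w) = fderiv ℝ u 0 z v w
        - inner ℝ w z * T x (fderiv ℝ (boost x) 0 v) x
        - inner ℝ v z * T x x (fderiv ℝ (boost x) 0 w) := by
    rw [← h4]; ring
  rw [h6, show (|A| + 2 * A₀) * ‖x‖⁻¹ ^ n * ‖z‖ * ‖v‖ * ‖w‖ = |A| * ‖x‖⁻¹ ^ n * ‖z‖ * ‖v‖ * ‖w‖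
    + A₀ * ‖x‖⁻¹ ^ n * ‖z‖ * ‖v‖ * ‖w‖ + A₀ * ‖x‖⁻¹ ^ n * ‖z‖ * ‖v‖ * ‖w‖ by ring]
  exact (abs_sub _ _).trans (add_le_add ((abs_sub _ _).trans (add_le_add h5 hb1)) hb2)

/-! ### Homogeneous functions -/

section Homogeneous

variable {V : Type*} [NormedAddCommGroup V] [NormedSpace ℝ V]

/-- `F` is homogeneous of degree `-j` on `ℝ³ \ {0}`. -/
def IsHomog (j : ℕ) (F : E3 → V) : Prop :=
  ∀ c : ℝ, 0 < c → ∀ x : E3, x ≠ 0 → F (c • x) = (c ^ j)⁻¹ • F x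

/-- Differentiating `F(cx) = c⁻ʲ F(x)` in `x` produces a factor `c` on the left, which lowers the
degree by one. -/
lemma IsHomog.fderiv {j : ℕ} {F : E3 → V} (h : IsHomog j F)
    (hF : ∀ x ≠ 0, DifferentiableAt ℝ F x) : IsHomog (j + 1) (_root_.fderiv ℝ F) := by
  intro c hc x hx
  have hcx : c • x ≠ 0 := smul_ne_zero hc.ne' hx
  have h1 : HasFDerivAt (fun y : E3 => F (c • y))
      ((_root_.fderiv ℝ F (c • x)).comp (c • ContinuousLinearMap.id ℝ E3)) x :=
    HasFDerivAt.comp x (f := fun y : E3 => c • y) (hF _ hcx).hasFDerivAt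
      ((hasFDerivAt_id x).const_smul c)
  have h2 : HasFDerivAt (fun y : E3 => F (c • y)) ((c ^ j)⁻¹ • _root_.fderiv ℝ F x) x := by
    refine ((hF x hx).hasFDerivAt.const_smul (c ^ j)⁻¹).congr_of_eventuallyEq ?_
    filter_upwards [isOpen_ne.mem_nhds hx] with y hy
    exact h c hc y hy
  have h3 := h1.unique h2
  ext v
  have h4 := DFunLike.congr_fun h3 v
  simp only [ContinuousLinearMap.comp_apply, smul_apply, ContinuousLinearMap.id_apply,
    map_smul] at h4
  have h5 : _root_.fderiv ℝ F (c • x) v = c⁻¹ • (c ^ j)⁻¹ • _root_.fderiv ℝ F x v := by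
    rw [← h4, smul_smul, inv_mul_cancel₀ hc.ne', one_smul]
  rw [h5, smul_smul, smul_apply, pow_succ, mul_inv, mul_comm]

/-- The unit sphere is compact, and homogeneity propagates the bound on it along rays. This is how
regularity on `S²` becomes decay at infinity. -/
lemma IsHomog.bound {j : ℕ} {F : E3 → V} (h : IsHomog j F) (hF : ContinuousOn F {0}ᶜ) :
    ∃ C, 0 ≤ C ∧ ∀ x ≠ 0, ‖F x‖ ≤ C * ‖x‖⁻¹ ^ j := by
  have hs : Metric.sphere (0 : E3) 1 ⊆ {0}ᶜ := by
    intro x hx h0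
    simp only [mem_singleton_iff] at h0
    simp [h0] at hx
  obtain ⟨C, hC⟩ := (isCompact_sphere (0 : E3) 1).exists_bound_of_continuousOn (hF.mono hs)
  refine ⟨|C|, abs_nonneg _, fun x hx => ?_⟩
  have hn : 0 < ‖x‖ := norm_pos_iff.mpr hx
  have h1 : ‖x‖ • (‖x‖⁻¹ • x) = x := by rw [smul_smul, mul_inv_cancel₀ hn.ne', one_smul]
  have h2 := h ‖x‖ hn (‖x‖⁻¹ • x) (smul_ne_zero (inv_ne_zero hn.ne') hx)
  rw [h1] at h2
  rw [h2, norm_smul, norm_inv, norm_pow, norm_norm, ← inv_pow, mul_comm]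
  gcongr
  refine (hC _ ?_).trans (le_abs_self C)
  simp [norm_smul, hn.ne']

/-- Euler's relation: the derivative of `t ↦ F(tx)` at `t = 1`, computed in two ways. -/
lemma IsHomog.euler {j : ℕ} {F : E3 → V} (h : IsHomog j F) {x : E3} (hx : x ≠ 0)
    (hF : DifferentiableAt ℝ F x) : _root_.fderiv ℝ F x x = -(j : ℝ) • F x := by
  have h1 : HasDerivAt (fun t : ℝ => t • x) x 1 := by
    simpa using (hasDerivAt_id (1 : ℝ)).smul_const x
  have hF1 : HasFDerivAt F (_root_.fderiv ℝ F x) ((1 : ℝ) • x) := by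
    rw [one_smul]; exact hF.hasFDerivAt
  have h2 : HasDerivAt (fun t : ℝ => F (t • x)) (_root_.fderiv ℝ F x x) 1 :=
    hF1.comp_hasDerivAt (1 : ℝ) h1
  have h3 : HasDerivAt (fun t : ℝ => F (t • x)) (-(j : ℝ) • F x) 1 := by
    have h4 : HasDerivAt (fun t : ℝ => (t ^ j)⁻¹) (-(j : ℝ)) 1 := by
      have := (hasDerivAt_pow j (1 : ℝ)).inv (by simp)
      convert! this using 1
      simp
    refine (h4.smul_const (F x)).congr_of_eventuallyEq ?_
    filter_upwards [lt_mem_nhds (zero_lt_one' ℝ)] with t ht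
    exact h t ht x hx
  exact h2.unique h3

lemma IsHomog.fderiv_bound {j : ℕ} {F : E3 → V} (h : IsHomog j F) (hF : ContDiffOn ℝ 1 F {0}ᶜ) :
    ∃ C, 0 ≤ C ∧ ∀ x ≠ 0, ∀ z, ‖_root_.fderiv ℝ F x z‖ ≤ C * ‖x‖⁻¹ ^ (j + 1) * ‖z‖ := by
  have hd : ∀ x ≠ 0, DifferentiableAt ℝ F x := fun x hx =>
    (hF.contDiffAt (isOpen_compl_singleton.mem_nhds hx)).differentiableAt (by norm_num)
  obtain ⟨C, hC, hb⟩ := (h.fderiv hd).bound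
    (hF.continuousOn_fderiv_of_isOpen isOpen_compl_singleton le_rfl)
  refine ⟨C, hC, fun x hx z => ((_root_.fderiv ℝ F x).le_opNorm z).trans ?_⟩
  gcongr
  exact hb x hx

end Homogeneous

/-! ### Tensors and functions on the sphere, extended along rays -/

lemma sphereDir_coe {x : E3} (hx : x ≠ 0) : (sphereDir x : E3) = ‖x‖⁻¹ • x := by
  simp [sphereDir, hx]

lemma sphereDir_smul {c : ℝ} (hc : 0 < c) {x : E3} (hx : x ≠ 0) :
    sphereDir (c • x) = sphereDir x := by
  apply Subtype.ext
  rw [sphereDir_coe hx, sphereDir_coe (smul_ne_zero hc.ne' hx), norm_smul, smul_smul,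
    Real.norm_of_nonneg hc.le]
  congr 1
  field_simp

lemma sphereDir_sphere (θ : S2) : sphereDir (θ : E3) = θ := by
  have h1 : ‖(θ : E3)‖ = 1 := by simp
  have h0 : (θ : E3) ≠ 0 := norm_ne_zero_iff.mp (by simp)
  apply Subtype.ext
  rw [sphereDir_coe h0, h1, inv_one, one_smul]

lemma isOpen_compl_zero : IsOpen ({0}ᶜ : Set E3) := isOpen_compl_singleton

lemma IsSphereTensor.bound {k : ℕ} {β : ℝ} {m : S2 → Bil} (h : IsSphereTensor k β m) :
    ∃ C, 0 ≤ C ∧ ∀ θ v w, |m θ v w| ≤ C * ‖v‖ * ‖w‖ := by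
  have hh : IsHomog 0 (fun x => m (sphereDir x)) := by
    intro c hc x hx
    simp [sphereDir_smul hc hx]
  obtain ⟨C, hC, hb⟩ := hh.bound h.regular.1.continuousOn
  refine ⟨C, hC, fun θ v w => ?_⟩
  have h0 : (θ : E3) ≠ 0 := norm_ne_zero_iff.mp (by simp)
  have h1 := hb θ h0
  rw [sphereDir_sphere, pow_zero, mul_one] at h1
  have h2 := ContinuousLinearMap.le_opNorm₂ (m θ) v w
  rw [Real.norm_eq_abs] at h2
  exact h2.trans (by gcongr)

/-- The tensor `r⁻¹ m` on `ℝ³ \ {0}`. -/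
def extTensor (m : S2 → Bil) (x : E3) : Bil := (‖x‖ ^ 3)⁻¹ • m (sphereDir x)

lemma isHomog_extTensor (m : S2 → Bil) : IsHomog 3 (extTensor m) := by
  intro c hc x hx
  simp only [extTensor, sphereDir_smul hc hx, norm_smul, Real.norm_of_nonneg hc.le, mul_pow,
    mul_inv, smul_smul]

lemma IsSphereTensor.contDiffOn_extTensor {k : ℕ} {β : ℝ} {m : S2 → Bil}
    (h : IsSphereTensor k β m) : ContDiffOn ℝ k (extTensor m) {0}ᶜ := by
  have h1 : ContDiffOn ℝ k (fun x : E3 => (‖x‖ ^ 3)⁻¹) {0}ᶜ := by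
    have : ContDiffOn ℝ k (fun x : E3 => ‖x‖ ^ 3) {0}ᶜ := by
      refine ContDiffOn.pow ?_ 3
      exact contDiffOn_id.norm ℝ fun x hx => hx
    exact this.inv fun x hx => pow_ne_zero _ (norm_ne_zero_iff.mpr hx)
  exact ContDiffOn.smul (F := Bil) h1 h.regular.1

lemma IsSphereTensor.differentiableAt_extTensor {k : ℕ} {β : ℝ} {m : S2 → Bil}
    (h : IsSphereTensor k β m) (hk : 1 ≤ k) {x : E3} (hx : x ≠ 0) :
    DifferentiableAt ℝ (extTensor m) x :=
  (h.contDiffOn_extTensor.contDiffAt (isOpen_compl_zero.mem_nhds hx)).differentiableAt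
    (by exact_mod_cast (by omega))

lemma IsSphereTensor.fderiv_bound {k : ℕ} {β : ℝ} {m : S2 → Bil}
    (h : IsSphereTensor k β m) (hk : 1 ≤ k) :
    ∃ C, 0 ≤ C ∧ ∀ x ≠ 0, ∀ z v w,
      |fderiv ℝ (extTensor m) x z v w| ≤ C * ‖x‖⁻¹ ^ 4 * ‖z‖ * ‖v‖ * ‖w‖ := by
  obtain ⟨C, hC, hb⟩ := (isHomog_extTensor m).fderiv_bound
    (h.contDiffOn_extTensor.of_le (by exact_mod_cast hk))
  refine ⟨C, hC, fun x hx z v w => ?_⟩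
  have h2 := ContinuousLinearMap.le_opNorm₂ (fderiv ℝ (extTensor m) x z) v w
  rw [Real.norm_eq_abs] at h2
  refine h2.trans ?_
  gcongr
  exact hb x hx z

/-- The extension of a function on the sphere that is constant along rays. -/
def ext (ψ : S2 → ℝ) (x : E3) : ℝ := ψ (sphereDir x)

/-- The derivatives up to order two of the extension of a `C²` function on the sphere, with
Laplacian `Θ`. -/
structure ExtBounds (ψ : S2 → ℝ) (Θ : S2 → ℝ) (C : ℝ) : Prop where
  nonneg : 0 ≤ C
  diff : ∀ x ≠ 0, DifferentiableAt ℝ (ext ψ) x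
  diff2 : ∀ x ≠ 0, DifferentiableAt ℝ (fderiv ℝ (ext ψ)) x
  radial : ∀ x ≠ 0, fderiv ℝ (ext ψ) x x = 0
  bound1 : ∀ x ≠ 0, ∀ v, |fderiv ℝ (ext ψ) x v| ≤ C * ‖x‖⁻¹ * ‖v‖
  radial_left : ∀ x ≠ 0, ∀ v, fderiv ℝ (fderiv ℝ (ext ψ)) x x v = -fderiv ℝ (ext ψ) x v
  radial_right : ∀ x ≠ 0, ∀ v, fderiv ℝ (fderiv ℝ (ext ψ)) x v x = -fderiv ℝ (ext ψ) x v
  bound2 : ∀ x ≠ 0, ∀ v w, |fderiv ℝ (fderiv ℝ (ext ψ)) x v w| ≤ C * ‖x‖⁻¹ ^ 2 * ‖v‖ * ‖w‖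
  laplacian : ∀ x ≠ 0, ∀ n : Fin 3 → E3, Orthonormal ℝ n → n 0 = ‖x‖⁻¹ • x →
    fderiv ℝ (fderiv ℝ (ext ψ)) x (n 1) (n 1) + fderiv ℝ (fderiv ℝ (ext ψ)) x (n 2) (n 2)
      = ‖x‖⁻¹ ^ 2 * Θ (sphereDir x)

/-- The extension has degree `0`, so its first two derivatives have degrees `-1` and `-2`;
`IsHomog.bound` gives the bounds and `IsHomog.euler` the radial identities. The second radial
derivative vanishes, so the Euclidean Laplacian at a point of the sphere is the trace over the two
tangential directions. -/
lemma exists_extBounds {ψ : S2 → ℝ} (hψ : ContDiffOn ℝ 2 (ext ψ) {0}ᶜ) :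
    ∃ C, ExtBounds ψ (sphereLaplacian ψ) C := by
  have h0 : IsHomog 0 (ext ψ) := by
    intro c hc x hx
    simp [ext, sphereDir_smul hc hx]
  have hat : ∀ x ≠ 0, ContDiffAt ℝ 2 (ext ψ) x := fun x hx =>
    hψ.contDiffAt (isOpen_compl_zero.mem_nhds hx)
  have hd : ∀ x ≠ 0, DifferentiableAt ℝ (ext ψ) x := fun x hx =>
    (hat x hx).differentiableAt (by norm_num)
  have hψ1 : ContDiffOn ℝ 1 (fderiv ℝ (ext ψ)) {0}ᶜ :=
    hψ.fderiv_of_isOpen isOpen_compl_zero (by norm_num)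
  have hd2 : ∀ x ≠ 0, DifferentiableAt ℝ (fderiv ℝ (ext ψ)) x := fun x hx =>
    (hψ1.contDiffAt (isOpen_compl_zero.mem_nhds hx)).differentiableAt (by norm_num)
  have h1 : IsHomog 1 (fderiv ℝ (ext ψ)) := h0.fderiv hd
  have h2 : IsHomog 2 (fderiv ℝ (fderiv ℝ (ext ψ))) := h1.fderiv hd2
  obtain ⟨C1, hC1, hb1⟩ := h1.bound hψ1.continuousOn
  obtain ⟨C2, hC2, hb2⟩ := h2.bound
    (hψ1.continuousOn_fderiv_of_isOpen isOpen_compl_zero (by norm_num))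
  have hrad : ∀ x ≠ 0, fderiv ℝ (ext ψ) x x = 0 := fun x hx => by
    simpa using h0.euler hx (hd x hx)
  have hleft : ∀ x ≠ 0, ∀ v, fderiv ℝ (fderiv ℝ (ext ψ)) x x v = -fderiv ℝ (ext ψ) x v :=
    fun x hx v => by
      have := DFunLike.congr_fun (h1.euler hx (hd2 x hx)) v
      simpa using this
  refine ⟨C1 + C2, ⟨by positivity, hd, hd2, hrad, fun x hx v => ?_, hleft,
    fun x hx v => ?_, fun x hx v w => ?_, fun x hx n hn hn0 => ?_⟩⟩
  · have := (fderiv ℝ (ext ψ) x).le_opNorm v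
    rw [Real.norm_eq_abs] at this
    have hb := hb1 x hx
    rw [pow_one] at hb
    refine this.trans ?_
    gcongr
    refine hb.trans ?_
    gcongr
    linarith
  · rw [← hleft x hx v]
    have hs : IsSymmSndFDerivAt ℝ (ext ψ) x := (hat x hx).isSymmSndFDerivAt (by simp)
    exact hs.eq v x
  · have := ContinuousLinearMap.le_opNorm₂ (fderiv ℝ (fderiv ℝ (ext ψ)) x) v w
    rw [Real.norm_eq_abs] at this
    refine this.trans ?_
    gcongr
    refine (hb2 x hx).trans ?_
    gcongr
    linarith
  · have hnx : 0 < ‖x‖ := norm_pos_iff.mpr hx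
    have hθ0 : (sphereDir x : E3) ≠ 0 := norm_ne_zero_iff.mp (by simp)
    have hx1 : ‖x‖ • (sphereDir x : E3) = x := by
      rw [sphereDir_coe hx, smul_smul, mul_inv_cancel₀ hnx.ne', one_smul]
    -- Degree `-2` moves the computation to the unit sphere, where `sphereLaplacian` is defined.
    have e1 := h2 ‖x‖ hnx _ hθ0
    rw [hx1] at e1
    have hc : Fintype.card (Fin 3) = Module.finrank ℝ E3 := by simp
    let b : OrthonormalBasis (Fin 3) ℝ E3 := OrthonormalBasis.mk hn
      (hn.linearIndependent.span_eq_top_of_card_eq_finrank' hc).ge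
    have hb : ∀ i, b i = n i := fun i => by simp [b]
    have e2 : sphereLaplacian ψ (sphereDir x) = ∑ i,
        fderiv ℝ (fderiv ℝ (ext ψ)) (sphereDir x : E3) (n i) (n i) := by
      rw [sphereLaplacian, InnerProductSpace.laplacian_eq_iteratedFDeriv_orthonormalBasis _ b]
      refine Finset.sum_congr rfl fun i _ => ?_
      rw [iteratedFDeriv_two_apply]
      simp [hb]
      rfl
    have e3 : n 0 = (sphereDir x : E3) := by rw [hn0, sphereDir_coe hx]
    rw [e2, Fin.sum_univ_three, e3, hleft _ hθ0, hrad _ hθ0, e1]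
    simp
    ring

/-! ### Pointwise bounds for the initial data -/

/-- The hyperbolic unit normal to the sphere through `x`. -/
def normal (x : E3) : E3 := (√(1 + ‖x‖ ^ 2) * ‖x‖⁻¹) • x

lemma fderiv_boost_normal (x : E3) : fderiv ℝ (boost x) 0 (‖x‖⁻¹ • x) = normal x := by
  rw [map_smul, fderiv_boost_zero_self, smul_smul, normal, mul_comm]

lemma tanProj_apply {x v : E3} (h : inner ℝ x v = 0) : tanProj x v = v := by
  simp only [tanProj, sub_apply, smul_apply, ContinuousLinearMap.smulRight_apply,
    ContinuousLinearMap.id_apply, innerSL_real, h]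
  simp

/-- Bounds for the metric `G`, its first derivatives and the tensor `K` at the point `x`. -/
structure PointBounds (G K : E3 → Bil) (m p : Bil) (C : ℝ) (x : E3) : Prop where
  nonneg : 0 ≤ C
  diff : DifferentiableAt ℝ G x
  symm : ∀ v w, G x v w = G x w v
  fderiv_symm : ∀ z v w, fderiv ℝ G x z v w = fderiv ℝ G x z w v
  radial : ∀ v, G x x v = hyp x x v
  fderiv_radial : ∀ z v, fderiv ℝ G x z x v = fderiv ℝ hyp x z x v - (G x z v - hyp x z v)
  metric : ∀ v w, inner ℝ x v = 0 → inner ℝ x w = 0 →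
    |G x v w - inner ℝ v w - ‖x‖⁻¹ ^ 3 * m v w| ≤ C * ‖x‖⁻¹ ^ 4 * ‖v‖ * ‖w‖
  fderiv_normal : ∀ v w, inner ℝ x v = 0 → inner ℝ x w = 0 →
    |fderiv ℝ G x x v w + 3 * (‖x‖⁻¹ ^ 3 * m v w)| ≤ C * ‖x‖⁻¹ ^ 4 * ‖v‖ * ‖w‖
  fderiv_tangent : ∀ z v w, inner ℝ x z = 0 → inner ℝ x v = 0 → inner ℝ x w = 0 →
    |fderiv ℝ G x z v w| ≤ C * ‖x‖⁻¹ ^ 3 * ‖z‖ * ‖v‖ * ‖w‖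
  K_normal : |K x (normal x) (normal x) - 1| ≤ C * ‖x‖⁻¹ ^ 3
  K_mixed : ∀ v, inner ℝ x v = 0 → |K x (normal x) v| ≤ C * ‖x‖⁻¹ ^ 3 * ‖v‖
  K_mixed' : ∀ v, inner ℝ x v = 0 → |K x v (normal x)| ≤ C * ‖x‖⁻¹ ^ 3 * ‖v‖
  K_tangent : ∀ v w, inner ℝ x v = 0 → inner ℝ x w = 0 →
    |K x v w - inner ℝ v w - ‖x‖⁻¹ ^ 3 * p v w| ≤ C * ‖x‖⁻¹ ^ 4 * ‖v‖ * ‖w‖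
  m_bound : ∀ v w, |m v w| ≤ C * ‖v‖ * ‖w‖
  p_bound : ∀ v w, |p v w| ≤ C * ‖v‖ * ‖w‖

lemma hyp_normal_normal {x : E3} (hx : x ≠ 0) : hyp x (normal x) (normal x) = 1 := by
  have hn : 0 < ‖x‖ := norm_pos_iff.mpr hx
  have hs : √(1 + ‖x‖ ^ 2) ^ 2 = 1 + ‖x‖ ^ 2 := Real.sq_sqrt (by positivity)
  rw [hyp_apply, normal]
  simp only [inner_smul_left, inner_smul_right, real_inner_self_eq_norm_sq,
    conj_trivial]
  field_simp
  rw [hs]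
  ring

lemma hyp_self_tangent {x v : E3} (h : inner ℝ x v = 0) : hyp x x v = 0 := by
  simp [hyp_apply, h]

lemma fderiv_sub_sub_apply {V : Type*} [NormedAddCommGroup V] [NormedSpace ℝ V] {a b c : E3 → V}
    {x : E3} (ha : DifferentiableAt ℝ a x) (hb : DifferentiableAt ℝ b x)
    (hc : DifferentiableAt ℝ c x) : DifferentiableAt ℝ (fun x => a x - b x - c x) x ∧
      ∀ z, fderiv ℝ (fun x => a x - b x - c x) x z
        = fderiv ℝ a x z - fderiv ℝ b x z - fderiv ℝ c x z := by
  have := (ha.hasFDerivAt.sub hb.hasFDerivAt).sub hc.hasFDerivAt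
  refine ⟨this.differentiableAt, fun z => ?_⟩
  exact DFunLike.congr_fun this.fderiv z

/-- All weighted bounds are evaluated in the boosted frame. On tangential arguments the
non-Euclidean part of `hyp` and its derivative vanish, so only `m`, `p` and the remainders survive.
The coefficient `3` in the radial derivative comes from Euler's relation, `extTensor m` having
degree `-3`. Components of `K` with a normal slot are read off from `K - G`, as `G` agrees with
`hyp` there. -/
lemma exists_pointBounds {G K : E3 → Bil} {m p : S2 → Bil} {l : ℕ} {β R₀ : ℝ} (hl : 2 ≤ l)
    (hR₀ : 0 < R₀) (hG : ∀ x : E3, R₀ < ‖x‖ → DifferentiableAt ℝ G x)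
    (hsymm : ∀ x v w, G x v w = G x w v)
    (hrad : ∀ x : E3, R₀ < ‖x‖ → ∀ v, G x x v = hyp x x v)
    (hm : IsSphereTensor l β m) (hp : IsSphereTensor (l - 1) β p)
    (hKG : WeightedTensor (l - 1) β 3 fun x => K x - G x)
    (hGm : WeightedTensor l β 4 fun x => G x - hyp x - (‖x‖ ^ 3)⁻¹ • m (sphereDir x))
    (hKp : WeightedTensor (l - 1) β 4 fun x =>
      (K x - hyp x).bilinearComp (tanProj x) (tanProj x) - (‖x‖ ^ 3)⁻¹ • p (sphereDir x)) :
    ∃ C R : ℝ, 1 ≤ R ∧ R₀ < R ∧ ∀ x : E3, R ≤ ‖x‖ →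
      PointBounds G K (m (sphereDir x)) (p (sphereDir x)) C x := by
  have h4 : ((4 : ℕ) : ℝ) = 4 := by norm_num
  have h3 : ((3 : ℕ) : ℝ) = 3 := by norm_num
  rw [← h3] at hKG
  rw [← h4] at hGm hKp
  set E : E3 → Bil := fun x => G x - hyp x - (‖x‖ ^ 3)⁻¹ • m (sphereDir x) with hE
  have hEd : ∀ x : E3, R₀ < ‖x‖ → DifferentiableAt ℝ E x ∧
      ∀ z, fderiv ℝ E x z = fderiv ℝ G x z - fderiv ℝ hyp x z - fderiv ℝ (extTensor m) x z := by
    intro x hx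
    have hx0 : x ≠ 0 := norm_pos_iff.mp (hR₀.trans hx)
    exact fderiv_sub_sub_apply (V := Bil) (hG x hx) (differentiableAt_hyp x)
      (hm.differentiableAt_extTensor (by omega) hx0)
  obtain ⟨A₁, R₁, hA₁, hR₁, hb₁⟩ := hKG.bound
  obtain ⟨A₂, R₂, hA₂, hR₂, hb₂⟩ := hGm.bound
  obtain ⟨A₃, R₃, hA₃, hR₃, hb₃⟩ := hKp.bound
  obtain ⟨A₄, R₄, hA₄, hR₄, hb₄⟩ := hGm.fderiv_bound (by omega) fun x hx => (hEd x hx).1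
  obtain ⟨A₅, hA₅, hb₅⟩ := hm.bound
  obtain ⟨A₆, hA₆, hb₆⟩ := hp.bound
  obtain ⟨A₇, hA₇, hb₇⟩ := hm.fderiv_bound (by omega)
  refine ⟨A₁ + A₂ + A₃ + A₄ + A₅ + A₆ + A₇, R₁ + R₂ + R₃ + R₄ + R₀, by linarith, by linarith,
    fun x hx => ?_⟩
  set C := A₁ + A₂ + A₃ + A₄ + A₅ + A₆ + A₇ with hC
  have hxR : R₀ < ‖x‖ := by linarith
  have hnx : 0 < ‖x‖ := by linarith
  have hx0 : x ≠ 0 := norm_pos_iff.mp hnx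
  have hu : ‖‖x‖⁻¹ • x‖ = 1 := by simp [norm_smul, hnx.ne']
  have hy1 : ‖x‖⁻¹ ≤ 1 := inv_le_one_of_one_le₀ (by linarith)
  have hy0 : 0 < ‖x‖⁻¹ := inv_pos.mpr hnx
  have hnorm : ∀ v : E3, G x (normal x) v = hyp x (normal x) v := fun v => by
    simp only [normal, map_smul, smul_apply, hrad x hxR]
  have hnv : ∀ v : E3, inner ℝ x v = 0 → G x (normal x) v = 0 := fun v hv => by
    simp only [normal, map_smul, smul_apply, hrad x hxR, hyp_self_tangent hv, smul_zero]
  refine ⟨by positivity, hG x hxR, hsymm x, fun z v w => ?_, hrad x hxR, fun z v => ?_,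
    fun v w hv hw => ?_, fun v w hv hw => ?_, fun z v w hz hv hw => ?_, ?_, fun v hv => ?_,
    fun v hv => ?_, fun v w hv hw => ?_, fun v w => ?_, fun v w => ?_⟩
  · rw [← fderiv_bil_apply (hG x hxR), ← fderiv_bil_apply (hG x hxR)]
    congr 1
    simp only [hsymm _ v w]
  · have e1 := ((hG x hxR).hasFDerivAt.clm_apply (hasFDerivAt_id x)).clm_apply
      (hasFDerivAt_const v x)
    have e2 := ((differentiableAt_hyp x).hasFDerivAt.clm_apply (hasFDerivAt_id x)).clm_apply
      (hasFDerivAt_const v x)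
    -- The radial condition holds on a neighbourhood and can be differentiated. The moving argument
    -- `y` in the first slot contributes the terms `G x z v` and `hyp x z v`.
    have e3 : (fun y => G y y v) =ᶠ[𝓝 x] fun y => hyp y y v := by
      filter_upwards [(isOpen_lt continuous_const continuous_norm).mem_nhds hxR] with y hy
      exact hrad y hy v
    have e4 := DFunLike.congr_fun (e1.unique (e2.congr_of_eventuallyEq e3)) z
    simp at e4
    linarith
  · have := hb₂ x (by linarith) v w
    rw [fderiv_boost_zero_tangent hv, fderiv_boost_zero_tangent hw] at this
    simp only [hE, sub_apply, smul_apply, hyp_apply, hv, smul_eq_mul] at this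
    rw [← inv_pow] at this
    refine le_trans (le_of_eq ?_) (this.trans ?_)
    · congr 1; ring
    · gcongr; linarith
  · have e1 := hb₄ x (by linarith) (‖x‖⁻¹ • x) v w
    have e2 := DFunLike.congr_fun ((isHomog_extTensor m).euler hx0
      (hm.differentiableAt_extTensor (by omega) hx0))
    have e3 : fderiv ℝ (extTensor m) x x v w = -3 * (‖x‖⁻¹ ^ 3 * m (sphereDir x) v w) := by
      rw [e2 v]
      simp [extTensor]
    rw [fderiv_boost_zero_tangent hv, fderiv_boost_zero_tangent hw, hu, map_smul,
      fderiv_boost_zero_self, (hEd x hxR).2, smul_smul] at e1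
    simp only [sub_apply, smul_apply, map_smul, smul_eq_mul, e3, fderiv_hyp_apply, hv, hw] at e1
    -- The boosted frame differentiates in the direction `S x` with `S ≥ 1`, so passing to the
    -- direction `x` only improves the bound.
    have e4 : 1 ≤ ‖x‖⁻¹ * √(1 + ‖x‖ ^ 2) := by
      rw [inv_mul_eq_div, one_le_div hnx]
      exact Real.le_sqrt_of_sq_le (by linarith)
    set S := ‖x‖⁻¹ * √(1 + ‖x‖ ^ 2)
    have e6 : ∀ g t : ℝ, S * g - S * (-(0 * 0 + 0 * 0) / (1 + ‖x‖ ^ 2)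
        + 2 * inner ℝ x x * 0 * 0 / (1 + ‖x‖ ^ 2) ^ 2) - S * (-3 * t) = S * (g + 3 * t) := by
      intro g t; ring
    rw [e6, abs_mul, abs_of_nonneg (zero_le_one.trans e4)] at e1
    have e5 : |fderiv ℝ G x x v w + 3 * (‖x‖⁻¹ ^ 3 * m (sphereDir x) v w)| ≤
        A₄ * ‖x‖⁻¹ ^ 4 * ‖v‖ * ‖w‖ := by
      exact le_trans (le_mul_of_one_le_left (abs_nonneg _) e4) (e1.trans (le_of_eq (by ring)))
    exact e5.trans (by gcongr; linarith)
  · have e1 := hb₄ x (by linarith) z v w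
    rw [fderiv_boost_zero_tangent hv, fderiv_boost_zero_tangent hw, fderiv_boost_zero_tangent hz,
      (hEd x hxR).2] at e1
    simp only [sub_apply, fderiv_hyp_apply, hv, hw] at e1
    have e2 := hb₇ x hx0 z v w
    have e3 : fderiv ℝ G x z v w = (fderiv ℝ G x z v w
      - (-(inner ℝ z v * 0 + 0 * inner ℝ z w) / (1 + ‖x‖ ^ 2)
        + 2 * inner ℝ x z * 0 * 0 / (1 + ‖x‖ ^ 2) ^ 2) - fderiv ℝ (extTensor m) x z v w)
        + fderiv ℝ (extTensor m) x z v w := by ring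
    rw [e3]
    have e4 : ‖x‖⁻¹ ^ 4 ≤ ‖x‖⁻¹ ^ 3 := pow_le_pow_of_le_one hy0.le hy1 (by norm_num)
    refine (abs_add_le _ _).trans ((add_le_add e1 e2).trans ?_)
    rw [← add_mul, ← add_mul, ← add_mul, ← add_mul]
    gcongr
    linarith
  · have e1 := hb₁ x (by linarith) (‖x‖⁻¹ • x) (‖x‖⁻¹ • x)
    rw [fderiv_boost_normal, hu] at e1
    simp only [sub_apply, hnorm, hyp_normal_normal hx0, mul_one] at e1
    exact e1.trans (by gcongr; linarith)
  · have e1 := hb₁ x (by linarith) (‖x‖⁻¹ • x) v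
    rw [fderiv_boost_normal, hu, fderiv_boost_zero_tangent hv] at e1
    simp only [sub_apply, hnv v hv, mul_one, sub_zero] at e1
    exact e1.trans (by gcongr; linarith)
  · have e1 := hb₁ x (by linarith) v (‖x‖⁻¹ • x)
    rw [fderiv_boost_normal, hu, fderiv_boost_zero_tangent hv] at e1
    simp only [sub_apply, hsymm x v, hnv v hv, mul_one, sub_zero] at e1
    exact e1.trans (by gcongr; linarith)
  · have := hb₃ x (by linarith) v w
    rw [fderiv_boost_zero_tangent hv, fderiv_boost_zero_tangent hw] at this
    simp only [sub_apply, smul_apply, ContinuousLinearMap.bilinearComp_apply, tanProj_apply hv,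
      tanProj_apply hw, hyp_apply, hv, smul_eq_mul] at this
    rw [← inv_pow] at this
    refine le_trans (le_of_eq ?_) (this.trans ?_)
    · congr 1; ring
    · gcongr; linarith
  · exact (hb₅ _ v w).trans (by gcongr; linarith)
  · exact (hb₆ _ v w).trans (by gcongr; linarith)

/-! ### A frame adapted to the spheres -/

lemma exists_inv_sqrt {t η : ℝ} (hη : η ≤ 1 / 2) (h : |t - 1| ≤ η) :
    ∃ a : ℝ, a ^ 2 * t = 1 ∧ |a - 1| ≤ 2 * η := by
  have h1 := abs_le.mp h
  have ht : 0 < t := by linarith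
  have hs : 0 < √t := Real.sqrt_pos.mpr ht
  have ha : ((√t)⁻¹) ^ 2 * t = 1 := by
    rw [inv_pow, Real.sq_sqrt ht.le, inv_mul_cancel₀ ht.ne']
  refine ⟨(√t)⁻¹, ha, ?_⟩
  set a := (√t)⁻¹
  have hapos : 0 < a := inv_pos.mpr hs
  have ha2 : a ^ 2 ≤ 2 := by nlinarith [sq_nonneg a]
  have h2 : (a - 1) * (a + 1) = a ^ 2 * (1 - t) := by linear_combination ha
  have h3 : |a - 1| * (a + 1) ≤ 2 * η := by
    rw [← abs_of_pos (show 0 < a + 1 by linarith), ← abs_mul, h2, abs_mul, abs_sub_comm,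
      abs_of_nonneg (sq_nonneg a)]
    exact mul_le_mul ha2 h (abs_nonneg _) (by norm_num)
  nlinarith [abs_nonneg (a - 1)]

/-- Quantitative Gram–Schmidt: `e₁` is normalized by `a`, and `e₂ - d e₁` with `d = B e₁ e₂ / B e₁
e₁` is normalized by `b`, so `c = -b d`. Since `B` is within `η` of the identity on the pair, all
corrections are `O(η)`. -/
lemma exists_orthonormal_pair {B : Bil} (hB : ∀ v w, B v w = B w v) {e₁ e₂ : E3} {η : ℝ}
    (h1 : ‖e₁‖ = 1) (h2 : ‖e₂‖ = 1) (hη : η ≤ 1 / 10) (h11 : |B e₁ e₁ - 1| ≤ η)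
    (h12 : |B e₁ e₂| ≤ η) (h22 : |B e₂ e₂ - 1| ≤ η) :
    ∃ a b c : ℝ, B (a • e₁) (a • e₁) = 1 ∧ B (a • e₁) (b • e₂ + c • e₁) = 0 ∧
      B (b • e₂ + c • e₁) (b • e₂ + c • e₁) = 1 ∧ ‖a • e₁ - e₁‖ ≤ 12 * η ∧
      ‖b • e₂ + c • e₁ - e₂‖ ≤ 12 * η := by
  have hη0 : 0 ≤ η := (abs_nonneg _).trans h11
  obtain ⟨a, ha, hab⟩ := exists_inv_sqrt (by linarith) h11
  set q₁₁ := B e₁ e₁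
  set q₁₂ := B e₁ e₂ with hq₁₂
  set q₂₂ := B e₂ e₂
  have hq21 : B e₂ e₁ = q₁₂ := hB _ _
  have hq : 9 / 10 ≤ q₁₁ := by linarith [(abs_le.mp h11).1]
  have hq0 : q₁₁ ≠ 0 := by linarith
  have hd : |q₁₂ / q₁₁| ≤ 2 * η := by
    rw [abs_div, abs_of_pos (by linarith : 0 < q₁₁), div_le_iff₀ (by linarith)]
    nlinarith
  set d := q₁₂ / q₁₁ with hddef
  have hdq : d * q₁₁ = q₁₂ := div_mul_cancel₀ _ hq0
  have ht : |q₂₂ - d * q₁₂ - 1| ≤ 2 * η := by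
    have e1 : |d * q₁₂| ≤ (2 * η) * η := by
      rw [abs_mul]; exact mul_le_mul hd h12 (abs_nonneg _) (by linarith)
    have e2 := abs_le.mp e1
    have e3 := abs_le.mp h22
    rw [abs_le]
    constructor <;> nlinarith
  obtain ⟨b, hb, hbb⟩ := exists_inv_sqrt (by linarith) ht
  have hb2 : |b| ≤ 2 := by
    have := abs_le.mp hbb
    rw [abs_le]; constructor <;> linarith
  refine ⟨a, b, -(b * d), ?_, ?_, ?_, ?_, ?_⟩
  · simp only [map_smul, smul_apply, smul_eq_mul]
    linear_combination ha
  · simp only [map_smul, map_add, smul_apply, smul_eq_mul]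
    linear_combination (-a * b) * hdq
  · simp only [map_smul, map_add, smul_apply, add_apply, smul_eq_mul, hq21]
    linear_combination hb + b ^ 2 * d * hdq
  · rw [show a • e₁ - e₁ = (a - 1) • e₁ by rw [sub_smul, one_smul], norm_smul, h1, mul_one,
      Real.norm_eq_abs]
    linarith
  · rw [show b • e₂ + -(b * d) • e₁ - e₂ = (b - 1) • e₂ + (-(b * d)) • e₁ by
      rw [sub_smul, one_smul]; abel]
    refine (norm_add_le _ _).trans ?_
    rw [norm_smul, norm_smul, h1, h2, mul_one, mul_one, Real.norm_eq_abs, Real.norm_eq_abs,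
      abs_neg, abs_mul]
    have : |b| * |d| ≤ 2 * (2 * η) := mul_le_mul hb2 hd (abs_nonneg _) (by norm_num)
    linarith

lemma exists_orthonormal_extend {x : E3} (hx : x ≠ 0) :
    ∃ e : Fin 3 → E3, Orthonormal ℝ e ∧ e 0 = ‖x‖⁻¹ • x := by
  have hu : ‖‖x‖⁻¹ • x‖ = 1 := by simp [norm_smul, hx]
  obtain ⟨b, hb⟩ := Orthonormal.exists_orthonormalBasis_extension_of_card_eq (𝕜 := ℝ) (E := E3)
    (ι := Fin 3) (by simp) (v := fun _ => ‖x‖⁻¹ • x) (s := {0}) (by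
      rw [orthonormal_iff_ite]
      rintro ⟨i, hi⟩ ⟨j, hj⟩
      simp only [mem_singleton_iff] at hi hj
      subst hi hj
      simp [hu])
  exact ⟨b, b.orthonormal, hb 0 rfl⟩

/-- A `G`-orthonormal frame `n` close to a Euclidean orthonormal frame `e` adapted to the
spheres. -/
structure AdaptedFrame (G : E3 → Bil) (x : E3) (η : ℝ) (e n : Fin 3 → E3) : Prop where
  orthonormal : Orthonormal ℝ e
  e_zero : e 0 = ‖x‖⁻¹ • x
  n_zero : n 0 = normal x
  isFrame : IsFrame (G x) n
  tangent1 : inner ℝ x (n 1) = 0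
  tangent2 : inner ℝ x (n 2) = 0
  close1 : ‖n 1 - e 1‖ ≤ η
  close2 : ‖n 2 - e 2‖ ≤ η

/-- The radial condition makes `normal x` a `G`-unit vector that is `G`-orthogonal to the sphere.
Gram–Schmidt is thus needed only in the tangent plane, where `G` differs from the Euclidean product
by at most `2C‖x‖⁻³`; this accounts for `24 = 12 · 2`. -/
lemma PointBounds.exists_adaptedFrame {G K : E3 → Bil} {m p : Bil} {C : ℝ} {x : E3}
    (h : PointBounds G K m p C x) (hx1 : 1 ≤ ‖x‖) (hC : 2 * C * ‖x‖⁻¹ ^ 3 ≤ 1 / 10) :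
    ∃ e n : Fin 3 → E3, AdaptedFrame G x (24 * C * ‖x‖⁻¹ ^ 3) e n := by
  have hnx : 0 < ‖x‖ := by linarith
  have hx0 : x ≠ 0 := norm_pos_iff.mp hnx
  obtain ⟨e, he, he0⟩ := exists_orthonormal_extend hx0
  have hxe : x = ‖x‖ • e 0 := by rw [he0, smul_smul, mul_inv_cancel₀ hnx.ne', one_smul]
  have hee := orthonormal_iff_ite.mp he
  have ht : ∀ i, i ≠ 0 → inner ℝ x (e i) = 0 := fun i hi => by
    rw [hxe, inner_smul_left, hee, if_neg hi.symm, mul_zero]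
  have hy1 : ‖x‖⁻¹ ≤ 1 := inv_le_one_of_one_le₀ hx1
  have hy0 : 0 < ‖x‖⁻¹ := inv_pos.mpr hnx
  have hC0 := h.nonneg
  have hG : ∀ i j, i ≠ 0 → j ≠ 0 → |G x (e i) (e j) - if i = j then 1 else 0| ≤
      2 * C * ‖x‖⁻¹ ^ 3 := fun i j hi hj => by
    have e1 := h.metric (e i) (e j) (ht i hi) (ht j hj)
    have e2 := h.m_bound (e i) (e j)
    rw [he.1 i, he.1 j, mul_one, mul_one] at e1 e2
    rw [hee] at e1
    have e3 : |‖x‖⁻¹ ^ 3 * m (e i) (e j)| ≤ ‖x‖⁻¹ ^ 3 * C := by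
      rw [abs_mul, abs_of_pos (by positivity)]; gcongr
    have e4 : C * ‖x‖⁻¹ ^ 4 ≤ C * ‖x‖⁻¹ ^ 3 := by
      gcongr ?_ * ?_
      exact pow_le_pow_of_le_one hy0.le hy1 (by norm_num)
    have e5 := abs_le.mp e1
    have e6 := abs_le.mp e3
    rw [abs_le]
    constructor <;> linarith
  have g11 := hG 1 1 (by decide) (by decide)
  have g12 := hG 1 2 (by decide) (by decide)
  have g22 := hG 2 2 (by decide) (by decide)
  rw [if_pos rfl] at g11 g22
  rw [if_neg (by decide), sub_zero] at g12
  obtain ⟨a, b, c, h11, h12, h22, hc1, hc2⟩ := exists_orthonormal_pair h.symm (he.1 1) (he.1 2)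
    hC g11 g12 g22
  have t1 : inner ℝ x (a • e 1) = 0 := by rw [inner_smul_right, ht 1 (by decide), mul_zero]
  have t2 : inner ℝ x (b • e 2 + c • e 1) = 0 := by
    rw [inner_add_right, inner_smul_right, inner_smul_right, ht 1 (by decide), ht 2 (by decide)]
    simp
  have hN : ∀ v, G x (normal x) v = hyp x (normal x) v := fun v => by
    simp only [normal, map_smul, smul_apply, h.radial]
  have hNt : ∀ v, inner ℝ x v = 0 → G x (normal x) v = 0 := fun v hv => by
    simp only [normal, map_smul, smul_apply, h.radial, hyp_self_tangent hv, smul_zero]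
  have hNN : G x (normal x) (normal x) = 1 := by rw [hN, hyp_normal_normal hx0]
  refine ⟨e, ![normal x, a • e 1, b • e 2 + c • e 1], he, he0, rfl, ?_, t1, t2, ?_, ?_⟩
  · intro i j
    fin_cases i <;> fin_cases j
    · simpa using hNN
    · simpa using hNt _ t1
    · simpa using hNt _ t2
    · simpa using (h.symm _ _).trans (hNt _ t1)
    · simpa using h11
    · simpa using h12
    · simpa using (h.symm _ _).trans (hNt _ t2)
    · simpa using (h.symm _ _).trans h12
    · simpa using h22
  · exact hc1.trans (le_of_eq (by ring))
  · exact hc2.trans (le_of_eq (by ring))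

/-- Telescoping `S n n - S e e = S (n - e) n + S e (n - e)`; the factor `3` is `‖n‖ + ‖e‖ ≤ 2 + 1`.
-/
lemma abs_sub_diag_le {S : Bil} {B η : ℝ} (hB : 0 ≤ B) (hS : ∀ v w, |S v w| ≤ B * ‖v‖ * ‖w‖)
    {n e : E3} (he : ‖e‖ = 1) (hn : ‖n‖ ≤ 2) (h : ‖n - e‖ ≤ η) :
    |S n n - S e e| ≤ 3 * B * η := by
  have h1 : S n n - S e e = S (n - e) n + S e (n - e) := by
    simp only [map_sub, sub_apply]; ring
  rw [h1]
  refine (abs_add_le _ _).trans ((add_le_add (hS _ _) (hS _ _)).trans ?_)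
  have e1 : B * ‖n - e‖ * ‖n‖ ≤ B * η * 2 := by
    have := (norm_nonneg _).trans h
    gcongr
  have e2 : B * ‖e‖ * ‖n - e‖ ≤ B * 1 * η := by rw [he]; gcongr
  linarith

/-! ### Radial functions -/

lemma hasFDerivAt_norm {y : E3} (hy : y ≠ 0) :
    HasFDerivAt (fun z : E3 => ‖z‖) (‖y‖⁻¹ • (innerSL ℝ : Bil) y) y := by
  have hn : ‖y‖ ^ 2 ≠ 0 := pow_ne_zero _ (norm_ne_zero_iff.mpr hy)
  have h := (hasStrictFDerivAt_norm_sq y).hasFDerivAt.sqrt hn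
  simp only [Real.sqrt_sq (norm_nonneg _)] at h
  refine h.congr_fderiv ?_
  ext v
  have hn' : ‖y‖ ≠ 0 := norm_ne_zero_iff.mpr hy
  simp
  field_simp

/-- The first two derivatives of `φ(|x|) + ext ψ`. -/
lemma fderiv_radial_add {φ φ₁ : ℝ → ℝ} {φ₂ : ℝ} {ψ : S2 → ℝ} {x : E3} (hx : x ≠ 0)
    (hφ : ∀ᶠ t in 𝓝 ‖x‖, HasDerivAt φ (φ₁ t) t) (hφ₁ : HasDerivAt φ₁ φ₂ ‖x‖)
    (hψ : ∀ x ≠ 0, DifferentiableAt ℝ (ext ψ) x)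
    (hψ2 : DifferentiableAt ℝ (fderiv ℝ (ext ψ)) x) :
    DifferentiableAt ℝ (fderiv ℝ fun y : E3 => φ ‖y‖ + ext ψ y) x ∧
    (∀ v, fderiv ℝ (fun y : E3 => φ ‖y‖ + ext ψ y) x v =
      φ₁ ‖x‖ * ‖x‖⁻¹ * inner ℝ x v + fderiv ℝ (ext ψ) x v) ∧
    ∀ v w, fderiv ℝ (fderiv ℝ fun y : E3 => φ ‖y‖ + ext ψ y) x v w =
      φ₁ ‖x‖ * ‖x‖⁻¹ * inner ℝ v w
      + (φ₂ * ‖x‖⁻¹ ^ 2 - φ₁ ‖x‖ * ‖x‖⁻¹ ^ 3) * inner ℝ x v * inner ℝ x w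
      + fderiv ℝ (fderiv ℝ (ext ψ)) x v w := by
  have hnx : ‖x‖ ≠ 0 := norm_ne_zero_iff.mpr hx
  have h1 : ∀ᶠ y in 𝓝 x, fderiv ℝ (fun y : E3 => φ ‖y‖ + ext ψ y) y =
      (φ₁ ‖y‖ * ‖y‖⁻¹) • (innerSL ℝ : Bil) y + fderiv ℝ (ext ψ) y := by
    filter_upwards [isOpen_ne.mem_nhds hx, continuous_norm.continuousAt.eventually hφ] with y hy hφy
    have e1 := (hφy.comp_hasFDerivAt y (hasFDerivAt_norm hy)).add (hψ y hy).hasFDerivAt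
    rw [← smul_smul]
    exact e1.fderiv
  have h2 : HasDerivAt (fun t => φ₁ t * t⁻¹) (φ₂ * ‖x‖⁻¹ + φ₁ ‖x‖ * (-(‖x‖ ^ 2)⁻¹)) ‖x‖ :=
    hφ₁.mul (hasDerivAt_inv hnx)
  have h3 : HasFDerivAt (fun y : E3 => φ₁ ‖y‖ * ‖y‖⁻¹) _ x :=
    h2.comp_hasFDerivAt x (hasFDerivAt_norm hx)
  have h4 : HasFDerivAt (fun y : E3 => (innerSL ℝ : Bil) y) (innerSL ℝ : Bil) x :=
    (innerSL ℝ : Bil).hasFDerivAt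
  have h5 := ((h3.smul h4).add hψ2.hasFDerivAt).congr_of_eventuallyEq h1
  refine ⟨h5.differentiableAt, fun v => ?_, fun v w => ?_⟩
  · rw [h1.self_of_nhds]
    simp [innerSL_real]
  · rw [h5.fderiv]
    simp only [add_apply, smul_apply, ContinuousLinearMap.smulRight_apply, smul_eq_mul]
    change φ₁ ‖x‖ * ‖x‖⁻¹ * inner ℝ v w + (φ₂ * ‖x‖⁻¹ + φ₁ ‖x‖ * -(‖x‖ ^ 2)⁻¹) *
      (‖x‖⁻¹ * inner ℝ x v) * inner ℝ x w + _ = _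
    ring

/-! ### The Jang operator of `φ(|x|) + ext ψ` -/

lemma abs_mul_le_of_abs_le_one {a b c : ℝ} (ha : |a| ≤ 1) (hb : |b| ≤ c) : |a * b| ≤ c := by
  rw [abs_mul]
  calc |a| * |b| ≤ 1 * c := mul_le_mul ha hb (abs_nonneg _) zero_le_one
    _ = c := one_mul c

set_option maxHeartbeats 1000000 in
/-- The algebraic part of the expansion of the Jang operator. Here `k = u / √(1 + u²)` and
`s = 1 / √(1 + u²)` for the radial slope `u`, and `w = √(1 + u²) / √(1 + |df|²)`. -/
lemma jang_expansion {y D k k₁ z q w s KN HX KX HY KY M P T e₁ e₂ e₃ e₄ : ℝ}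
    (hy : 0 < y) (hy1 : y ≤ 1) (hD : 1 ≤ D) (hz : 1 ≤ z) (hz' : z - 1 ≤ y ^ 2)
    (hks : k ^ 2 + s ^ 2 = 1) (hs : 0 < s) (hw : 0 < w) (hws : w ^ 2 * (1 + q * s ^ 2) = 1)
    (hq0 : 0 ≤ q) (hq : q ≤ D * y ^ 2) (hKN : |KN - 1| ≤ D * y ^ 3) (hHX : |HX| ≤ D * y ^ 2)
    (hKX : |KX| ≤ D * y ^ 4) (hHY : |HY * (w * s)| ≤ D * y ^ 2) (hKY : |KY| ≤ D * y ^ 2)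
    (hM : |M| ≤ D) (hT : |T| ≤ D) (he₁ : |e₁| ≤ D * y ^ 4) (he₂ : |e₂| ≤ D * y ^ 4)
    (he₃ : |e₃| ≤ D * y ^ 4) (he₄ : |e₄| ≤ D * y ^ 4) :
    |((1 + q) * w ^ 3 * k₁ - (1 + q) * s ^ 2 * w ^ 2 * KN - k * w ^ 2 * s * (HX * (w * s) - KX)
      - s ^ 2 * w ^ 2 * (HY * (w * s) - KY)
      + (2 * k * w * z + 1 / 2 * (k * w * z) * (-3 * y ^ 3 * M + e₂)
        + w * s * (y ^ 2 * T + e₃ + e₁) - (2 - y ^ 3 * M + y ^ 3 * P + e₄)))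
      - (k₁ - s ^ 2 + 2 * k * z - 2 + s * y ^ 2 * T - y ^ 3 * (1 / 2 * M + P))| ≤
    30 * D ^ 2 * (y ^ 2 * (|k₁| + (1 - k)) + y ^ 4) := by
  have hk : |k| ≤ 1 := abs_le_one_iff_mul_self_le_one.mpr (by nlinarith only [hks, sq_nonneg s])
  have hk1 := abs_le.mp hk
  have hs1 : s ≤ 1 := by nlinarith only [hks, sq_nonneg k, hs]
  have hw1 : w ≤ 1 := by
    have : 0 ≤ w ^ 2 * (q * s ^ 2) := by positivity
    nlinarith only [this, hws, hw]
  -- `1 - k² = (1-k)(1+k)` with `1 + k ≤ 2`. Errors carrying a factor `s²` are thereby measured by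
  -- `1 - k`, which is itself small away from the inner boundary.
  have hs2 : s ^ 2 ≤ 2 * (1 - k) := by nlinarith only [hks, sq_nonneg (1 - k)]
  have hs20 : s ^ 2 ≤ 1 := by nlinarith only [hks, sq_nonneg k]
  have hk0' : 0 ≤ 2 * (1 - k) := by linarith
  have hw2 : w ^ 2 ≤ 1 := pow_le_one₀ hw.le hw1
  have hwq : 1 - w ≤ q * s ^ 2 := by
    have h1 : 1 - w ^ 2 = w ^ 2 * (q * s ^ 2) := by linear_combination -hws
    have h2 : w ^ 2 * (q * s ^ 2) ≤ 1 * (q * s ^ 2) := by gcongr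
    nlinarith only [h1, h2, hw, hw1]
  have hy2 : 0 < y ^ 2 := by positivity
  have hy4 : 0 < y ^ 4 := by positivity
  have hwD : 1 - w ≤ D * y ^ 2 * s ^ 2 := hwq.trans (by gcongr)
  have hDy : 0 ≤ D * y ^ 2 := by positivity
  have hwD' : 1 - w ≤ D * y ^ 2 := hwD.trans (mul_le_of_le_one_right hDy hs20)
  have hwk : 1 - w ≤ 2 * D * (y ^ 2 * (1 - k)) :=
    hwD.trans ((mul_le_mul_of_nonneg_left hs2 hDy).trans (le_of_eq (by ring)))
  have hwabs : |w - 1| = 1 - w := by rw [abs_sub_comm]; exact abs_of_nonneg (by linarith)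
  have hy34 : y ^ 3 ≤ y ^ 2 := pow_le_pow_of_le_one hy.le hy1 (by norm_num)
  have hy54 : y ^ 5 ≤ y ^ 4 := pow_le_pow_of_le_one hy.le hy1 (by norm_num)
  have hE0 : 0 ≤ y ^ 2 * (1 - k) := mul_nonneg hy2.le (by linarith)
  have hDD : D ≤ D ^ 2 := by nlinarith only [hD]
  -- The difference splits into ten terms: `d1` to `d9` bound nine of them by multiples of `y²|k₁|`,
  -- `y²(1-k)` and `y⁴`, and the tenth is `e₄`.
  have d1 : |((1 + q) * w ^ 3 - 1) * k₁| ≤ 3 * D * (y ^ 2 * |k₁|) := by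
    rw [abs_mul]
    have h3 : w ^ 3 ≤ 1 := pow_le_one₀ hw.le hw1
    have h4 : 1 - w ^ 3 ≤ 3 * (1 - w) := by
      have := mul_nonneg (by linarith : 0 ≤ w + 2) (sq_nonneg (w - 1))
      linarith
    have : |(1 + q) * w ^ 3 - 1| ≤ 3 * (D * y ^ 2) := by
      rw [abs_le]
      have h5 : 0 ≤ q * w ^ 3 := by positivity
      have h6 : q * w ^ 3 ≤ q * 1 := by gcongr
      constructor <;> linarith
    calc _ ≤ 3 * (D * y ^ 2) * |k₁| := by gcongr
      _ = _ := by ring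
  have hw2' : |(1 + q) * w ^ 2 - 1| ≤ 2 * (D * y ^ 2) := by
    have h4 : 1 - w ^ 2 ≤ 2 * (1 - w) := by nlinarith only [sq_nonneg (w - 1)]
    have h5 : 0 ≤ q * w ^ 2 := by positivity
    have h6 : q * w ^ 2 ≤ q * 1 := by gcongr
    rw [abs_le]
    constructor <;> linarith
  have d2 : |s ^ 2 * ((1 + q) * w ^ 2 * KN - 1)| ≤ 10 * D ^ 2 * (y ^ 2 * (1 - k)) := by
    have h1 : |KN| ≤ 2 * D := by
      have := abs_le.mp hKN
      have h2 : D * y ^ 3 ≤ D * 1 := by gcongr; exact pow_le_one₀ hy.le hy1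
      rw [abs_le]; constructor <;> linarith
    have h2 : |(1 + q) * w ^ 2 * KN - 1| ≤ 5 * D ^ 2 * y ^ 2 := by
      have h3 : (1 + q) * w ^ 2 * KN - 1 = ((1 + q) * w ^ 2 - 1) * KN + (KN - 1) := by ring
      rw [h3]
      refine (abs_add_le _ _).trans ?_
      rw [abs_mul]
      have h4 : |(1 + q) * w ^ 2 - 1| * |KN| ≤ 2 * (D * y ^ 2) * (2 * D) := by gcongr
      have h5 : D * y ^ 3 ≤ D ^ 2 * y ^ 2 := by gcongr
      linarith
    rw [abs_mul, abs_of_nonneg (sq_nonneg s)]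
    calc s ^ 2 * _ ≤ (2 * (1 - k)) * (5 * D ^ 2 * y ^ 2) := by gcongr
      _ = _ := by ring
  have hw1' : |w| ≤ 1 := by rw [abs_of_pos hw]; exact hw1
  have hs1' : |s| ≤ 1 := by rw [abs_of_pos hs]; exact hs1
  have hw2a : |w ^ 2| ≤ 1 := by rw [abs_of_nonneg (sq_nonneg w)]; exact hw2
  have d3 : |k * w ^ 2 * s * (HX * (w * s) - KX)| ≤ 2 * D * (y ^ 2 * (1 - k)) + D * y ^ 4 := by
    have h1 : k * w ^ 2 * s * (HX * (w * s) - KX) =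
        k * (w ^ 2 * (w * (s ^ 2 * HX))) - k * (w ^ 2 * (s * KX)) := by ring
    rw [h1]
    refine (abs_sub _ _).trans (add_le_add ?_ ?_)
    · refine abs_mul_le_of_abs_le_one hk (abs_mul_le_of_abs_le_one hw2a
        (abs_mul_le_of_abs_le_one hw1' ?_))
      rw [abs_mul, abs_of_nonneg (sq_nonneg s)]
      calc s ^ 2 * |HX| ≤ (2 * (1 - k)) * (D * y ^ 2) := by gcongr
        _ = _ := by ring
    · exact abs_mul_le_of_abs_le_one hk (abs_mul_le_of_abs_le_one hw2a
        (abs_mul_le_of_abs_le_one hs1' hKX))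
  have d4 : |s ^ 2 * w ^ 2 * (HY * (w * s) - KY)| ≤ 4 * D * (y ^ 2 * (1 - k)) := by
    have h1 : |HY * (w * s) - KY| ≤ 2 * (D * y ^ 2) := (abs_sub _ _).trans (by linarith)
    rw [mul_comm (s ^ 2), mul_assoc]
    refine abs_mul_le_of_abs_le_one hw2a ?_
    rw [abs_mul, abs_of_nonneg (sq_nonneg s)]
    calc s ^ 2 * _ ≤ (2 * (1 - k)) * (2 * (D * y ^ 2)) := by gcongr
      _ = _ := by ring
  have hz2 : z ≤ 2 := by linarith [pow_le_one₀ hy.le hy1 (n := 2)]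
  have d5 : |2 * z * (k * (w - 1))| ≤ 8 * D * (y ^ 2 * (1 - k)) := by
    rw [abs_mul, abs_of_pos (by linarith : 0 < 2 * z)]
    have : |k * (w - 1)| ≤ 2 * D * (y ^ 2 * (1 - k)) :=
      abs_mul_le_of_abs_le_one hk (by rw [hwabs]; exact hwk)
    calc 2 * z * _ ≤ (2 * 2) * (2 * D * (y ^ 2 * (1 - k))) := by gcongr
      _ = _ := by ring
  have d6 : |3 / 2 * (y ^ 3 * M) * (1 - k * w * z)| ≤
      3 / 2 * D * (y ^ 2 * (1 - k)) + 3 * D ^ 2 * y ^ 4 := by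
    have h1 : |1 - k * w * z| ≤ (1 - k) + 2 * D * y ^ 2 := by
      have h2 : 1 - k * w * z = (1 - k) + k * (1 - w) + k * (w * (1 - z)) := by ring
      rw [h2]
      have h3 : |k * (1 - w)| ≤ D * y ^ 2 :=
        abs_mul_le_of_abs_le_one hk (by rw [abs_of_nonneg (by linarith)]; exact hwD')
      have h4 : |k * (w * (1 - z))| ≤ y ^ 2 :=
        abs_mul_le_of_abs_le_one hk (abs_mul_le_of_abs_le_one hw1' (by
          rw [abs_sub_comm, abs_of_nonneg (by linarith)]; exact hz'))
      have h5 : |1 - k| = 1 - k := abs_of_nonneg (by linarith)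
      have h6 : y ^ 2 ≤ D * y ^ 2 := le_mul_of_one_le_left hy2.le hD
      refine (abs_add_le _ _).trans ((add_le_add (abs_add_le _ _) h4).trans ?_)
      linarith
    have h2 : |3 / 2 * (y ^ 3 * M)| ≤ 3 / 2 * (y ^ 3 * D) := by
      rw [abs_mul, abs_mul, abs_of_pos (by norm_num : (0 : ℝ) < 3 / 2),
        abs_of_pos (by positivity : 0 < y ^ 3)]
      gcongr
    rw [abs_mul]
    calc _ ≤ 3 / 2 * (y ^ 3 * D) * ((1 - k) + 2 * D * y ^ 2) := by gcongr
      _ = 3 / 2 * D * (y ^ 3 * (1 - k)) + 3 * D ^ 2 * y ^ 5 := by ring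
      _ ≤ _ := by gcongr; linarith
  have d7 : |1 / 2 * z * (k * (w * e₂))| ≤ D * y ^ 4 := by
    have h1 : |k * (w * e₂)| ≤ D * y ^ 4 :=
      abs_mul_le_of_abs_le_one hk (abs_mul_le_of_abs_le_one hw1' he₂)
    refine abs_mul_le_of_abs_le_one ?_ h1
    rw [abs_of_pos (by linarith)]; linarith
  have d8 : |s * ((w - 1) * (y ^ 2 * T))| ≤ D ^ 2 * y ^ 4 := by
    refine abs_mul_le_of_abs_le_one hs1' ?_
    rw [abs_mul, hwabs, abs_mul, abs_of_pos hy2]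
    calc _ ≤ D * y ^ 2 * (y ^ 2 * D) := by gcongr
      _ = _ := by ring
  have d9 : |w * (s * (e₃ + e₁))| ≤ 2 * D * y ^ 4 :=
    abs_mul_le_of_abs_le_one hw1' (abs_mul_le_of_abs_le_one hs1'
      ((abs_add_le _ _).trans (by linarith)))
  have hsplit : ((1 + q) * w ^ 3 * k₁ - (1 + q) * s ^ 2 * w ^ 2 * KN
      - k * w ^ 2 * s * (HX * (w * s) - KX)
      - s ^ 2 * w ^ 2 * (HY * (w * s) - KY)
      + (2 * k * w * z + 1 / 2 * (k * w * z) * (-3 * y ^ 3 * M + e₂)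
        + w * s * (y ^ 2 * T + e₃ + e₁) - (2 - y ^ 3 * M + y ^ 3 * P + e₄)))
      - (k₁ - s ^ 2 + 2 * k * z - 2 + s * y ^ 2 * T - y ^ 3 * (1 / 2 * M + P)) =
      ((1 + q) * w ^ 3 - 1) * k₁ - s ^ 2 * ((1 + q) * w ^ 2 * KN - 1)
      - k * w ^ 2 * s * (HX * (w * s) - KX) - s ^ 2 * w ^ 2 * (HY * (w * s) - KY)
      + 2 * z * (k * (w - 1)) + 3 / 2 * (y ^ 3 * M) * (1 - k * w * z)
      + 1 / 2 * z * (k * (w * e₂)) + s * ((w - 1) * (y ^ 2 * T)) + w * (s * (e₃ + e₁)) - e₄ := by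
    ring
  have tri : ∀ a₁ a₂ a₃ a₄ a₅ a₆ a₇ a₈ a₉ a₁₀ : ℝ,
      |a₁ - a₂ - a₃ - a₄ + a₅ + a₆ + a₇ + a₈ + a₉ - a₁₀| ≤
      |a₁| + |a₂| + |a₃| + |a₄| + |a₅| + |a₆| + |a₇| + |a₈| + |a₉| + |a₁₀| := by
    intro a₁ a₂ a₃ a₄ a₅ a₆ a₇ a₈ a₉ a₁₀
    exact (abs_sub _ _).trans (add_le_add_left ((abs_add_le _ _).trans (add_le_add_left
      ((abs_add_le _ _).trans (add_le_add_left ((abs_add_le _ _).trans (add_le_add_left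
      ((abs_add_le _ _).trans (add_le_add_left ((abs_add_le _ _).trans (add_le_add_left
      ((abs_sub _ _).trans (add_le_add_left ((abs_sub _ _).trans (add_le_add_left
      (abs_sub _ _) _)) _)) _)) _)) _)) _)) _)) _)
  rw [hsplit]
  refine (tri _ _ _ _ _ _ _ _ _ _).trans ?_
  have hk0 : 0 ≤ y ^ 2 * |k₁| := by positivity
  have m1 := mul_le_mul_of_nonneg_right hDD hE0
  have m2 := mul_le_mul_of_nonneg_right hDD hk0
  have m3 := mul_le_mul_of_nonneg_right hDD hy4.le
  have n1 : 0 ≤ D ^ 2 * (y ^ 2 * (1 - k)) := by positivity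
  have n2 : 0 ≤ D ^ 2 * (y ^ 2 * |k₁|) := by positivity
  have n3 : 0 ≤ D ^ 2 * y ^ 4 := by positivity
  have hfin : 30 * D ^ 2 * (y ^ 2 * (|k₁| + (1 - k)) + y ^ 4) =
    30 * (D ^ 2 * (y ^ 2 * |k₁|)) + 30 * (D ^ 2 * (y ^ 2 * (1 - k))) + 30 * (D ^ 2 * y ^ 4) := by
    ring
  rw [hfin]
  linarith only [d1, d2, d3, d4, d5, d6, d7, d8, d9, he₄, m1, m2, m3, n1, n2, n3]

/-! ### Components of the Hessian in radial and tangential directions. -/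

section Hessian

variable {G K : E3 → Bil} {m p : Bil} {C : ℝ} {x : E3}

/-- Derivatives of `G` with a radial slot are explicit: differentiating the radial condition
expresses them through `hyp` and `G`, without any decay estimate. The same holds for the next three
lemmas. -/
lemma PointBounds.fderiv_tangent_radial (h : PointBounds G K m p C x) {v w : E3}
    (hv : inner ℝ x v = 0) (hw : inner ℝ x w = 0) :
    fderiv ℝ G x v x w = inner ℝ v w / (1 + ‖x‖ ^ 2) - G x v w := by
  have hx : (1 + ‖x‖ ^ 2 : ℝ) ≠ 0 := by positivity
  rw [h.fderiv_radial, fderiv_hyp_apply, hyp_apply, hv, hw, real_inner_self_eq_norm_sq]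
  field_simp
  ring

lemma PointBounds.fderiv_radial_radial (h : PointBounds G K m p C x) {w : E3}
    (hw : inner ℝ x w = 0) : fderiv ℝ G x x x w = 0 := by
  rw [h.fderiv_radial, fderiv_hyp_apply, h.radial, hw]
  simp

lemma PointBounds.fderiv_tangent_self (h : PointBounds G K m p C x) {w : E3}
    (hw : inner ℝ x w = 0) : fderiv ℝ G x w x x = 0 := by
  rw [h.fderiv_radial, fderiv_hyp_apply, h.symm, h.radial, hyp_apply, hyp_apply, hw,
    real_inner_comm, hw]
  simp

lemma PointBounds.fderiv_self (h : PointBounds G K m p C x) :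
    fderiv ℝ G x x x x = -2 * ‖x‖ ^ 4 / (1 + ‖x‖ ^ 2) ^ 2 := by
  have hx : (1 + ‖x‖ ^ 2 : ℝ) ≠ 0 := by positivity
  rw [h.fderiv_radial, fderiv_hyp_apply, h.radial, real_inner_self_eq_norm_sq]
  field_simp
  ring

lemma PointBounds.hessBil_tangent (h : PointBounds G K m p C x) (f : E3 → ℝ) (s : ℝ)
    {Y v w : E3} (hv : inner ℝ x v = 0) (hw : inner ℝ x w = 0) :
    hessBil G f (s • x + Y) x v w = fderiv ℝ (fderiv ℝ f) x v w
      - s * (inner ℝ v w / (1 + ‖x‖ ^ 2) - G x v w) + 1 / 2 * s * fderiv ℝ G x x v w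
      - 1 / 2 * (fderiv ℝ G x v w Y + fderiv ℝ G x w v Y - fderiv ℝ G x Y v w) := by
  rw [hessBil_apply]
  simp only [map_add, map_smul, add_apply, smul_apply, smul_eq_mul]
  rw [h.fderiv_symm v w x, h.fderiv_symm w v x, h.fderiv_tangent_radial hv hw,
    h.fderiv_tangent_radial hw hv, h.symm w v, real_inner_comm]
  ring

/-- The terms multiplied by the radial part `s` of the gradient vanish one by one. The two terms
that pair `w` with `Y` through `fderiv_tangent_radial` are symmetric and cancel. -/
lemma PointBounds.hessBil_radial_tangent (h : PointBounds G K m p C x) (f : E3 → ℝ) (s : ℝ)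
    {Y w : E3} (hY : inner ℝ x Y = 0) (hw : inner ℝ x w = 0) :
    hessBil G f (s • x + Y) x x w = fderiv ℝ (fderiv ℝ f) x x w
      - 1 / 2 * fderiv ℝ G x x w Y := by
  rw [hessBil_apply]
  simp only [map_add, map_smul, add_apply, smul_apply, smul_eq_mul]
  rw [h.fderiv_symm x w x, h.fderiv_radial_radial hw, h.fderiv_tangent_self hw,
    h.fderiv_tangent_radial hw hY, h.fderiv_tangent_radial hY hw, h.symm Y w, real_inner_comm]
  ring

lemma PointBounds.hessBil_tangent_radial (h : PointBounds G K m p C x) (f : E3 → ℝ) (s : ℝ)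
    {Y w : E3} (hY : inner ℝ x Y = 0) (hw : inner ℝ x w = 0) :
    hessBil G f (s • x + Y) x w x = fderiv ℝ (fderiv ℝ f) x w x
      - 1 / 2 * fderiv ℝ G x x w Y := by
  rw [hessBil_apply]
  simp only [map_add, map_smul, add_apply, smul_apply, smul_eq_mul]
  rw [h.fderiv_symm x w x, h.fderiv_symm Y w x, h.fderiv_radial_radial hw,
    h.fderiv_tangent_self hw, h.fderiv_tangent_radial hw hY, h.fderiv_tangent_radial hY hw,
    h.symm Y w, real_inner_comm]
  ring

lemma PointBounds.hessBil_radial (h : PointBounds G K m p C x) (f : E3 → ℝ) (s : ℝ)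
    {Y : E3} (hY : inner ℝ x Y = 0) :
    hessBil G f (s • x + Y) x x x = fderiv ℝ (fderiv ℝ f) x x x
      + s * ‖x‖ ^ 4 / (1 + ‖x‖ ^ 2) ^ 2 := by
  rw [hessBil_apply]
  simp only [map_add, map_smul, add_apply, smul_apply, smul_eq_mul]
  rw [h.fderiv_radial_radial hY, h.fderiv_tangent_self hY, h.fderiv_self]
  ring

lemma PointBounds.abs_fderiv_normal_le (h : PointBounds G K m p C x) (hx : 1 ≤ ‖x‖) {v w : E3}
    (hv : inner ℝ x v = 0) (hw : inner ℝ x w = 0) :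
    |fderiv ℝ G x x v w| ≤ 4 * C * ‖x‖⁻¹ ^ 3 * ‖v‖ * ‖w‖ := by
  have hy0 : 0 < ‖x‖⁻¹ := inv_pos.mpr (by linarith)
  have hy1 : ‖x‖⁻¹ ≤ 1 := inv_le_one_of_one_le₀ hx
  have hC := h.nonneg
  have e1 := h.fderiv_normal v w hv hw
  have e2 : |3 * (‖x‖⁻¹ ^ 3 * m v w)| ≤ 3 * (‖x‖⁻¹ ^ 3 * (C * ‖v‖ * ‖w‖)) := by
    rw [abs_mul, abs_mul, abs_of_pos (by positivity : 0 < ‖x‖⁻¹ ^ 3),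
      abs_of_pos (by norm_num : (0 : ℝ) < 3)]
    gcongr
    exact h.m_bound v w
  have e3 : C * ‖x‖⁻¹ ^ 4 * ‖v‖ * ‖w‖ ≤ C * ‖x‖⁻¹ ^ 3 * ‖v‖ * ‖w‖ := by
    have := pow_le_pow_of_le_one hy0.le hy1 (show 3 ≤ 4 by norm_num)
    gcongr C * ?_ * _ * _
  have e4 : fderiv ℝ G x x v w = (fderiv ℝ G x x v w + 3 * (‖x‖⁻¹ ^ 3 * m v w))
    - 3 * (‖x‖⁻¹ ^ 3 * m v w) := by ring
  rw [e4]
  refine (abs_sub _ _).trans ((add_le_add (e1.trans e3) e2).trans (le_of_eq (by ring)))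

lemma PointBounds.abs_K_tangent_le (h : PointBounds G K m p C x) (hx : 1 ≤ ‖x‖) {v w : E3}
    (hv : inner ℝ x v = 0) (hw : inner ℝ x w = 0) :
    |K x v w| ≤ (1 + 2 * C) * ‖v‖ * ‖w‖ := by
  have hy0 : 0 < ‖x‖⁻¹ := inv_pos.mpr (by linarith)
  have hy1 : ‖x‖⁻¹ ≤ 1 := inv_le_one_of_one_le₀ hx
  have hC := h.nonneg
  have e1 := h.K_tangent v w hv hw
  have e2 : |‖x‖⁻¹ ^ 3 * p v w| ≤ 1 * (C * ‖v‖ * ‖w‖) := by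
    rw [abs_mul, abs_of_pos (by positivity : 0 < ‖x‖⁻¹ ^ 3)]
    gcongr
    · exact pow_le_one₀ hy0.le hy1
    · exact h.p_bound v w
  have e3 : C * ‖x‖⁻¹ ^ 4 * ‖v‖ * ‖w‖ ≤ C * 1 * ‖v‖ * ‖w‖ := by
    gcongr
    exact pow_le_one₀ hy0.le hy1
  have e4 := abs_real_inner_le_norm v w
  have e5 : K x v w = (K x v w - inner ℝ v w - ‖x‖⁻¹ ^ 3 * p v w) + ‖x‖⁻¹ ^ 3 * p v w
    + inner ℝ v w := by ring
  rw [e5]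
  refine (abs_add_le _ _).trans ((add_le_add ((abs_add_le _ _).trans
    (add_le_add (e1.trans e3) e2)) e4).trans (le_of_eq (by ring)))

end Hessian

/-- The slope data of a radial profile `φ` at radius `r`: with `ρ = √(1 + r²)` and `u = ρ φ'`, one
has `k = u / √(1 + u²)`, `s = √(1 - k²)` and `k₁ = ρ k'`. -/
structure RadialSlope (φ φ₁ : ℝ → ℝ) (φ₂ r k k₁ s : ℝ) : Prop where
  deriv : ∀ᶠ t in 𝓝 r, HasDerivAt φ (φ₁ t) t
  deriv2 : HasDerivAt φ₁ φ₂ r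
  pos : 0 < s
  sq : k ^ 2 + s ^ 2 = 1
  slope : √(1 + r ^ 2) * φ₁ r = k / s
  slope_deriv : (1 + r ^ 2) * φ₂ + r * φ₁ r = k₁ / s ^ 3

/-! ### Passage from the metric frame to the Euclidean frame in diagonal terms. -/

section Diagonal

variable {G K : E3 → Bil} {m p : Bil} {C : ℝ} {x n e : E3}

lemma PointBounds.scaled_diag_le (h : PointBounds G K m p C x) (hx : 1 ≤ ‖x‖) (he : ‖e‖ = 1)
    (hn : ‖n‖ ≤ 2) (hne : ‖n - e‖ ≤ 24 * C * ‖x‖⁻¹ ^ 3) {S : Bil}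
    (hS : ∀ v w, |S v w| ≤ C * ‖v‖ * ‖w‖) :
    |‖x‖⁻¹ ^ 3 * S n n - ‖x‖⁻¹ ^ 3 * S e e| ≤ 72 * C ^ 2 * ‖x‖⁻¹ ^ 4 := by
  have hy0 : 0 < ‖x‖⁻¹ := inv_pos.mpr (by linarith)
  have hy1 : ‖x‖⁻¹ ≤ 1 := inv_le_one_of_one_le₀ hx
  have hC := h.nonneg
  have e1 := abs_sub_diag_le hC hS he hn hne
  rw [← mul_sub, abs_mul, abs_of_pos (by positivity : 0 < ‖x‖⁻¹ ^ 3)]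
  calc _ ≤ ‖x‖⁻¹ ^ 3 * (3 * C * (24 * C * ‖x‖⁻¹ ^ 3)) := by gcongr
    _ = 72 * C ^ 2 * ‖x‖⁻¹ ^ 6 := by ring
    _ ≤ _ := by
      have := pow_le_pow_of_le_one hy0.le hy1 (show 4 ≤ 6 by norm_num)
      gcongr

lemma PointBounds.fderiv_normal_diag (h : PointBounds G K m p C x) (hC1 : 1 ≤ C) (hx : 1 ≤ ‖x‖)
    (he : ‖e‖ = 1) (hn : ‖n‖ ≤ 2) (hne : ‖n - e‖ ≤ 24 * C * ‖x‖⁻¹ ^ 3)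
    (hxn : inner ℝ x n = 0) :
    |fderiv ℝ G x x n n + 3 * ‖x‖⁻¹ ^ 3 * m e e| ≤ 220 * C ^ 2 * ‖x‖⁻¹ ^ 4 := by
  have hy0 : 0 < ‖x‖⁻¹ := inv_pos.mpr (by linarith)
  have e1 := h.fderiv_normal n n hxn hxn
  have e2 := h.scaled_diag_le hx he hn hne h.m_bound
  have e3 : C * ‖x‖⁻¹ ^ 4 * ‖n‖ * ‖n‖ ≤ 4 * C ^ 2 * ‖x‖⁻¹ ^ 4 := by
    calc _ ≤ C * ‖x‖⁻¹ ^ 4 * 2 * 2 := by gcongr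
      _ = 4 * C * ‖x‖⁻¹ ^ 4 * 1 := by ring
      _ ≤ 4 * C * ‖x‖⁻¹ ^ 4 * C := by gcongr
      _ = _ := by ring
  rw [show fderiv ℝ G x x n n + 3 * ‖x‖⁻¹ ^ 3 * m e e =
    (fderiv ℝ G x x n n + 3 * (‖x‖⁻¹ ^ 3 * m n n))
      - 3 * (‖x‖⁻¹ ^ 3 * m n n - ‖x‖⁻¹ ^ 3 * m e e) by ring]
  refine (abs_sub _ _).trans ?_
  rw [abs_mul 3, abs_of_pos (by norm_num : (0 : ℝ) < 3)]
  linarith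

/-- The vector `n` has unit length for `G`, so its Euclidean square length is `1 - ‖x‖⁻³ m(e,e)` up
to fourth order. This is the source of the `m`-term in the trace of `K`. -/
lemma PointBounds.K_diag (h : PointBounds G K m p C x) (hC1 : 1 ≤ C) (hx : 1 ≤ ‖x‖)
    (he : ‖e‖ = 1) (hn : ‖n‖ ≤ 2) (hne : ‖n - e‖ ≤ 24 * C * ‖x‖⁻¹ ^ 3)
    (hxn : inner ℝ x n = 0) (hG : G x n n = 1) :
    |K x n n - (1 - ‖x‖⁻¹ ^ 3 * m e e + ‖x‖⁻¹ ^ 3 * p e e)| ≤ 152 * C ^ 2 * ‖x‖⁻¹ ^ 4 := by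
  have hy0 : 0 < ‖x‖⁻¹ := inv_pos.mpr (by linarith)
  have e1 := h.K_tangent n n hxn hxn
  have e0 := h.metric n n hxn hxn
  have e2 := h.scaled_diag_le hx he hn hne h.m_bound
  have e4 := h.scaled_diag_le hx he hn hne h.p_bound
  have e3 : C * ‖x‖⁻¹ ^ 4 * ‖n‖ * ‖n‖ ≤ 4 * C ^ 2 * ‖x‖⁻¹ ^ 4 := by
    calc _ ≤ C * ‖x‖⁻¹ ^ 4 * 2 * 2 := by gcongr
      _ = 4 * C * ‖x‖⁻¹ ^ 4 * 1 := by ring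
      _ ≤ 4 * C * ‖x‖⁻¹ ^ 4 * C := by gcongr
      _ = _ := by ring
  rw [hG] at e0
  have a0 := abs_le.mp (e0.trans e3)
  have a1 := abs_le.mp (e1.trans e3)
  have a2 := abs_le.mp e2
  have a4 := abs_le.mp e4
  rw [abs_le]
  constructor <;> linarith only [a0.1, a0.2, a1.1, a1.2, a2.1, a2.2, a4.1, a4.2]

lemma ExtBounds.hess_diag {ψ Θ : S2 → ℝ} (h : ExtBounds ψ Θ C) (hx : 1 ≤ ‖x‖) (he : ‖e‖ = 1)
    (hn : ‖n‖ ≤ 2) (hne : ‖n - e‖ ≤ 24 * C * ‖x‖⁻¹ ^ 3) :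
    |fderiv ℝ (fderiv ℝ (ext ψ)) x n n - fderiv ℝ (fderiv ℝ (ext ψ)) x e e|
      ≤ 72 * C ^ 2 * ‖x‖⁻¹ ^ 4 := by
  have hx0 : x ≠ 0 := norm_pos_iff.mp (by linarith)
  have hy0 : 0 < ‖x‖⁻¹ := inv_pos.mpr (by linarith)
  have hy1 : ‖x‖⁻¹ ≤ 1 := inv_le_one_of_one_le₀ hx
  have hC := h.nonneg
  refine (abs_sub_diag_le (by positivity) (h.bound2 x hx0) he hn hne).trans ?_
  calc _ = 72 * C ^ 2 * ‖x‖⁻¹ ^ 5 := by ring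
    _ ≤ _ := by
      have := pow_le_pow_of_le_one hy0.le hy1 (show 4 ≤ 5 by norm_num)
      gcongr

lemma PointBounds.fderiv_tangent_diag (h : PointBounds G K m p C x) (hx : 1 ≤ ‖x‖)
    (hn : ‖n‖ ≤ 2) (hxn : inner ℝ x n = 0) {Y : E3} (hY : ‖Y‖ ≤ 8 * C * ‖x‖⁻¹)
    (hxY : inner ℝ x Y = 0) :
    |1 / 2 * (fderiv ℝ G x n n Y + fderiv ℝ G x n n Y - fderiv ℝ G x Y n n)|
      ≤ 48 * C ^ 2 * ‖x‖⁻¹ ^ 4 := by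
  have hy0 : 0 < ‖x‖⁻¹ := inv_pos.mpr (by linarith)
  have hC := h.nonneg
  have e1 := h.fderiv_tangent n n Y hxn hxn hxY
  have e2 := h.fderiv_tangent Y n n hxY hxn hxn
  have e3 : C * ‖x‖⁻¹ ^ 3 * ‖n‖ * ‖n‖ * ‖Y‖ ≤ 32 * C ^ 2 * ‖x‖⁻¹ ^ 4 := by
    calc _ ≤ C * ‖x‖⁻¹ ^ 3 * 2 * 2 * (8 * C * ‖x‖⁻¹) := by gcongr
      _ = _ := by ring
  have a1 := abs_le.mp (e1.trans e3)
  have a2 := abs_le.mp (e2.trans ((le_of_eq (by ring)).trans e3))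
  rw [abs_le]
  constructor <;> linarith only [a1.1, a1.2, a2.1, a2.2]

end Diagonal

set_option maxHeartbeats 1000000 in
/-- The expansion of the Jang operator of `φ(|x|) + ext ψ` near infinity. -/
theorem jang_estimate {G K : E3 → Bil} {m p : Bil} {ψ Θ : S2 → ℝ} {C : ℝ} {x : E3}
    (h : PointBounds G K m p C x) (hψ : ExtBounds ψ Θ C) (hC : 1 ≤ C) (hx : 1 ≤ ‖x‖)
    (hsmall : 24 * C * ‖x‖⁻¹ ^ 3 ≤ 1) (hm : ∀ v, m x v = 0) (hp : ∀ v, p x v = 0)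
    {φ φ₁ : ℝ → ℝ} {φ₂ k k₁ s : ℝ} (hφ : RadialSlope φ φ₁ φ₂ ‖x‖ k k₁ s) :
    |jang G K (fun y => φ ‖y‖ + ext ψ y) x
      - (k₁ - s ^ 2 + 2 * k * (√(1 + ‖x‖ ^ 2) * ‖x‖⁻¹) - 2
        + s * ‖x‖⁻¹ ^ 2 * Θ (sphereDir x)
        - ‖x‖⁻¹ ^ 3 * (1 / 2 * ∑ a, m (stdVec a) (stdVec a) + ∑ a, p (stdVec a) (stdVec a)))| ≤
    30 * (600 * C ^ 4) ^ 2 * (‖x‖⁻¹ ^ 2 * (|k₁| + (1 - k)) + ‖x‖⁻¹ ^ 4) := by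
  have hnx : 0 < ‖x‖ := by linarith
  have hx0 : x ≠ 0 := norm_pos_iff.mp hnx
  obtain ⟨e, n, F⟩ := h.exists_adaptedFrame hx (by linarith)
  obtain ⟨hfd, hf1, hf2⟩ := fderiv_radial_add hx0 hφ.deriv hφ.deriv2 hψ.diff (hψ.diff2 x hx0)
  set f : E3 → ℝ := fun y => φ ‖y‖ + ext ψ y with hfdef
  have hee := orthonormal_iff_ite.mp F.orthonormal
  have he1 : ‖e 1‖ = 1 := F.orthonormal.1 1
  have he2 : ‖e 2‖ = 1 := F.orthonormal.1 2
  have hn1 : ‖n 1‖ ≤ 2 := by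
    have := norm_add_le (n 1 - e 1) (e 1)
    rw [sub_add_cancel] at this
    linarith [F.close1]
  have hn2 : ‖n 2‖ ≤ 2 := by
    have := norm_add_le (n 2 - e 2) (e 2)
    rw [sub_add_cancel] at this
    linarith [F.close2]
  set y := ‖x‖⁻¹ with hy
  have hyx : y * ‖x‖ = 1 := inv_mul_cancel₀ hnx.ne'
  have hy0 : 0 < y := inv_pos.mpr hnx
  have hy1 : y ≤ 1 := inv_le_one_of_one_le₀ hx
  set ρ := √(1 + ‖x‖ ^ 2) with hρ
  have hρ2 : ρ ^ 2 = 1 + ‖x‖ ^ 2 := Real.sq_sqrt (by positivity)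
  have hρ0 : 0 < ρ := by positivity
  set z := ρ * y with hz
  have hz2 : z ^ 2 = 1 + y ^ 2 := by
    rw [hz, mul_pow, hρ2]
    linear_combination (y * ‖x‖ + 1) * hyx
  have hz0 : 0 < z := by positivity
  have hz1 : 1 ≤ z := by nlinarith only [hz2, hz0, sq_nonneg y]
  have hz1' : z - 1 ≤ y ^ 2 := by nlinarith only [hz2, hz1, sq_nonneg y]
  have hz_two : z ≤ 2 := by nlinarith only [hz1', hy0, hy1]
  have hN : n 0 = z • x := F.n_zero
  set a₁ := fderiv ℝ (ext ψ) x (n 1) with ha₁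
  set a₂ := fderiv ℝ (ext ψ) x (n 2) with ha₂
  set u := k / s with hu
  have hs0 := hφ.pos
  have hslope : u = ρ * φ₁ ‖x‖ := hφ.slope.symm
  have hd0 : fderiv ℝ f x (n 0) = u := by
    rw [hf1, hN, map_smul, hψ.radial x hx0, inner_smul_right, real_inner_self_eq_norm_sq,
      hslope, hz]
    simp only [smul_zero, add_zero]
    linear_combination (φ₁ ‖x‖ * ρ * (y * ‖x‖ + 1)) * hyx
  have hd1 : fderiv ℝ f x (n 1) = a₁ := by rw [hf1, F.tangent1]; ring
  have hd2 : fderiv ℝ f x (n 2) = a₂ := by rw [hf1, F.tangent2]; ring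
  set q := a₁ ^ 2 + a₂ ^ 2 with hq
  have hq0 : 0 ≤ q := by positivity
  set Y := a₁ • n 1 + a₂ • n 2 with hY
  have hxY : inner ℝ x Y = 0 := by
    rw [hY, inner_add_right, inner_smul_right, inner_smul_right, F.tangent1, F.tangent2]
    simp
  have hZ : frameGrad f n x = (u * z) • x + Y := by
    rw [frameGrad, Fin.sum_univ_three, hd0, hd1, hd2, hN, smul_smul, hY, add_assoc]
  have hC0 : 0 ≤ C := by linarith
  have ha₁b : |a₁| ≤ 2 * C * y := by
    refine (hψ.bound1 x hx0 _).trans ?_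
    calc _ ≤ C * y * 2 := by gcongr
      _ = _ := by ring
  have ha₂b : |a₂| ≤ 2 * C * y := by
    refine (hψ.bound1 x hx0 _).trans ?_
    calc _ ≤ C * y * 2 := by gcongr
      _ = _ := by ring
  have hqb : q ≤ 8 * C ^ 2 * y ^ 2 := by
    have h1 := pow_le_pow_left₀ (abs_nonneg _) ha₁b 2
    have h2 := pow_le_pow_left₀ (abs_nonneg _) ha₂b 2
    rw [sq_abs] at h1 h2
    calc q ≤ (2 * C * y) ^ 2 + (2 * C * y) ^ 2 := add_le_add h1 h2
      _ = _ := by ring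
  have hYb : ‖Y‖ ≤ 8 * C * y := by
    refine (norm_add_le _ _).trans ?_
    rw [norm_smul, norm_smul, Real.norm_eq_abs, Real.norm_eq_abs]
    calc _ ≤ 2 * C * y * 2 + 2 * C * y * 2 := by gcongr
      _ = _ := by ring
  have hψY : fderiv ℝ (ext ψ) x Y = q := by
    rw [hY, map_add, map_smul, map_smul, smul_eq_mul, smul_eq_mul, hq]; ring
  have hGn : ∀ i j, G x (n i) (n j) = if i = j then 1 else 0 := F.isFrame
  have hGYY : G x Y Y = q := by
    simp only [hY, map_add, map_smul, add_apply, smul_apply, smul_eq_mul, hGn]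
    simp [hq]
    ring
  -- the Hessian of `f`
  have hcancel : u * z * (1 + ‖x‖ ^ 2)⁻¹ = φ₁ ‖x‖ * y := by
    rw [hslope, ← hρ2, hz]
    field_simp
  have Htt : ∀ v w, inner ℝ x v = 0 → inner ℝ x w = 0 →
      hessBil G f ((u * z) • x + Y) x v w = u * z * G x v w
        + 1 / 2 * (u * z) * fderiv ℝ G x x v w + fderiv ℝ (fderiv ℝ (ext ψ)) x v w
        - 1 / 2 * (fderiv ℝ G x v w Y + fderiv ℝ G x w v Y - fderiv ℝ G x Y v w) := by
    intro v w hv hw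
    rw [h.hessBil_tangent f _ hv hw, hf2, hv, hw, div_eq_mul_inv]
    linear_combination (-inner ℝ v w) * hcancel
  have HNY : hessBil G f ((u * z) • x + Y) x (n 0) Y =
      z * (-q - 1 / 2 * fderiv ℝ G x x Y Y) := by
    rw [hN, map_smul, smul_apply, h.hessBil_radial_tangent f _ hxY hxY, hf2, hxY,
      hψ.radial_left x hx0, hψY, smul_eq_mul]
    ring
  have HYN : hessBil G f ((u * z) • x + Y) x Y (n 0) =
      z * (-q - 1 / 2 * fderiv ℝ G x x Y Y) := by
    rw [hN, map_smul, h.hessBil_tangent_radial f _ hxY hxY, hf2, hxY, real_inner_comm, hxY,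
      hψ.radial_right x hx0, hψY, smul_eq_mul]
    ring
  have HNN : hessBil G f ((u * z) • x + Y) x (n 0) (n 0) = k₁ / s ^ 3 := by
    rw [hN, map_smul, map_smul, smul_apply, h.hessBil_radial f _ hxY, hf2,
      hψ.radial_left x hx0, hψ.radial x hx0, real_inner_self_eq_norm_sq, ← hφ.slope_deriv,
      ← hρ2, div_eq_mul_inv]
    have h1 : (u * z * ‖x‖ ^ 4 * ((ρ ^ 2) ^ 2)⁻¹) = φ₁ ‖x‖ * y * ‖x‖ ^ 4 * (ρ ^ 2)⁻¹ := by
      rw [← hcancel, hρ2]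
      field_simp
    rw [h1, hz, hy]
    simp only [smul_eq_mul]
    field_simp
    rw [hρ2]
    ring
  -- the expansion
  have hks := hφ.sq
  -- Here `√(1 + |df|²) = (w s)⁻¹`; the factor `w` records the tangential gradient and equals `1`
  -- when `q = 0`.
  set w := (√(1 + q * s ^ 2))⁻¹ with hw
  have hw0 : 0 < w := by positivity
  have hwq : w ^ 2 * (1 + q * s ^ 2) = 1 := by
    rw [hw, inv_pow, Real.sq_sqrt (by positivity), inv_mul_cancel₀ (by positivity)]
  have hw1 : w ≤ 1 := by
    have : 0 ≤ w ^ 2 * (q * s ^ 2) := by positivity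
    nlinarith only [this, hwq, hw0]
  have hs1 : s ≤ 1 := by nlinarith only [hks, sq_nonneg k, hs0]
  have hW0 : 0 < (w * s)⁻¹ := by positivity
  have hW2 : (w * s)⁻¹ ^ 2 = 1 + ∑ i, fderiv ℝ f x (n i) ^ 2 := by
    rw [Fin.sum_univ_three, hd0, hd1, hd2, add_assoc, ← hq, hu]
    field_simp
    linear_combination (-1 : ℝ) * hwq - w ^ 2 * hks
  rw [jang_eq_frame F.isFrame h.diff hfd hW0 hW2, hZ]
  set H := hessBil G f ((u * z) • x + Y) x with hH
  have hZN : (u * z) • x + Y = u • n 0 + Y := by rw [hN, smul_smul]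
  have hHZ : H ((u * z) • x + Y) ((u * z) • x + Y) = u ^ 2 * (k₁ / s ^ 3)
      + u * (H (n 0) Y + H Y (n 0)) + H Y Y := by
    rw [hZN]
    simp only [map_add, map_smul, add_apply, smul_apply, smul_eq_mul, HNN]
    ring
  have hKZ : K x ((u * z) • x + Y) ((u * z) • x + Y) = u ^ 2 * K x (n 0) (n 0)
      + u * (K x (n 0) Y + K x Y (n 0)) + K x Y Y := by
    rw [hZN]
    simp only [map_add, map_smul, add_apply, smul_apply, smul_eq_mul]
    ring
  have ht1 := F.tangent1
  have ht2 := F.tangent2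
  set M := m (e 1) (e 1) + m (e 2) (e 2) with hM
  set P := p (e 1) (e 1) + p (e 2) (e 2) with hP
  -- The form vanishes on the radial vector `e 0`, so its trace over `ℝ³` is a trace over the
  -- tangent plane.
  have hsumM : ∑ a, m (stdVec a) (stdVec a) = M := by
    rw [sum_stdVec_eq_sum F.orthonormal, Fin.sum_univ_three, F.e_zero]
    simp [hm, hM]
  have hsumP : ∑ a, p (stdVec a) (stdVec a) = P := by
    rw [sum_stdVec_eq_sum F.orthonormal, Fin.sum_univ_three, F.e_zero]
    simp [hp, hP]
  have hlap := hψ.laplacian x hx0 e F.orthonormal F.e_zero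
  rw [← hy] at hlap
  set T := Θ (sphereDir x) with hT
  set e₁ := -(1 / 2 * (fderiv ℝ G x (n 1) (n 1) Y + fderiv ℝ G x (n 1) (n 1) Y
      - fderiv ℝ G x Y (n 1) (n 1)))
    - 1 / 2 * (fderiv ℝ G x (n 2) (n 2) Y + fderiv ℝ G x (n 2) (n 2) Y
      - fderiv ℝ G x Y (n 2) (n 2)) with he₁
  set e₂ := (fderiv ℝ G x x (n 1) (n 1) + 3 * y ^ 3 * m (e 1) (e 1))
    + (fderiv ℝ G x x (n 2) (n 2) + 3 * y ^ 3 * m (e 2) (e 2)) with he₂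
  set e₃ := (fderiv ℝ (fderiv ℝ (ext ψ)) x (n 1) (n 1)
      - fderiv ℝ (fderiv ℝ (ext ψ)) x (e 1) (e 1))
    + (fderiv ℝ (fderiv ℝ (ext ψ)) x (n 2) (n 2)
      - fderiv ℝ (fderiv ℝ (ext ψ)) x (e 2) (e 2)) with he₃
  set e₄ := (K x (n 1) (n 1) - (1 - y ^ 3 * m (e 1) (e 1) + y ^ 3 * p (e 1) (e 1)))
    + (K x (n 2) (n 2) - (1 - y ^ 3 * m (e 2) (e 2) + y ^ 3 * p (e 2) (e 2))) with he₄
  have hHS : H (n 1) (n 1) + H (n 2) (n 2) = 2 * (u * z) + 1 / 2 * (u * z) * (-3 * y ^ 3 * M + e₂)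
      + (y ^ 2 * T + e₃ + e₁) := by
    rw [hH, Htt _ _ ht1 ht1, Htt _ _ ht2 ht2, hGn, hGn, if_pos rfl, if_pos rfl, ← hlap, he₁, he₂,
      he₃, hM]
    ring
  have hKS : K x (n 1) (n 1) + K x (n 2) (n 2) = 2 - y ^ 3 * M + y ^ 3 * P + e₄ := by
    rw [he₄, hM, hP]; ring
  have hJ : ∑ i, (H (n i) (n i) / (w * s)⁻¹ - K x (n i) (n i))
      - (H ((u * z) • x + Y) ((u * z) • x + Y) / (w * s)⁻¹
        - K x ((u * z) • x + Y) ((u * z) • x + Y)) / (w * s)⁻¹ ^ 2 =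
      (1 + q) * w ^ 3 * k₁ - (1 + q) * s ^ 2 * w ^ 2 * K x (n 0) (n 0)
      - k * w ^ 2 * s * ((H (n 0) Y + H Y (n 0)) * (w * s) - (K x (n 0) Y + K x Y (n 0)))
      - s ^ 2 * w ^ 2 * (H Y Y * (w * s) - K x Y Y)
      + (2 * k * w * z + 1 / 2 * (k * w * z) * (-3 * y ^ 3 * M + e₂)
        + w * s * (y ^ 2 * T + e₃ + e₁) - (2 - y ^ 3 * M + y ^ 3 * P + e₄)) := by
    have hus : u * s = k := div_mul_cancel₀ _ hs0.ne'
    have hk1 : k₁ / s ^ 3 * s ^ 3 = k₁ := div_mul_cancel₀ _ (by positivity)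
    -- The weight of the normal-normal component after projection along the gradient.
    have h1 : 1 - u ^ 2 * (w * s) ^ 2 = (1 + q) * (w * s) ^ 2 := by
      linear_combination (-1 : ℝ) * hwq - w ^ 2 * hks + (-w ^ 2 * (u * s + k)) * hus
    rw [Fin.sum_univ_three, hHZ, hKZ, HNN]
    simp only [inv_pow, div_inv_eq_mul]
    have h2 : ∀ A B, A * (w * s) - B + (H (n 1) (n 1) * (w * s) - K x (n 1) (n 1))
        + (H (n 2) (n 2) * (w * s) - K x (n 2) (n 2)) = A * (w * s) - B +
        ((H (n 1) (n 1) + H (n 2) (n 2)) * (w * s) - (K x (n 1) (n 1) + K x (n 2) (n 2))) := by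
      intro A B; ring
    rw [h2, hHS, hKS]
    linear_combination (k₁ / s ^ 3 * (w * s) - K x (n 0) (n 0)) * h1
      + (1 + q) * w ^ 3 * hk1
      + (-w ^ 2 * s * ((H (n 0) Y + H Y (n 0)) * (w * s) - (K x (n 0) Y + K x Y (n 0)))
        + 2 * w * z + 1 / 2 * w * z * (-3 * y ^ 3 * M + e₂)) * hus
  rw [hJ, hsumM, hsumP]
  have hkabs : |k| ≤ 1 := abs_le_one_iff_mul_self_le_one.mpr (by nlinarith only [hks, sq_nonneg s])
  have hC4 : 1 ≤ C ^ 4 := one_le_pow₀ hC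
  have hC24 : C ^ 2 ≤ C ^ 4 := pow_le_pow_right₀ hC (by norm_num)
  have hC34 : C ^ 3 ≤ C ^ 4 := pow_le_pow_right₀ hC (by norm_num)
  have hC14 : C ≤ C ^ 4 := le_self_pow₀ hC (by norm_num)
  have hDGY : |fderiv ℝ G x x Y Y| ≤ 256 * C ^ 3 * y ^ 2 := by
    refine (h.abs_fderiv_normal_le hx hxY hxY).trans ?_
    calc _ ≤ 4 * C * y ^ 3 * (8 * C * y) * (8 * C * y) := by gcongr
      _ = 256 * C ^ 3 * y ^ 5 := by ring
      _ ≤ _ := by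
        have := pow_le_pow_of_le_one hy0.le hy1 (show 2 ≤ 5 by norm_num)
        gcongr
  have hkw : |k * w| ≤ 1 := by
    rw [mul_comm]
    exact abs_mul_le_of_abs_le_one (by rw [abs_of_pos hw0]; exact hw1) hkabs
  have hws1 : |w * s| ≤ 1 :=
    abs_mul_le_of_abs_le_one (by rw [abs_of_pos hw0]; exact hw1) (by rw [abs_of_pos hs0]; exact hs1)
  -- `600 C⁴` dominates all the individual constants; the largest is that of `HY`, namely `16 + 256
  -- + 64 + 256 = 592`.
  refine le_trans (le_of_eq ?_) (jang_expansion hy0 hy1 (D := 600 * C ^ 4) (by linarith) hz1 hz1'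
    hks hs0 hw0 hwq hq0 (hqb.trans ?_) (KN := K x (n 0) (n 0)) ?_ (HX := H (n 0) Y + H Y (n 0)) ?_
    (KX := K x (n 0) Y + K x Y (n 0)) ?_ (HY := H Y Y) ?_ (KY := K x Y Y) ?_ (M := M) ?_ (T := T) ?_
    (e₁ := e₁) ?_ (e₂ := e₂) ?_ (e₃ := e₃) ?_ (e₄ := e₄) ?_ (P := P) (k₁ := k₁))
  · congr 1
  · gcongr; norm_num
  · rw [F.n_zero]
    refine h.K_normal.trans ?_
    gcongr; linarith
  · rw [HNY, HYN, ← two_mul, ← mul_assoc, abs_mul, abs_of_pos (by positivity)]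
    have h1 : |-q - 1 / 2 * fderiv ℝ G x x Y Y| ≤ 136 * C ^ 4 * y ^ 2 := by
      have h3 := abs_le.mp hDGY
      have h4 : C ^ 2 * y ^ 2 ≤ C ^ 4 * y ^ 2 := by gcongr
      have h5 : C ^ 3 * y ^ 2 ≤ C ^ 4 * y ^ 2 := by gcongr
      rw [abs_le]
      constructor <;> linarith only [h3.1, h3.2, h4, h5, hq0, hqb]
    calc _ ≤ 2 * 2 * (136 * C ^ 4 * y ^ 2) := by gcongr
      _ ≤ _ := by nlinarith only [pow_pos hy0 2, hC4, mul_pos (pow_pos hy0 2) (by linarith : 0 < C ^ 4)]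
  · have h1 := h.K_mixed Y hxY
    have h2 := h.K_mixed' Y hxY
    rw [← F.n_zero] at h1 h2
    refine (abs_add_le _ _).trans ((add_le_add h1 h2).trans ?_)
    calc _ ≤ C * y ^ 3 * (8 * C * y) + C * y ^ 3 * (8 * C * y) := by gcongr
      _ = 16 * C ^ 2 * y ^ 4 := by ring
      _ ≤ _ := by gcongr; norm_num
  · have h1 : H Y Y * (w * s) = k * w * (z * q) + k * w * (1 / 2 * z * fderiv ℝ G x x Y Y)
        + w * s * fderiv ℝ (fderiv ℝ (ext ψ)) x Y Y
        - w * s * (1 / 2 * fderiv ℝ G x Y Y Y) := by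
      have hus : u * s = k := div_mul_cancel₀ _ hs0.ne'
      rw [hH, Htt _ _ hxY hxY, hGYY]
      linear_combination (w * (z * q) + w * (1 / 2 * z * fderiv ℝ G x x Y Y)) * hus
    have b1 : |k * w * (z * q)| ≤ 16 * C ^ 4 * y ^ 2 := by
      refine abs_mul_le_of_abs_le_one hkw ?_
      rw [abs_of_nonneg (by positivity)]
      calc _ ≤ 2 * (8 * C ^ 2 * y ^ 2) := by gcongr
        _ = 16 * C ^ 2 * y ^ 2 := by ring
        _ ≤ _ := by gcongr
    have b2 : |k * w * (1 / 2 * z * fderiv ℝ G x x Y Y)| ≤ 256 * C ^ 4 * y ^ 2 := by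
      refine abs_mul_le_of_abs_le_one hkw (abs_mul_le_of_abs_le_one ?_ (hDGY.trans ?_))
      · rw [abs_of_pos (by positivity)]; linarith
      · gcongr
    have b3 : |w * s * fderiv ℝ (fderiv ℝ (ext ψ)) x Y Y| ≤ 64 * C ^ 4 * y ^ 2 := by
      refine abs_mul_le_of_abs_le_one hws1 ((hψ.bound2 x hx0 Y Y).trans ?_)
      calc _ ≤ C * y ^ 2 * (8 * C * y) * (8 * C * y) := by gcongr
        _ = 64 * C ^ 3 * y ^ 4 := by ring
        _ ≤ _ := by
          have := pow_le_pow_of_le_one hy0.le hy1 (show 2 ≤ 4 by norm_num)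
          gcongr
    have b4 : |w * s * (1 / 2 * fderiv ℝ G x Y Y Y)| ≤ 256 * C ^ 4 * y ^ 2 := by
      refine abs_mul_le_of_abs_le_one hws1 ?_
      rw [abs_mul, abs_of_pos (by norm_num : (0 : ℝ) < 1 / 2)]
      calc _ ≤ 1 / 2 * (C * y ^ 3 * (8 * C * y) * (8 * C * y) * (8 * C * y)) := by
            gcongr
            refine (h.fderiv_tangent Y Y Y hxY hxY hxY).trans ?_
            gcongr
        _ = 256 * C ^ 4 * y ^ 6 := by ring
        _ ≤ _ := by
          have := pow_le_pow_of_le_one hy0.le hy1 (show 2 ≤ 6 by norm_num)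
          gcongr
    rw [h1]
    refine (abs_sub _ _).trans ((add_le_add ((abs_add_le _ _).trans (add_le_add
      ((abs_add_le _ _).trans (add_le_add b1 b2)) b3)) b4).trans ?_)
    have : 0 ≤ C ^ 4 * y ^ 2 := by positivity
    linarith
  · refine (h.abs_K_tangent_le hx hxY hxY).trans ?_
    calc _ ≤ (C + 2 * C) * (8 * C * y) * (8 * C * y) := by gcongr
      _ = 192 * C ^ 3 * y ^ 2 := by ring
      _ ≤ _ := by gcongr; norm_num
  · have h1 := h.m_bound (e 1) (e 1)
    have h2 := h.m_bound (e 2) (e 2)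
    rw [he1] at h1
    rw [he2] at h2
    refine (abs_add_le _ _).trans ((add_le_add h1 h2).trans ?_)
    linarith
  · have h1 := hψ.bound2 x hx0 (e 1) (e 1)
    have h2 := hψ.bound2 x hx0 (e 2) (e 2)
    rw [he1] at h1
    rw [he2] at h2
    have h3 : |y ^ 2 * T| ≤ y ^ 2 * (2 * C) := by
      rw [← hlap]
      exact (abs_add_le _ _).trans ((add_le_add h1 h2).trans (le_of_eq (by ring)))
    rw [abs_mul, abs_of_pos (by positivity)] at h3
    have := le_of_mul_le_mul_left h3 (by positivity)
    linarith
  · have h1 := h.fderiv_tangent_diag hx hn1 ht1 hYb hxY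
    have h2 := h.fderiv_tangent_diag hx hn2 ht2 hYb hxY
    rw [he₁]
    refine (abs_sub _ _).trans ?_
    rw [abs_neg]
    refine (add_le_add h1 h2).trans ?_
    rw [← add_mul, ← add_mul]
    gcongr
    norm_num
  · have h1 := h.fderiv_normal_diag hC hx he1 hn1 F.close1 ht1
    have h2 := h.fderiv_normal_diag hC hx he2 hn2 F.close2 ht2
    refine (abs_add_le _ _).trans ((add_le_add h1 h2).trans ?_)
    rw [← add_mul, ← add_mul]
    gcongr
    norm_num
  · have h1 := hψ.hess_diag hx he1 hn1 F.close1
    have h2 := hψ.hess_diag hx he2 hn2 F.close2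
    refine (abs_add_le _ _).trans ((add_le_add h1 h2).trans ?_)
    rw [← add_mul, ← add_mul]
    gcongr
    norm_num
  · have h1 := h.K_diag hC hx he1 hn1 F.close1 ht1 (by rw [hGn, if_pos rfl])
    have h2 := h.K_diag hC hx he2 hn2 F.close2 ht2 (by rw [hGn, if_pos rfl])
    refine (abs_add_le _ _).trans ((add_le_add h1 h2).trans ?_)
    rw [← add_mul, ← add_mul]
    gcongr
    norm_num

/-! ### Estimates in one variable -/

section Profile

variable {y z α d D Θ B k k₁ s : ℝ}

lemma one_le_of_sq_eq (hz0 : 0 < z) (hz2 : z ^ 2 = 1 + y ^ 2) : 1 ≤ z := by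
  nlinarith only [hz0, hz2, sq_nonneg y]

lemma sub_one_le_of_sq_eq (hz0 : 0 < z) (hz2 : z ^ 2 = 1 + y ^ 2) : z - 1 ≤ y ^ 2 := by
  have h1 := one_le_of_sq_eq hz0 hz2
  nlinarith only [h1, hz2, sq_nonneg y]

/-- The slope `k = 1/z + α y³ + d` is `1/z` up to a small error. -/
lemma abs_sq_sub_le (hy0 : 0 < y) (hy1 : y ≤ 1) (hz0 : 0 < z) (hz2 : z ^ 2 = 1 + y ^ 2)
    (hB : 1 ≤ B) (hα : |α| ≤ B) (hd : |d| ≤ 2) (hk : k = z⁻¹ + α * y ^ 3 + d)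
    (hks : k ^ 2 + s ^ 2 = 1) :
    |s ^ 2 - y ^ 2| ≤ y ^ 4 + (B + 4) * (B * y ^ 3 + |d|) := by
  have hz1 := one_le_of_sq_eq hz0 hz2
  have hi1 : z⁻¹ ≤ 1 := inv_le_one_of_one_le₀ hz1
  have hi0 : 0 < z⁻¹ := inv_pos.mpr hz0
  have hzi : z * z⁻¹ = 1 := mul_inv_cancel₀ hz0.ne'
  have hi2 : z⁻¹ ^ 2 * (1 + y ^ 2) = 1 := by
    rw [← hz2, ← mul_pow, mul_comm, hzi, one_pow]
  set w := α * y ^ 3 + d with hw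
  have hwb : |w| ≤ B * y ^ 3 + |d| := by
    refine (abs_add_le _ _).trans ?_
    rw [abs_mul, abs_of_pos (pow_pos hy0 3)]
    gcongr
  have hw2 : |2 * z⁻¹ + w| ≤ B + 4 := by
    refine (abs_add_le _ _).trans ?_
    rw [abs_of_pos (by positivity)]
    have : B * y ^ 3 ≤ B * 1 := by
      gcongr
      exact pow_le_one₀ hy0.le hy1
    linarith
  have e : s ^ 2 - y ^ 2 = -(z⁻¹ ^ 2 * y ^ 4) - (2 * z⁻¹ + w) * w := by
    have : k = z⁻¹ + w := by rw [hk, hw]; ring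
    rw [this] at hks
    linear_combination hks + (y ^ 2 - 1) * hi2
  rw [e]
  refine (abs_sub _ _).trans (add_le_add ?_ ?_)
  · rw [abs_neg, abs_of_pos (by positivity)]
    exact mul_le_of_le_one_left (by positivity) (pow_le_one₀ hi0.le hi1)
  · rw [abs_mul]
    gcongr

/-- The part `1/z` of `k` solves the equation of the hyperboloid exactly. The part `α y³`
contributes `α y³ (2/z - z)`, and `s y² Θ` is close to `y³ Θ`, so both match the subtracted `y³ (Θ +
α)`. The part `d` gives `2d/z + 2dz ≈ 4d` together with `zD ≈ D` and `d²`. -/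
lemma radial_estimate (hy0 : 0 < y) (hy1 : y ≤ 1) (hz0 : 0 < z) (hz2 : z ^ 2 = 1 + y ^ 2)
    (hB : 1 ≤ B) (hα : |α| ≤ B) (hΘ : |Θ| ≤ B) (hd : |d| ≤ 2) (hD : |D| ≤ 4 * |d|)
    (hk : k = z⁻¹ + α * y ^ 3 + d) (hk₁ : k₁ = y ^ 2 * z⁻¹ ^ 2 - 3 * α * z * y ^ 3 + z * D)
    (hs : 0 < s) (hks : k ^ 2 + s ^ 2 = 1) :
    |k₁ - s ^ 2 + 2 * k * z - 2 + s * y ^ 2 * Θ - y ^ 3 * (Θ + α) - (D + 4 * d + d ^ 2)|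
      ≤ 15 * B ^ 3 * (y ^ 4 + y * |d|) := by
  have hz1 := one_le_of_sq_eq hz0 hz2
  have hz1' := sub_one_le_of_sq_eq hz0 hz2
  have hi1 : z⁻¹ ≤ 1 := inv_le_one_of_one_le₀ hz1
  have hi0 : 0 < z⁻¹ := inv_pos.mpr hz0
  have hzi : z * z⁻¹ = 1 := mul_inv_cancel₀ hz0.ne'
  have hi2 : z⁻¹ ^ 2 * (1 + y ^ 2) = 1 := by
    rw [← hz2, ← mul_pow, mul_comm, hzi, one_pow]
  have hd0 := abs_nonneg d
  have p54 : y ^ 5 ≤ y ^ 4 := pow_le_pow_of_le_one hy0.le hy1 (by norm_num)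
  have p64 : y ^ 6 ≤ y ^ 4 := pow_le_pow_of_le_one hy0.le hy1 (by norm_num)
  have p21 : y ^ 2 ≤ y := by nlinarith only [hy0, hy1]
  have p31 : y ^ 3 ≤ y := pow_le_of_le_one hy0.le hy1 (by norm_num)
  have p41 : y ^ 4 ≤ y := pow_le_of_le_one hy0.le hy1 (by norm_num)
  have hB0 : 0 ≤ B := by linarith
  have hB1 : B ≤ B ^ 3 := le_self_pow₀ hB (by norm_num)
  have hB2 : B ^ 2 ≤ B ^ 3 := pow_le_pow_right₀ hB (by norm_num)
  have hB3 : 1 ≤ B ^ 3 := one_le_pow₀ hB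
  have hyd : 0 ≤ y * |d| := by positivity
  have hy4 : 0 < y ^ 4 := by positivity
  have e : k₁ - s ^ 2 + 2 * k * z - 2 + s * y ^ 2 * Θ - y ^ 3 * (Θ + α) - (D + 4 * d + d ^ 2)
      = α * y ^ 3 * (2 * z⁻¹ - z - 1) + (z - 1) * D + d * (2 * z⁻¹ + 2 * z - 4)
        + 2 * α * y ^ 3 * d + α ^ 2 * y ^ 6 + y ^ 2 * (s - y) * Θ := by
    rw [hk] at hks ⊢
    rw [hk₁]
    linear_combination (-1 : ℝ) * hks + hi2 + 2 * hzi
  have b1 : |α * y ^ 3 * (2 * z⁻¹ - z - 1)| ≤ 3 * B ^ 3 * y ^ 4 := by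
    have h1 : |2 * z⁻¹ - z - 1| ≤ 3 * y ^ 2 := by
      rw [abs_le]
      constructor
      · nlinarith only [hi0, hi1, hzi, hz1, hz1']
      · nlinarith only [hi1, hz1, sq_nonneg y]
    rw [abs_mul, abs_mul, abs_of_pos (pow_pos hy0 3)]
    calc _ ≤ B * y ^ 3 * (3 * y ^ 2) := by gcongr
      _ = 3 * B * y ^ 5 := by ring
      _ ≤ _ := by gcongr
  have b2 : |(z - 1) * D| ≤ 4 * B ^ 3 * (y * |d|) := by
    rw [abs_mul, abs_of_nonneg (by linarith)]
    calc _ ≤ y * (4 * |d|) := by gcongr; linarith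
      _ = 4 * 1 * (y * |d|) := by ring
      _ ≤ _ := by gcongr
  have b3 : |d * (2 * z⁻¹ + 2 * z - 4)| ≤ 2 * B ^ 3 * (y * |d|) := by
    have h1 : |2 * z⁻¹ + 2 * z - 4| ≤ 2 * y := by
      rw [abs_le]
      constructor
      · nlinarith only [hi0, hi1, hzi, hz1, hy0]
      · linarith only [hi1, hz1', p21]
    rw [abs_mul]
    calc _ ≤ |d| * (2 * y) := by gcongr
      _ = 2 * 1 * (y * |d|) := by ring
      _ ≤ _ := by gcongr
  have b4 : |2 * α * y ^ 3 * d| ≤ 2 * B ^ 3 * (y * |d|) := by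
    rw [abs_mul, abs_mul, abs_mul, abs_of_pos (pow_pos hy0 3), abs_of_pos (two_pos)]
    calc _ ≤ 2 * B ^ 3 * y * |d| := by
          gcongr
          linarith
      _ = _ := by ring
  have b5 : |α ^ 2 * y ^ 6| ≤ B ^ 3 * y ^ 4 := by
    rw [abs_mul, abs_pow, abs_of_pos (pow_pos hy0 6)]
    calc _ ≤ B ^ 2 * y ^ 4 := by gcongr
      _ ≤ _ := by gcongr
  have b6 : |y ^ 2 * (s - y) * Θ| ≤ 6 * B ^ 3 * y ^ 4 + 5 * B ^ 3 * (y * |d|) := by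
    -- Since `s + y ≥ y`, the estimate for `s²` transfers to `s` at the cost of one of the two
    -- available factors `y`.
    have h1 : y * |s - y| ≤ |s ^ 2 - y ^ 2| := by
      rw [show s ^ 2 - y ^ 2 = (s + y) * (s - y) by ring, abs_mul,
        abs_of_pos (by positivity : 0 < s + y)]
      gcongr
      linarith
    have h2 := h1.trans (abs_sq_sub_le hy0 hy1 hz0 hz2 hB hα hd hk hks)
    rw [abs_mul, abs_mul, abs_of_pos (pow_pos hy0 2)]
    calc _ = y * (y * |s - y|) * |Θ| := by ring
      _ ≤ y * (y ^ 4 + (B + 4) * (B * y ^ 3 + |d|)) * B := by gcongr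
      _ = B * y ^ 5 + (B ^ 3 + 4 * B ^ 2) * y ^ 4 + (B ^ 2 + 4 * B) * (y * |d|) := by ring
      _ ≤ B ^ 3 * y ^ 4 + (B ^ 3 + 4 * B ^ 3) * y ^ 4 + (B ^ 3 + 4 * B ^ 3) * (y * |d|) := by
          gcongr
      _ = _ := by ring
  rw [e]
  refine (abs_add_le _ _).trans ((add_le_add ((abs_add_le _ _).trans (add_le_add
    ((abs_add_le _ _).trans (add_le_add ((abs_add_le _ _).trans (add_le_add
    ((abs_add_le _ _).trans (add_le_add b1 b2)) b3)) b4)) b5)) b6).trans ?_)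
  have h1 : 0 ≤ B ^ 3 * y ^ 4 := by positivity
  have h2 : 0 ≤ B ^ 3 * (y * |d|) := by positivity
  linarith only [h1, h2]

/-- Both `|k₁|` and `1 - k` are `O(y² + |d|)`. This puts the error of `jang_estimate` into the form
`y⁴ + y|d|` that `BarrierSlope` absorbs. -/
lemma slope_error_le (hy0 : 0 < y) (hy1 : y ≤ 1) (hz0 : 0 < z) (hz2 : z ^ 2 = 1 + y ^ 2)
    (hB : 1 ≤ B) (hα : |α| ≤ B) (hD : |D| ≤ 4 * |d|)
    (hk : k = z⁻¹ + α * y ^ 3 + d) (hk₁ : k₁ = y ^ 2 * z⁻¹ ^ 2 - 3 * α * z * y ^ 3 + z * D) :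
    y ^ 2 * (|k₁| + (1 - k)) ≤ 9 * B * (y ^ 4 + y * |d|) := by
  have hz1 := one_le_of_sq_eq hz0 hz2
  have hz1' := sub_one_le_of_sq_eq hz0 hz2
  have hi1 : z⁻¹ ≤ 1 := inv_le_one_of_one_le₀ hz1
  have hi0 : 0 < z⁻¹ := inv_pos.mpr hz0
  have hzi : z * z⁻¹ = 1 := mul_inv_cancel₀ hz0.ne'
  have p32 : y ^ 3 ≤ y ^ 2 := pow_le_pow_of_le_one hy0.le hy1 (by norm_num)
  have p21 : y ^ 2 ≤ y := by nlinarith only [hy0, hy1]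
  have hz_two : z ≤ 2 := by linarith
  have hd0 := abs_nonneg d
  have hB0 : 0 ≤ B := by linarith
  have h1 : |k₁| ≤ 7 * B * y ^ 2 + 8 * |d| := by
    rw [hk₁]
    refine (abs_add_le _ _).trans ((add_le_add ((abs_sub _ _).trans (le_refl _)) le_rfl).trans ?_)
    have a1 : |y ^ 2 * z⁻¹ ^ 2| ≤ B * y ^ 2 := by
      rw [abs_of_pos (by positivity)]
      calc _ ≤ y ^ 2 * 1 := by
            gcongr
            exact pow_le_one₀ hi0.le hi1
        _ = 1 * y ^ 2 := by ring
        _ ≤ _ := by gcongr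
    have a2 : |3 * α * z * y ^ 3| ≤ 6 * B * y ^ 2 := by
      rw [abs_mul, abs_mul, abs_mul, abs_of_pos (pow_pos hy0 3), abs_of_pos hz0,
        abs_of_pos (by norm_num : (0 : ℝ) < 3)]
      calc _ ≤ 3 * B * 2 * y ^ 2 := by gcongr
        _ = _ := by ring
    have a3 : |z * D| ≤ 8 * |d| := by
      rw [abs_mul, abs_of_pos hz0]
      calc _ ≤ 2 * (4 * |d|) := by gcongr
        _ = _ := by ring
    linarith
  have h2 : 1 - k ≤ 2 * B * y ^ 2 + |d| := by
    have a1 : 1 - z⁻¹ ≤ y ^ 2 := by nlinarith only [hi0, hi1, hzi, hz1, hz1']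
    have a2 : |α * y ^ 3| ≤ B * y ^ 2 := by
      rw [abs_mul, abs_of_pos (pow_pos hy0 3)]
      gcongr
    have a3 : y ^ 2 ≤ B * y ^ 2 := le_mul_of_one_le_left (by positivity) hB
    rw [hk]
    linarith [neg_abs_le d, neg_abs_le (α * y ^ 3)]
  calc _ ≤ y ^ 2 * ((7 * B * y ^ 2 + 8 * |d|) + (2 * B * y ^ 2 + |d|)) := by gcongr
    _ = 9 * B * y ^ 4 + 9 * 1 * (y ^ 2 * |d|) := by ring
    _ ≤ 9 * B * y ^ 4 + 9 * B * (y * |d|) := by gcongr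
    _ = _ := by ring

/-- The slope of a graph whose slope parameter is `k = 1/z + α y³ + d`, with `d` small. -/
lemma slope_expansion {η A : ℝ} (hy0 : 0 < y) (hz0 : 0 < z) (hz2 : z ^ 2 = 1 + y ^ 2)
    (hB : 1 ≤ B) (hα : |α| ≤ B) (hA : 1 ≤ A) (hη : y ^ 2 ≤ η) (hηy : η ≤ y)
    (hd : |d| ≤ A * η * y ^ 2)
    (hsmall : 100 * (A * B ^ 2) ^ 2 * y ≤ 1)
    (hk : k = z⁻¹ + α * y ^ 3 + d) (hs : 0 < s) (hks : k ^ 2 + s ^ 2 = 1) :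
    |k * (z * (s * y⁻¹))⁻¹ - z⁻¹ - α * y| ≤ 100 * (A * B ^ 2) ^ 2 * η := by
  have hz1 := one_le_of_sq_eq hz0 hz2
  have hz1' := sub_one_le_of_sq_eq hz0 hz2
  have hi1 : z⁻¹ ≤ 1 := inv_le_one_of_one_le₀ hz1
  have hi0 : 0 < z⁻¹ := inv_pos.mpr hz0
  have hzi : z * z⁻¹ = 1 := mul_inv_cancel₀ hz0.ne'
  have hi2 : z⁻¹ ^ 2 * (1 + y ^ 2) = 1 := by
    rw [← hz2, ← mul_pow, mul_comm, hzi, one_pow]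
  set Q := A * B ^ 2 with hQ
  have hB2 : 1 ≤ B ^ 2 := one_le_pow₀ hB
  have hBB : B ≤ B ^ 2 := le_self_pow₀ hB (by norm_num)
  have hAQ : A ≤ Q := le_mul_of_one_le_right (by linarith) hB2
  have hBQ : B ^ 2 ≤ Q := le_mul_of_one_le_left (by linarith) hA
  have hQ1 : 1 ≤ Q := hA.trans hAQ
  have hQQ : Q ≤ Q ^ 2 := le_self_pow₀ hQ1 (by norm_num)
  have hQy : Q * y ≤ 1 / 100 := by nlinarith only [hQQ, hy0, hsmall]
  have hη0 : 0 < η := lt_of_lt_of_le (by positivity) hη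
  have hQη : Q * η ≤ 1 / 100 := le_trans (by gcongr) hQy
  have hαQ : |α| ≤ Q := hα.trans (hBB.trans hBQ)
  have hy_le : y ≤ 1 / 100 := by nlinarith only [hQ1, hy0, hQy]
  have hηQ : η ≤ Q * η := le_mul_of_one_le_left hη0.le hQ1
  -- Since `s` is of order `y`, the relevant sizes are `s/y` and `d/y²`.
  set v := d * y⁻¹ ^ 2 with hv
  have hvd : d = v * y ^ 2 := by rw [hv]; field_simp
  have hvb : |v| ≤ Q * η := by
    rw [hvd, abs_mul, abs_of_pos (by positivity : 0 < y ^ 2)] at hd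
    exact (le_of_mul_le_mul_right hd (by positivity)).trans (by gcongr)
  have hαy : |α * y| ≤ 1 / 100 := by
    rw [abs_mul, abs_of_pos hy0]
    exact le_trans (by gcongr) hQy
  have hαy2 : (α * y) ^ 2 ≤ Q * η := by
    rw [mul_pow, ← sq_abs α]
    have : |α| ^ 2 ≤ Q := (pow_le_pow_left₀ (abs_nonneg _) hα 2).trans hBQ
    gcongr
  have hzη : z - 1 ≤ η := hz1'.trans hη
  have hziη : 1 - z⁻¹ ≤ η := by nlinarith only [hi0, hi1, hzi, hz1, hzη]
  have hw1 : (α * y + v) ^ 2 ≤ 1 := by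
    rw [sq_le_one_iff_abs_le_one]
    exact (abs_add_le _ _).trans (by linarith)
  have hw1' : |α * y + v| ≤ 1 := (sq_le_one_iff_abs_le_one _).mp hw1
  set a := s * y⁻¹ with ha
  have ha0 : 0 < a := by positivity
  have hsa : s = a * y := by rw [ha]; field_simp
  -- Thus `s/y = 1 - α y + O(η)`. Dividing by this quantity turns the term `α y³` of `k` into the
  -- term `α y` of the slope.
  have e1 : a ^ 2 - (1 - α * y) ^ 2 = -(z⁻¹ ^ 2 * y ^ 2) + 2 * (1 - z⁻¹) * (α * y) - 2 * z⁻¹ * v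
      - y ^ 2 * (α * y + v) ^ 2 - (α * y) ^ 2 := by
    have : y ^ 2 ≠ 0 := by positivity
    rw [hk, hvd, hsa] at hks
    apply mul_left_cancel₀ this
    linear_combination hks + (y ^ 2 - 1) * hi2
  have b1 : |a ^ 2 - (1 - α * y) ^ 2| ≤ 7 * (Q * η) := by
    have c1 : z⁻¹ ^ 2 * y ^ 2 ≤ η :=
      (mul_le_of_le_one_left (by positivity) (pow_le_one₀ hi0.le hi1)).trans hη
    have c2 : |(1 - z⁻¹) * (α * y)| ≤ η * (1 / 100) := by
      rw [abs_mul, abs_of_nonneg (by linarith)]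
      gcongr
    have c3 : |z⁻¹ * v| ≤ 1 * (Q * η) := by
      rw [abs_mul, abs_of_pos hi0]
      gcongr
    have c4 : y ^ 2 * (α * y + v) ^ 2 ≤ η :=
      (mul_le_of_le_one_right (by positivity) hw1).trans hη
    have c5 : 0 ≤ z⁻¹ ^ 2 * y ^ 2 := by positivity
    have c6 : 0 ≤ y ^ 2 * (α * y + v) ^ 2 := by positivity
    have c7 := sq_nonneg (α * y)
    have c2' := abs_le.mp c2
    have c3' := abs_le.mp c3
    rw [e1, abs_le]
    constructor <;> linarith only [c1, c2'.1, c2'.2, c3'.1, c3'.2, c4, c5, c6, c7, hαy2, hηQ, hη0]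
  have hb := abs_le.mp hαy
  have b2 : |a - (1 - α * y)| ≤ 8 * (Q * η) := by
    rw [show a ^ 2 - (1 - α * y) ^ 2 = (a + (1 - α * y)) * (a - (1 - α * y)) by ring, abs_mul,
      abs_of_pos (by linarith)] at b1
    nlinarith only [b1, ha0, hb.2, abs_nonneg (a - (1 - α * y))]
  have ha9 : 9 / 10 ≤ a := by linarith [(abs_le.mp b2).1]
  have e2 : k * (z * a)⁻¹ - z⁻¹ - α * y = (z⁻¹ * a⁻¹) * (-(1 - z⁻¹) + y ^ 2 * (α * y + v)
      - (a - (1 - α * y)) * (1 + α * y * z) - α * y * (z - 1) + (α * y) ^ 2 * z) := by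
    have : a * a⁻¹ = 1 := mul_inv_cancel₀ ha0.ne'
    rw [mul_inv, hk, hvd]
    linear_combination (z⁻¹ + z⁻¹ * α * y * z) * this + α * y * hzi
  have b3 : |-(1 - z⁻¹) + y ^ 2 * (α * y + v)
      - (a - (1 - α * y)) * (1 + α * y * z) - α * y * (z - 1) + (α * y) ^ 2 * z|
      ≤ 15 * (Q * η) := by
    have hz_two : z ≤ 2 := by linarith
    have c1 : |y ^ 2 * (α * y + v)| ≤ η := by
      rw [abs_mul, abs_of_pos (by positivity)]
      exact (mul_le_of_le_one_right (by positivity) hw1').trans hη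
    have c2 : |(a - (1 - α * y)) * (1 + α * y * z)| ≤ 8 * (Q * η) * (102 / 100) := by
      rw [abs_mul]
      gcongr
      refine (abs_add_le _ _).trans ?_
      rw [abs_mul _ z, abs_one, abs_of_pos hz0]
      have : |α * y| * z ≤ 1 / 100 * 2 := by gcongr
      linarith
    have c3 : |α * y * (z - 1)| ≤ 1 / 100 * η := by
      rw [abs_mul, abs_of_nonneg (by linarith : 0 ≤ z - 1)]
      gcongr
    have c4 : (α * y) ^ 2 * z ≤ Q * η * 2 := by gcongr
    have c5 : 0 ≤ (α * y) ^ 2 * z := by positivity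
    have c1' := abs_le.mp c1
    have c2' := abs_le.mp c2
    have c3' := abs_le.mp c3
    rw [abs_le]
    constructor <;>
      linarith only [c1'.1, c1'.2, c2'.1, c2'.2, c3'.1, c3'.2, c4, c5, hziη, hi1, hηQ, hη0]
  have b4 : |z⁻¹ * a⁻¹| ≤ 10 / 9 := by
    rw [abs_of_pos (by positivity)]
    have : a⁻¹ ≤ (9 / 10)⁻¹ := by gcongr
    calc _ ≤ 1 * (9 / 10 : ℝ)⁻¹ := by gcongr
      _ = _ := by norm_num
  rw [e2, abs_mul]
  calc _ ≤ 10 / 9 * (15 * (Q * η)) := by gcongr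
    _ ≤ 100 * (Q * η) := by nlinarith only [hηQ, hη0]
    _ = 100 * Q * η := by ring
    _ ≤ _ := by gcongr

end Profile

/-! ### Radial functions with prescribed slope -/

/-- A function `k = r/√(1+r²) + α/r³ + O(r^{-4+ε})` on `[r₀, ∞)` with values in `(-1, 1)`, except
that `k² = 1` transversally at `r₀`. It is the parameter `k = u/√(1+u²)` of the slope
`u = √(1+r²) φ'` of the graph of a radial function `φ`. -/
structure SlopeProfile (α ε r₀ : ℝ) (k k' : ℝ → ℝ) : Prop where
  pos : 0 < r₀
  deriv : ∀ t, 0 < t → HasDerivAt k (k' t) t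
  cont : ContinuousOn k' (Ioi 0)
  lt_one : ∀ t, r₀ < t → k t ^ 2 < 1
  boundary : k r₀ ^ 2 = 1
  transversal : k r₀ * k' r₀ < 0
  decay : ∃ A, ∀ t, r₀ ≤ t → |k t - (t / √(1 + t ^ 2) + α / t ^ 3)| ≤ A * t ^ (-4 + ε)

/-- The derivative of the radial function with slope parameter `k`. -/
def slopeOf (k : ℝ → ℝ) (t : ℝ) : ℝ := k t / (√(1 + t ^ 2) * √(1 - k t ^ 2))

/-- The part of the slope that is integrable at infinity. -/
def slopeRem (α : ℝ) (k : ℝ → ℝ) (t : ℝ) : ℝ := slopeOf k t - t / √(1 + t ^ 2) - α / t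

/-- The radial function with slope parameter `k` that is asymptotic to `√(1+r²) + α ln r`. -/
def radialProfile (α r₀ : ℝ) (k : ℝ → ℝ) (r : ℝ) : ℝ :=
  √(1 + r ^ 2) + α * Real.log r - (∫ t in Ioi r₀, slopeRem α k t) + ∫ t in r₀..r, slopeRem α k t

lemma hasDerivAt_sqrt_one_add_sq (r : ℝ) :
    HasDerivAt (fun t : ℝ => √(1 + t ^ 2)) (r / √(1 + r ^ 2)) r := by
  have h : HasDerivAt (fun t : ℝ => 1 + t ^ 2) (2 * r) r := by
    simpa using (hasDerivAt_pow 2 r).const_add 1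
  convert h.sqrt (by positivity) using 1
  field_simp

/-- The majorant is the nonnegative derivative of `2√(t-a)`, hence integrable. This handles the
vertical slope at `r₀`. -/
lemma integrableOn_Ioc_of_sqrt_bound {h : ℝ → ℝ} {a b C : ℝ}
    (hc : ContinuousOn h (Ioc a b)) (hb : ∀ t ∈ Ioc a b, |h t| ≤ C * (√(t - a))⁻¹) :
    IntegrableOn h (Ioc a b) := by
  have h1 : IntegrableOn (fun t => (√(t - a))⁻¹) (Ioc a b) := by
    refine intervalIntegral.integrableOn_deriv_of_nonneg (g := fun t => 2 * √(t - a)) ?_ ?_ ?_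
    · fun_prop
    · intro t ht
      have : HasDerivAt (fun t => t - a) 1 t := (hasDerivAt_id t).sub_const a
      have h0 : t - a ≠ 0 := by linarith [ht.1]
      have hs : √(t - a) ≠ 0 := (Real.sqrt_pos.mpr (by linarith [ht.1])).ne'
      refine ((this.sqrt h0).const_mul 2).congr_deriv ?_
      field_simp
    · intro t _
      positivity
  refine (h1.const_mul C).mono' (hc.aestronglyMeasurable measurableSet_Ioc) ?_
  exact (ae_restrict_iff' measurableSet_Ioc).mpr (ae_of_all _ hb)

namespace SlopeProfile

variable {α ε r₀ : ℝ} {k k' : ℝ → ℝ}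

lemma one_sub_pos (h : SlopeProfile α ε r₀ k k') {t : ℝ} (ht : r₀ < t) : 0 < 1 - k t ^ 2 := by
  linarith [h.lt_one t ht]

/-- By transversality `1 - k²` has the positive derivative `-2 k k'` at `r₀`; half of it serves as
`c`. -/
lemma exists_one_sub_ge (h : SlopeProfile α ε r₀ k k') :
    ∃ c, 0 < c ∧ ∀ᶠ t in 𝓝[>] r₀, c * (t - r₀) ≤ 1 - k t ^ 2 := by
  have hd : HasDerivAt (fun t => 1 - k t ^ 2) (-(2 * (k r₀ * k' r₀))) r₀ := by
    refine (((h.deriv r₀ h.pos).pow 2).const_sub 1).congr_deriv ?_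
    push_cast
    ring
  have hL : 0 < -(2 * (k r₀ * k' r₀)) := by linarith [h.transversal]
  refine ⟨-(2 * (k r₀ * k' r₀)) / 2, by linarith, ?_⟩
  have := (hasDerivAt_iff_tendsto_slope.mp hd).eventually_const_le (half_lt_self hL)
  have h2 : ∀ᶠ t in 𝓝[>] r₀, _ := this.filter_mono (nhdsWithin_mono _ fun t ht => ne_of_gt ht)
  filter_upwards [h2, self_mem_nhdsWithin] with t ht htr
  have htr : 0 < t - r₀ := sub_pos.mpr htr
  rw [slope_def_field, le_div_iff₀ htr, h.boundary] at ht
  linarith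

lemma contDiffOn (h : SlopeProfile α ε r₀ k k') : ContDiffOn ℝ 1 k (Ioi 0) := by
  rw [show (1 : WithTop ℕ∞) = 0 + 1 by simp, contDiffOn_succ_iff_deriv_of_isOpen isOpen_Ioi]
  refine ⟨fun t ht => (h.deriv t ht).differentiableAt.differentiableWithinAt, by simp, ?_⟩
  rw [contDiffOn_zero]
  exact h.cont.congr fun t ht => (h.deriv t ht).deriv

lemma contDiffOn_slopeOf (h : SlopeProfile α ε r₀ k k') :
    ContDiffOn ℝ 1 (slopeOf k) (Ioi r₀) := by
  have hk : ContDiffOn ℝ 1 k (Ioi r₀) := h.contDiffOn.mono (Ioi_subset_Ioi h.pos.le)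
  have h1 : ContDiffOn ℝ 1 (fun t : ℝ => √(1 + t ^ 2)) (Ioi r₀) :=
    ContDiffOn.sqrt (by fun_prop) fun t _ => by positivity
  have h2 : ContDiffOn ℝ 1 (fun t : ℝ => √(1 - k t ^ 2)) (Ioi r₀) :=
    ContDiffOn.sqrt (contDiffOn_const.sub (hk.pow 2)) fun t ht => (h.one_sub_pos ht).ne'
  refine hk.div (h1.mul h2) fun t ht => ?_
  have := Real.sqrt_pos.mpr (h.one_sub_pos ht)
  positivity

lemma continuousOn_slopeRem (h : SlopeProfile α ε r₀ k k') :
    ContinuousOn (slopeRem α k) (Ioi r₀) := by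
  refine (h.contDiffOn_slopeOf.continuousOn.sub ?_).sub ?_
  · exact continuousOn_id.div (by fun_prop) fun t _ => by positivity
  · exact continuousOn_const.div continuousOn_id fun t ht => (h.pos.trans ht).ne'

/-- `slope_expansion` with `y = 1/t` and `η = t^(-2+ε)`. The last term in the radius ensures its
smallness hypothesis. -/
lemma exists_slopeRem_le (h : SlopeProfile α ε r₀ k k') (hε : 0 ≤ ε) (hε1 : ε ≤ 1 / 2) :
    ∃ C R, 1 ≤ R ∧ r₀ < R ∧ ∀ t, R ≤ t → |slopeRem α k t| ≤ C * t ^ (-2 + ε) := by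
  obtain ⟨A, hA⟩ := h.decay
  set B := max 1 |α| with hB
  set A' := max 1 A with hA'
  refine ⟨100 * (A' * B ^ 2) ^ 2, max (max 1 (r₀ + 1)) (100 * (A' * B ^ 2) ^ 2),
    (le_max_left _ _).trans (le_max_left _ _), (lt_add_one _).trans_le
      ((le_max_right _ _).trans (le_max_left _ _)), fun t ht => ?_⟩
  have ht1 : 1 ≤ t := ((le_max_left _ _).trans (le_max_left _ _)).trans ht
  have htr : r₀ < t := ((lt_add_one _).trans_le
      ((le_max_right _ _).trans (le_max_left _ _))).trans_le ht
  have htC := (le_max_right _ _).trans ht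
  have ht0 : 0 < t := by linarith
  have hρ : √(1 + t ^ 2) ^ 2 = 1 + t ^ 2 := Real.sq_sqrt (by positivity)
  have hs : 0 < √(1 - k t ^ 2) := Real.sqrt_pos.mpr (h.one_sub_pos htr)
  have hy2 : t⁻¹ ^ 2 = t ^ (-2 : ℝ) := by
    rw [Real.rpow_neg ht0.le, inv_pow]; norm_cast
  have key := slope_expansion (y := t⁻¹) (z := √(1 + t ^ 2) * t⁻¹) (α := α) (B := B) (A := A')
    (η := t ^ (-2 + ε)) (d := k t - (t / √(1 + t ^ 2) + α / t ^ 3)) (k := k t)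
    (s := √(1 - k t ^ 2)) (by positivity) (by positivity) ?_ (le_max_left _ _) (le_max_right _ _)
    (le_max_left _ _) ?_ ?_ ?_ ?_ ?_ hs ?_
  · convert key using 2
    rw [slopeRem, slopeOf]
    field_simp
  · rw [mul_pow, hρ]; field_simp; ring
  · rw [hy2]
    exact Real.rpow_le_rpow_of_exponent_le ht1 (by linarith)
  · rw [← Real.rpow_neg_one t]
    exact Real.rpow_le_rpow_of_exponent_le ht1 (by linarith)
  · refine (hA t htr.le).trans ?_
    rw [hy2, mul_assoc, ← Real.rpow_add ht0, show -2 + ε + -2 = -4 + ε by ring]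
    gcongr
    exact le_max_right _ _
  · rw [← div_eq_mul_inv]
    exact (div_le_one ht0).mpr htC
  · field_simp; ring
  · rw [Real.sq_sqrt (h.one_sub_pos htr).le]; ring

/-- Near `r₀` the slope is `O((t-r₀)^(-1/2))` by `exists_one_sub_ge`, at infinity the remainder is
`O(t^(-2+ε))` with exponent below `-1`, and in between it is continuous. -/
lemma integrableOn_slopeRem (h : SlopeProfile α ε r₀ k k') (hε : 0 ≤ ε) (hε1 : ε ≤ 1 / 2) :
    IntegrableOn (slopeRem α k) (Ioi r₀) := by
  obtain ⟨C, R, hR1, hRr, hC⟩ := h.exists_slopeRem_le hε hε1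
  obtain ⟨c, hc0, hc1⟩ := h.exists_one_sub_ge
  obtain ⟨b, hb, hb1⟩ := mem_nhdsGT_iff_exists_Ioc_subset.mp hc1
  have hb : r₀ < b := hb
  have hc := h.continuousOn_slopeRem (α := α)
  have near : IntegrableOn (slopeRem α k) (Ioc r₀ b) := by
    have h1 : IntegrableOn (slopeOf k) (Ioc r₀ b) := by
      refine integrableOn_Ioc_of_sqrt_bound (C := (√c)⁻¹)
        (h.contDiffOn_slopeOf.continuousOn.mono Ioc_subset_Ioi_self) fun t ht => ?_
      have ht0 : 0 < t - r₀ := sub_pos.mpr ht.1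
      have hk1 : |k t| ≤ 1 := (sq_le_one_iff_abs_le_one _).mp (h.lt_one t ht.1).le
      have hs1 : 1 ≤ √(1 + t ^ 2) := Real.one_le_sqrt.mpr (by linarith [sq_nonneg t])
      have hs2 : √c * √(t - r₀) ≤ √(1 - k t ^ 2) := by
        rw [← Real.sqrt_mul hc0.le]
        exact Real.sqrt_le_sqrt (hb1 ht)
      have hp : 0 < √c * √(t - r₀) := by positivity
      have hp1 : 0 < √(1 + t ^ 2) * √(1 - k t ^ 2) := by
        have := hp.trans_le hs2
        positivity
      rw [slopeOf, abs_div, abs_of_pos hp1, ← mul_inv, ← one_div]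
      refine div_le_div₀ zero_le_one hk1 hp ?_
      calc _ = 1 * (√c * √(t - r₀)) := (one_mul _).symm
        _ ≤ _ := by gcongr
    have h2 : ContinuousOn (fun t : ℝ => t / √(1 + t ^ 2) + α / t) (Icc r₀ b) := by
      refine ContinuousOn.add (continuousOn_id.div (by fun_prop) fun t _ => by positivity)
        (continuousOn_const.div continuousOn_id fun t ht => (h.pos.trans_le ht.1).ne')
    refine (h1.sub ((h2.integrableOn_Icc).mono_set Ioc_subset_Icc_self)).congr_fun
      (fun t _ => ?_) measurableSet_Ioc
    simp only [Pi.sub_apply, slopeRem]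
    ring
  have mid : IntegrableOn (slopeRem α k) (Icc b (max b R)) :=
    (hc.mono fun t ht => hb.trans_le ht.1).integrableOn_Icc
  have far : IntegrableOn (slopeRem α k) (Ioi (max b R)) := by
    have hm : 0 < max b R := h.pos.trans (hb.trans_le (le_max_left _ _))
    refine ((integrableOn_Ioi_rpow_of_lt (by linarith : -2 + ε < -1) hm).const_mul C).mono'
      ((hc.mono (Ioi_subset_Ioi (hb.le.trans (le_max_left _ _)))).aestronglyMeasurable
        measurableSet_Ioi) ?_
    exact (ae_restrict_iff' measurableSet_Ioi).mpr
      (ae_of_all _ fun t ht => hC t ((le_max_right _ _).trans (le_of_lt ht)))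
  refine ((near.union mid).union far).mono_set fun t ht => ?_
  by_cases h1 : t ≤ b
  · exact Or.inl (Or.inl ⟨ht, h1⟩)
  · by_cases h2 : t ≤ max b R
    · exact Or.inl (Or.inr ⟨(not_le.mp h1).le, h2⟩)
    · exact Or.inr (not_le.mp h2)

/-- The additive constant in `radialProfile` makes the remainder an integral from infinity. The
asymptotics and the comparison of two profiles both rest on this form. -/
lemma radialProfile_eq (h : SlopeProfile α ε r₀ k k') (hε : 0 ≤ ε) (hε1 : ε ≤ 1 / 2) {r : ℝ}
    (hr : r₀ ≤ r) : radialProfile α r₀ k r =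
      √(1 + r ^ 2) + α * Real.log r - ∫ t in Ioi r, slopeRem α k t := by
  rw [radialProfile, ← intervalIntegral.integral_Ioi_sub_Ioi (h.integrableOn_slopeRem hε hε1) hr]
  ring

lemma continuousOn_radialProfile (h : SlopeProfile α ε r₀ k k') (hε : 0 ≤ ε) (hε1 : ε ≤ 1 / 2) :
    ContinuousOn (radialProfile α r₀ k) (Ici r₀) := by
  have hi := h.integrableOn_slopeRem hε hε1
  -- The integrand is controlled only to the right of `r₀`. Extension by zero gives a primitive
  -- continuous everywhere, in particular at `r₀`.
  have h1 : Continuous fun r => ∫ t in r₀..r, (Ioi r₀).indicator (slopeRem α k) t :=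
    intervalIntegral.continuous_primitive
      (fun a b => (hi.integrable_indicator measurableSet_Ioi).intervalIntegrable) r₀
  have h2 : ContinuousOn (fun r => ∫ t in r₀..r, slopeRem α k t) (Ici r₀) := by
    refine h1.continuousOn.congr fun r hr => ?_
    have hr : r₀ ≤ r := hr
    simp only
    rw [intervalIntegral.integral_of_le hr, intervalIntegral.integral_of_le hr]
    exact setIntegral_congr_fun measurableSet_Ioc fun t ht =>
      (indicator_of_mem (show t ∈ Ioi r₀ from ht.1) _).symm
  unfold radialProfile
  refine ContinuousOn.add (ContinuousOn.sub (ContinuousOn.add (by fun_prop) ?_)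
    continuousOn_const) h2
  exact continuousOn_const.mul (continuousOn_id.log fun t ht => (h.pos.trans_le ht).ne')

lemma hasDerivAt_radialProfile (h : SlopeProfile α ε r₀ k k') (hε : 0 ≤ ε) (hε1 : ε ≤ 1 / 2)
    {r : ℝ} (hr : r₀ < r) : HasDerivAt (radialProfile α r₀ k) (slopeOf k r) r := by
  have hi := h.integrableOn_slopeRem hε hε1
  have hc := h.continuousOn_slopeRem (α := α)
  have h1 : HasDerivAt (fun u => ∫ t in r₀..u, slopeRem α k t) (slopeRem α k r) r :=
    intervalIntegral.integral_hasDerivAt_right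
      ((intervalIntegrable_iff_integrableOn_Ioc_of_le hr.le).mpr (hi.mono_set Ioc_subset_Ioi_self))
      (hc.stronglyMeasurableAtFilter isOpen_Ioi r hr) (hc.continuousAt (Ioi_mem_nhds hr))
  have h2 := (((hasDerivAt_sqrt_one_add_sq r).add
    ((Real.hasDerivAt_log (h.pos.trans hr).ne').const_mul α)).sub_const
      (∫ t in Ioi r₀, slopeRem α k t)).add h1
  refine h2.congr_deriv ?_
  rw [slopeRem]
  ring

lemma contDiffOn_radialProfile (h : SlopeProfile α ε r₀ k k') (hε : 0 ≤ ε) (hε1 : ε ≤ 1 / 2) :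
    ContDiffOn ℝ 2 (radialProfile α r₀ k) (Ioi r₀) := by
  rw [show (2 : WithTop ℕ∞) = 1 + 1 by norm_num, contDiffOn_succ_iff_deriv_of_isOpen isOpen_Ioi]
  refine ⟨fun t ht => (h.hasDerivAt_radialProfile hε hε1
    ht).differentiableAt.differentiableWithinAt, by simp, ?_⟩
  exact h.contDiffOn_slopeOf.congr fun t ht => (h.hasDerivAt_radialProfile hε hε1 ht).deriv

lemma radialProfile_asymptotics (h : SlopeProfile α ε r₀ k k') (hε : 0 ≤ ε) (hε1 : ε ≤ 1 / 2) :
    ∃ C R, 1 ≤ R ∧ ∀ r, R ≤ r →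
      |radialProfile α r₀ k r - (√(1 + r ^ 2) + α * Real.log r)| ≤ C * r ^ (-1 + ε) := by
  obtain ⟨C, R, hR1, hRr, hC⟩ := h.exists_slopeRem_le hε hε1
  refine ⟨C / (1 - ε), R, hR1, fun r hr => ?_⟩
  have hr0 : 0 < r := by linarith
  rw [h.radialProfile_eq hε hε1 (hRr.le.trans hr), sub_sub_cancel_left, abs_neg]
  calc |∫ t in Ioi r, slopeRem α k t| ≤ ∫ t in Ioi r, C * t ^ (-2 + ε) := by
        refine norm_integral_le_of_norm_le (f := slopeRem α k)
          ((integrableOn_Ioi_rpow_of_lt (by linarith : -2 + ε < -1) hr0).const_mul C) ?_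
        exact (ae_restrict_iff' measurableSet_Ioi).mpr
          (ae_of_all _ fun t ht => hC t (hr.trans (le_of_lt ht)))
    _ = C / (1 - ε) * r ^ (-1 + ε) := by
        rw [integral_const_mul, integral_Ioi_rpow_of_lt (by linarith) hr0,
          show -2 + ε + 1 = -1 + ε by ring, show -1 + ε = -(1 - ε) by ring, neg_div_neg_eq]
        ring

/-- The map `k ↦ k/√(1-k²)` is increasing on `(-1, 1)`. -/
lemma slopeOf_le_slopeOf {k₁ k₂ : ℝ → ℝ} {t : ℝ} (h1 : k₁ t ^ 2 < 1) (h2 : k₂ t ^ 2 < 1)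
    (h12 : k₁ t ≤ k₂ t) : slopeOf k₁ t ≤ slopeOf k₂ t := by
  have s1 : 0 < √(1 - k₁ t ^ 2) := Real.sqrt_pos.mpr (by linarith)
  have s2 : 0 < √(1 - k₂ t ^ 2) := Real.sqrt_pos.mpr (by linarith)
  have q1 : √(1 - k₁ t ^ 2) ^ 2 = 1 - k₁ t ^ 2 := Real.sq_sqrt (by linarith)
  have q2 : √(1 - k₂ t ^ 2) ^ 2 = 1 - k₂ t ^ 2 := Real.sq_sqrt (by linarith)
  rw [slopeOf, slopeOf, div_mul_eq_div_div_swap, div_mul_eq_div_div_swap]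
  gcongr ?_ / _
  rw [div_le_div_iff₀ s1 s2]
  set a := √(1 - k₁ t ^ 2)
  set b := √(1 - k₂ t ^ 2)
  set x := k₁ t
  set y := k₂ t
  by_contra! hlt
  rcases le_total 0 x with hx | hx
  · have : b ≤ a := by
      refine le_of_sq_le_sq ?_ s1.le
      rw [q1, q2]
      nlinarith
    nlinarith
  · rcases le_total 0 y with hy | hy
    · nlinarith
    · have : a ≤ b := by
        refine le_of_sq_le_sq ?_ s2.le
        rw [q1, q2]
        nlinarith
      nlinarith

/-- The two profiles agree at infinity, so the one with the larger slope lies below. -/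
lemma radialProfile_le {k₁ k₂ k₁' k₂' : ℝ → ℝ} (h1 : SlopeProfile α ε r₀ k₁ k₁')
    (h2 : SlopeProfile α ε r₀ k₂ k₂') (hε : 0 ≤ ε) (hε1 : ε ≤ 1 / 2)
    (h12 : ∀ t, r₀ < t → k₁ t ≤ k₂ t) {r : ℝ} (hr : r₀ ≤ r) :
    radialProfile α r₀ k₂ r ≤ radialProfile α r₀ k₁ r := by
  rw [h1.radialProfile_eq hε hε1 hr, h2.radialProfile_eq hε hε1 hr]
  have := setIntegral_mono_on ((h1.integrableOn_slopeRem hε hε1).mono_set (Ioi_subset_Ioi hr))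
    ((h2.integrableOn_slopeRem hε hε1).mono_set (Ioi_subset_Ioi hr)) measurableSet_Ioi
    fun t ht => by
      have ht : r₀ < t := hr.trans_lt ht
      rw [slopeRem, slopeRem]
      have := slopeOf_le_slopeOf (h1.lt_one t ht) (h2.lt_one t ht) (h12 t ht)
      linarith
  linarith

lemma tendsto_sqrt_inv (h : SlopeProfile α ε r₀ k k') :
    Tendsto (fun t => (√(1 - k t ^ 2))⁻¹) (𝓝[>] r₀) atTop := by
  refine tendsto_inv_nhdsGT_zero.comp (tendsto_nhdsWithin_iff.mpr ⟨?_, ?_⟩)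
  · have : ContinuousAt (fun t => √(1 - k t ^ 2)) r₀ :=
      (continuousAt_const.sub ((h.deriv r₀ h.pos).continuousAt.pow 2)).sqrt
    have h2 := this.tendsto
    rw [h.boundary, sub_self, Real.sqrt_zero] at h2
    exact h2.mono_left nhdsWithin_le_nhds
  · filter_upwards [self_mem_nhdsWithin] with t ht
    exact Real.sqrt_pos.mpr (h.one_sub_pos ht)

lemma tendsto_div (h : SlopeProfile α ε r₀ k k') :
    Tendsto (fun t => k t / √(1 + t ^ 2)) (𝓝[>] r₀) (𝓝 (k r₀ / √(1 + r₀ ^ 2))) := by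
  have : ContinuousAt (fun t => k t / √(1 + t ^ 2)) r₀ :=
    (h.deriv r₀ h.pos).continuousAt.div (by fun_prop) (by positivity)
  exact this.tendsto.mono_left nhdsWithin_le_nhds

lemma slopeOf_eq (k : ℝ → ℝ) :
    slopeOf k = fun t => k t / √(1 + t ^ 2) * (√(1 - k t ^ 2))⁻¹ := by
  funext t
  rw [slopeOf, div_mul_eq_div_div, div_eq_mul_inv]

lemma tendsto_slopeOf_atTop (h : SlopeProfile α ε r₀ k k') (h1 : k r₀ = 1) :
    Tendsto (slopeOf k) (𝓝[>] r₀) atTop := by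
  rw [slopeOf_eq]
  refine Tendsto.pos_mul_atTop (C := k r₀ / √(1 + r₀ ^ 2)) ?_ h.tendsto_div h.tendsto_sqrt_inv
  rw [h1]; positivity

lemma tendsto_slopeOf_atBot (h : SlopeProfile α ε r₀ k k') (h1 : k r₀ = -1) :
    Tendsto (slopeOf k) (𝓝[>] r₀) atBot := by
  rw [slopeOf_eq]
  refine Tendsto.neg_mul_atTop (C := k r₀ / √(1 + r₀ ^ 2)) ?_ h.tendsto_div h.tendsto_sqrt_inv
  rw [h1, neg_div, neg_lt_zero]; positivity

lemma radialSlope (h : SlopeProfile α ε r₀ k k') (hε : 0 ≤ ε) (hε1 : ε ≤ 1 / 2) {r : ℝ}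
    (hr : r₀ < r) : ∃ φ₂, RadialSlope (radialProfile α r₀ k) (slopeOf k) φ₂ r (k r)
      (√(1 + r ^ 2) * k' r) (√(1 - k r ^ 2)) := by
  have hs := Real.sqrt_pos.mpr (h.one_sub_pos hr)
  have hs2 : √(1 - k r ^ 2) ^ 2 = 1 - k r ^ 2 := Real.sq_sqrt (h.one_sub_pos hr).le
  have hρ2 : √(1 + r ^ 2) ^ 2 = 1 + r ^ 2 := Real.sq_sqrt (by positivity)
  have hρ : 0 < √(1 + r ^ 2) := by positivity
  have hk := h.deriv r (h.pos.trans hr)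
  have h1 : HasDerivAt (fun t => 1 - k t ^ 2) (-(2 * k r * k' r)) r := by
    refine ((hk.pow 2).const_sub 1).congr_deriv ?_
    push_cast
    ring
  have hne : √(1 + r ^ 2) * √(1 - k r ^ 2) ≠ 0 := by positivity
  have h2 : HasDerivAt (slopeOf k) ((k' r * (√(1 + r ^ 2) * √(1 - k r ^ 2))
      - k r * (r / √(1 + r ^ 2) * √(1 - k r ^ 2)
        + √(1 + r ^ 2) * (-(2 * k r * k' r) / (2 * √(1 - k r ^ 2)))))
      / (√(1 + r ^ 2) * √(1 - k r ^ 2)) ^ 2) r :=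
    hk.div ((hasDerivAt_sqrt_one_add_sq r).mul (h1.sqrt (h.one_sub_pos hr).ne')) hne
  refine ⟨_, ⟨?_, h2, hs, by rw [hs2]; ring, ?_, ?_⟩⟩
  · filter_upwards [Ioi_mem_nhds hr] with t ht
    exact h.hasDerivAt_radialProfile hε hε1 ht
  · rw [slopeOf]; field_simp
  · rw [slopeOf]
    nth_rw 1 [← hρ2]
    set ρ := √(1 + r ^ 2)
    set s := √(1 - k r ^ 2)
    field_simp
    linear_combination (k' r * ρ ^ 2) * hs2

end SlopeProfile

/-! ### The slopes of the barriers -/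

/-- The leading part of a slope parameter. -/
def baseSlope (α t : ℝ) : ℝ := t / √(1 + t ^ 2) + α / t ^ 3

/-- The derivative of `baseSlope`. -/
def baseSlopeDeriv (α t : ℝ) : ℝ := 1 / √(1 + t ^ 2) ^ 3 - 3 * α / t ^ 4

section Base

variable {α t r₀ γ : ℝ}

lemma hasDerivAt_baseSlope (ht : 0 < t) : HasDerivAt (baseSlope α) (baseSlopeDeriv α t) t := by
  have hρ : 0 < √(1 + t ^ 2) := by positivity
  have hρ2 : √(1 + t ^ 2) ^ 2 = 1 + t ^ 2 := Real.sq_sqrt (by positivity)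
  have h1 : HasDerivAt (fun t : ℝ => t / √(1 + t ^ 2))
      ((1 * √(1 + t ^ 2) - t * (t / √(1 + t ^ 2))) / √(1 + t ^ 2) ^ 2) t :=
    (hasDerivAt_id t).div (hasDerivAt_sqrt_one_add_sq t) hρ.ne'
  have h2 : HasDerivAt (fun t : ℝ => α / t ^ 3) ((0 * t ^ 3 - α * (3 * t ^ 2)) / (t ^ 3) ^ 2) t := by
    have := hasDerivAt_pow 3 t
    exact (hasDerivAt_const t α).div (by simpa using this) (by positivity)
  refine (h1.add h2).congr_deriv ?_
  rw [baseSlopeDeriv]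
  set ρ := √(1 + t ^ 2)
  field_simp
  linear_combination t ^ 4 * hρ2

lemma continuousOn_baseSlopeDeriv : ContinuousOn (baseSlopeDeriv α) (Ioi 0) := by
  unfold baseSlopeDeriv
  refine ContinuousOn.sub (continuousOn_const.div (by fun_prop) fun t _ => by positivity)
    (continuousOn_const.div (by fun_prop) fun t ht => ?_)
  have : 0 < t := ht
  positivity

lemma hypRatio_sq (ht : 0 < t) : (√(1 + t ^ 2) * t⁻¹) ^ 2 = 1 + t⁻¹ ^ 2 := by
  rw [mul_pow, Real.sq_sqrt (by positivity)]
  field_simp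
  ring

lemma baseSlope_eq (ht : 0 < t) :
    baseSlope α t = (√(1 + t ^ 2) * t⁻¹)⁻¹ + α * t⁻¹ ^ 3 := by
  rw [baseSlope]; field_simp

lemma abs_mul_inv_le (hr : 100 * (1 + |α|) ≤ r₀) (ht : r₀ ≤ t) :
    0 < t⁻¹ ∧ t⁻¹ ≤ 1 / 100 ∧ |α * t⁻¹| ≤ 1 / 100 := by
  have hα := abs_nonneg α
  have ht0 : 0 < t := by linarith
  refine ⟨inv_pos.mpr ht0, ?_, ?_⟩
  · rw [one_div]
    gcongr
    linarith
  · rw [abs_mul, abs_of_pos (inv_pos.mpr ht0), ← div_eq_mul_inv, div_le_iff₀ ht0]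
    linarith

/-- `1 - t/√(1+t²)` behaves like `t⁻²/2`, and for `t ≥ 100(1+|α|)` the correction `α t⁻³` is at most
`t⁻²/100`, so it changes no sign. -/
lemma baseSlope_bounds (hr : 100 * (1 + |α|) ≤ r₀) (ht : r₀ ≤ t) :
    0 < baseSlope α t ∧ 1 / 4 * t⁻¹ ^ 2 ≤ 1 - baseSlope α t ∧ 1 - baseSlope α t < 1 ∧
      0 < baseSlopeDeriv α t := by
  obtain ⟨hy0, hy1, hαy⟩ := abs_mul_inv_le hr ht
  have ht0 : 0 < t := inv_pos.mp hy0
  have hz0 : 0 < √(1 + t ^ 2) * t⁻¹ := by positivity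
  have hz2 := hypRatio_sq ht0
  have e1 := baseSlope_eq (α := α) ht0
  have e2 : baseSlopeDeriv α t = t⁻¹ ^ 3 * ((√(1 + t ^ 2) * t⁻¹)⁻¹ ^ 3 - 3 * (α * t⁻¹)) := by
    rw [baseSlopeDeriv]; field_simp
  have hz1 := one_le_of_sq_eq hz0 hz2
  have hz1' := sub_one_le_of_sq_eq hz0 hz2
  have hzi : √(1 + t ^ 2) * t⁻¹ * (√(1 + t ^ 2) * t⁻¹)⁻¹ = 1 := mul_inv_cancel₀ hz0.ne'
  have hi0 : 0 < (√(1 + t ^ 2) * t⁻¹)⁻¹ := inv_pos.mpr hz0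
  generalize (√(1 + t ^ 2) * t⁻¹)⁻¹ = i at *
  generalize √(1 + t ^ 2) * t⁻¹ = z at *
  generalize t⁻¹ = y at *
  have hab := abs_le.mp hαy
  have hi : 9 / 10 ≤ i := by nlinarith only [hzi, hz1', hy0, hy1, hi0]
  have hi2 : 1 / 3 * y ^ 2 ≤ 1 - i := by
    have : (1 - i) * (z * (z + 1)) = y ^ 2 := by linear_combination hz2 - (z + 1) * hzi
    have hz3 : z ≤ 101 / 100 := by nlinarith only [hz1', hy0, hy1]
    have hz3 : z * (z + 1) ≤ 3 := by nlinarith only [hz1, hz3]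
    have hi1 : 0 ≤ 1 - i := by nlinarith only [hzi, hz1, hi0]
    nlinarith only [this, hz3, hi1]
  have hαy3 : |α * y ^ 3| ≤ 1 / 100 * y ^ 2 := by
    rw [show α * y ^ 3 = α * y * y ^ 2 by ring, abs_mul, abs_of_pos (by positivity : 0 < y ^ 2)]
    gcongr
  have h3 := abs_le.mp hαy3
  have hy2 : y ^ 2 ≤ 1 / 100 := by nlinarith only [hy0, hy1]
  have hy2' : 0 < y ^ 2 := by positivity
  refine ⟨by rw [e1]; linarith, by rw [e1]; linarith, by rw [e1]; linarith, ?_⟩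
  rw [e2]
  have : (9 / 10 : ℝ) ^ 3 ≤ i ^ 3 := by gcongr
  have h4 : 0 < i ^ 3 - 3 * (α * y) := by norm_num at this; linarith
  positivity

/-- Multiplied by `t³`, the quantity `1 - baseSlope α t` becomes a strictly increasing function
minus the constant `α`. It thus decays more slowly than `t⁻³`, which keeps the slope parameter of
the lower barrier below `1`. -/
lemma one_sub_baseSlope_lt (hr : 0 < r₀) (ht : r₀ < t) :
    (1 - baseSlope α r₀) * (r₀ / t) ^ 3 < 1 - baseSlope α t := by
  have ht0 : 0 < t := hr.trans ht
  have key : ∀ s : ℝ, 0 < s → s ^ 3 * (1 - baseSlope α s)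
      = (s * (s * s)) / (√(1 + s ^ 2) * (√(1 + s ^ 2) + s)) - α := by
    intro s hs
    have hρ2 : √(1 + s ^ 2) ^ 2 = 1 + s ^ 2 := Real.sq_sqrt (by positivity)
    rw [baseSlope]
    have : 0 < √(1 + s ^ 2) := by positivity
    field_simp
    linear_combination s ^ 3 * hρ2
  have hlt : r₀ ^ 3 * (1 - baseSlope α r₀) < t ^ 3 * (1 - baseSlope α t) := by
    rw [key r₀ hr, key t ht0]
    gcongr ?_ - _
    have h0 : 0 < √(1 + r₀ ^ 2) := by positivity
    have h1 : 0 < √(1 + t ^ 2) := by positivity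
    rw [div_lt_div_iff₀ (by positivity) (by positivity)]
    have h2 : r₀ * √(1 + t ^ 2) < t * √(1 + r₀ ^ 2) := by
      refine lt_of_pow_lt_pow_left₀ 2 (by positivity) ?_
      rw [mul_pow, mul_pow, Real.sq_sqrt (by positivity), Real.sq_sqrt (by positivity)]
      nlinarith
    have h3 : r₀ * (√(1 + t ^ 2) + t) < t * (√(1 + r₀ ^ 2) + r₀) := by nlinarith
    calc _ = r₀ * ((r₀ * √(1 + t ^ 2)) * (r₀ * (√(1 + t ^ 2) + t))) := by ring
      _ < t * ((t * √(1 + r₀ ^ 2)) * (t * (√(1 + r₀ ^ 2) + r₀))) := by gcongr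
      _ = _ := by ring
  rw [div_pow, mul_div_assoc', div_lt_iff₀ (by positivity)]
  linarith

lemma hasDerivAt_div_rpow (hr : 0 < r₀) (ht : 0 < t) :
    HasDerivAt (fun t : ℝ => (t / r₀) ^ γ) (γ * (t / r₀) ^ γ / t) t := by
  have h := ((hasDerivAt_id t).div_const r₀).rpow_const (p := γ) (Or.inl (div_pos ht hr).ne')
  refine h.congr_deriv ?_
  rw [id, Real.rpow_sub_one (div_pos ht hr).ne']
  field_simp

lemma continuousOn_div_rpow (hr : 0 < r₀) :
    ContinuousOn (fun t : ℝ => (t / r₀) ^ γ) (Ioi 0) :=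
  fun _ ht => (hasDerivAt_div_rpow hr ht).continuousAt.continuousWithinAt

lemma one_le_div_rpow (hr : 0 < r₀) (ht : r₀ ≤ t) (hγ : 0 ≤ γ) : 1 ≤ (t / r₀) ^ γ :=
  Real.one_le_rpow ((one_le_div hr).mpr ht) hγ

lemma inv_pow_four_le (hr : 0 < r₀) (ht : r₀ ≤ t) (hγ : γ ≤ 4) :
    r₀ ^ 4 * t⁻¹ ^ 4 ≤ ((t / r₀) ^ γ)⁻¹ := by
  have h1 := Real.rpow_le_rpow_of_exponent_le ((one_le_div hr).mpr ht) hγ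
  have ht0 : 0 < t := hr.trans_le ht
  have h2 : (t / r₀) ^ (4 : ℝ) = t ^ 4 / r₀ ^ 4 := by
    rw [← div_pow]; norm_cast
  calc _ = ((t / r₀) ^ (4 : ℝ))⁻¹ := by rw [h2]; field_simp
    _ ≤ _ := by gcongr

lemma inv_rpow_le (hr : 0 < r₀) (ht : r₀ ≤ t) (hγ : 3 ≤ γ) :
    ((t / r₀) ^ γ)⁻¹ ≤ (r₀ / t) ^ 3 := by
  have h1 := Real.rpow_le_rpow_of_exponent_le ((one_le_div hr).mpr ht) hγ
  have ht0 : 0 < t := hr.trans_le ht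
  have h2 : (t / r₀) ^ (3 : ℝ) = t ^ 3 / r₀ ^ 3 := by
    rw [← div_pow]; norm_cast
  calc _ ≤ ((t / r₀) ^ (3 : ℝ))⁻¹ := by gcongr
    _ = _ := by rw [h2]; field_simp

lemma inv_div_rpow_eq (hr : 0 < r₀) (ht : 0 < t) :
    ((t / r₀) ^ γ)⁻¹ = r₀ ^ γ * t ^ (-γ) := by
  rw [Real.div_rpow ht.le hr.le, Real.rpow_neg ht.le, inv_div, div_eq_mul_inv]

lemma mul_baseSlopeDeriv_add (ht : 0 < t) (D : ℝ) :
    √(1 + t ^ 2) * (baseSlopeDeriv α t + D / t) = t⁻¹ ^ 2 * (√(1 + t ^ 2) * t⁻¹)⁻¹ ^ 2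
      - 3 * α * (√(1 + t ^ 2) * t⁻¹) * t⁻¹ ^ 3 + √(1 + t ^ 2) * t⁻¹ * D := by
  rw [baseSlopeDeriv]
  field_simp

end Base

/-- The slope parameters of barriers: `d = k - (r/√(1+r²) + α/r³)` and `D = r d'` satisfy the
linearized equation `D + 4 d + d² = 0` up to a strict inequality, which absorbs an error of
size `L (r⁻⁴ + r⁻¹ |d|)`; `σ = 1` for upper and `σ = -1` for lower barriers. -/
structure BarrierSlope (σ α ε L r₀ : ℝ) (k k' : ℝ → ℝ) : Prop where
  profile : SlopeProfile α ε r₀ k k'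
  boundary : k r₀ = -σ
  le : ∀ t, r₀ < t → σ * k t ≤ σ * baseSlope α t
  defect : ∀ t, r₀ < t → ∃ d D : ℝ, k t = baseSlope α t + d ∧ k' t = baseSlopeDeriv α t + D / t ∧
    |d| ≤ 2 ∧ |D| ≤ 4 * |d| ∧ L * (t⁻¹ ^ 4 + t⁻¹ * |d|) < -σ * (D + 4 * d + d ^ 2)

variable {α ε L r₀ : ℝ}

/-- Here `d = -s`, where `s` solves the logistic equation `t s' = -γ (s - s²/3)` with `γ = 4 - ε`.
As `γ/3 ≥ 1`, its quadratic term outweighs `d²`, while at infinity `s` still decays like `t^(-γ)`.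
-/
lemma exists_upper_barrierSlope (hε : 0 < ε) (hε1 : ε ≤ 1 / 2) (hL : 0 ≤ L)
    (hr : 100 * (1 + |α|) ≤ r₀) (hrL : 5 * L < ε * r₀) :
    ∃ k k', BarrierSlope 1 α ε L r₀ k k' := by
  have hα := abs_nonneg α
  have hr1 : 1 ≤ r₀ := by linarith
  have hr0 : 0 < r₀ := by linarith
  set γ := 4 - ε with hγ
  have hγ3 : 3 ≤ γ := by linarith
  obtain ⟨b0, b1, b2, b3⟩ := baseSlope_bounds (α := α) hr le_rfl
  have b4 : 0 < 1 - baseSlope α r₀ := lt_of_lt_of_le (by positivity) b1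
  -- This value gives `s r₀ = 1 + baseSlope α r₀`, that is `k r₀ = -1`.
  set A := (1 + baseSlope α r₀)⁻¹ - 1 / 3 with hA
  have hAi : (A + 1 / 3)⁻¹ = 1 + baseSlope α r₀ := by rw [hA, sub_add_cancel, inv_inv]
  have hA1 : A + 1 / 3 ≤ 1 := by
    rw [hA, sub_add_cancel]
    exact inv_le_one_of_one_le₀ (by linarith)
  have hA2 : 1 / 2 ≤ A + 1 / 3 := by
    rw [hA, sub_add_cancel, one_div]
    gcongr
    linarith
  have hA0 : 0 < A := by linarith
  set x : ℝ → ℝ := fun t => (t / r₀) ^ γ with hx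
  have hx0 : x r₀ = 1 := by simp only [hx]; rw [div_self hr0.ne', Real.one_rpow]
  have hxpos : ∀ t, 0 < t → 0 < x t := fun t ht => Real.rpow_pos_of_pos (div_pos ht hr0) _
  have hx1 : ∀ t, r₀ ≤ t → 1 ≤ x t := fun t ht => one_le_div_rpow hr0 ht (by linarith)
  set s : ℝ → ℝ := fun t => (A * x t + 1 / 3)⁻¹ with hs
  have hspos : ∀ t, 0 < t → 0 < s t := fun t ht => by
    have := hxpos t ht
    simp only [hs]
    positivity
  have hsx : ∀ t, 0 < t → s t * (A * x t) = 1 - s t / 3 := fun t ht => by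
    have := hxpos t ht
    have h1 : s t * (A * x t + 1 / 3) = 1 := inv_mul_cancel₀ (by positivity)
    linear_combination h1
  have hs2 : ∀ t, r₀ ≤ t → s t ≤ s r₀ := fun t ht => by
    have := hx1 t ht
    simp only [hs, hx0]
    gcongr
  have hs0 : s r₀ = 1 + baseSlope α r₀ := by simp only [hs, hx0, mul_one, hAi]
  have hd : ∀ t, 0 < t → HasDerivAt (fun t => -s t) (γ * (s t - s t ^ 2 / 3) / t) t := by
    intro t ht
    have := hxpos t ht
    have h1 := ((((hasDerivAt_div_rpow (γ := γ) hr0 ht).const_mul A).add_const (1 / 3)).inv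
      (by positivity)).neg
    refine h1.congr_deriv ?_
    change -(-(A * (γ * x t / t)) / (A * x t + 1 / 3) ^ 2) = _
    rw [neg_div, neg_neg, div_eq_mul_inv, ← inv_pow]
    change A * (γ * x t / t) * s t ^ 2 = _
    field_simp
    linear_combination (3 * s t) * hsx t ht
  have hk0 : baseSlope α r₀ + -s r₀ = -1 := by rw [hs0]; ring
  have hk' : ∀ t, r₀ ≤ t → 0 < baseSlopeDeriv α t + γ * (s t - s t ^ 2 / 3) / t := by
    intro t ht
    have h1 := (baseSlope_bounds (α := α) hr ht).2.2.2
    have ht0 := hr0.trans_le ht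
    have h2 := hspos t ht0
    have h3 := hs2 t ht
    have h4 : 0 ≤ s t - s t ^ 2 / 3 := by nlinarith
    positivity
  have hderiv : ∀ t, 0 < t → HasDerivAt (fun t => baseSlope α t + -s t)
      (baseSlopeDeriv α t + γ * (s t - s t ^ 2 / 3) / t) t :=
    fun t ht => (hasDerivAt_baseSlope ht).add (hd t ht)
  -- Both summands increase, so `k` stays above its initial value `-1`; the bound `k < 1` comes from
  -- `baseSlope`.
  have hmono : StrictMonoOn (fun t => baseSlope α t + -s t) (Ici r₀) := by
    refine strictMonoOn_of_deriv_pos (convex_Ici r₀)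
      (fun t ht => (hderiv t (hr0.trans_le ht)).continuousAt.continuousWithinAt) fun t ht => ?_
    rw [interior_Ici] at ht
    have ht : r₀ < t := ht
    rw [(hderiv t (hr0.trans ht)).deriv]
    exact hk' t ht.le
  refine ⟨fun t => baseSlope α t + -s t,
    fun t => baseSlopeDeriv α t + γ * (s t - s t ^ 2 / 3) / t,
    ⟨hr0, hderiv, ?_, fun t ht => ?_, ?_, ?_, 6 * r₀ ^ γ, fun t ht => ?_⟩, hk0, fun t ht => ?_,
      fun t ht => ?_⟩
  · have hsc : ContinuousOn s (Ioi 0) := ContinuousOn.inv₀ ((continuousOn_const.mul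
      (continuousOn_div_rpow hr0)).add continuousOn_const) fun t ht => by
        have := hxpos t ht
        positivity
    exact continuousOn_baseSlopeDeriv.add (ContinuousOn.div (continuousOn_const.mul
      (hsc.sub ((hsc.pow 2).div_const 3))) continuousOn_id fun t ht => (ne_of_gt ht))
  · have h1 := hmono self_mem_Ici (show t ∈ Ici r₀ from ht.le) ht
    simp only [hk0] at h1
    have h2 := (baseSlope_bounds (α := α) hr ht.le).2.1
    have h3 := hspos t (hr0.trans ht)
    have h4 := sq_nonneg t⁻¹
    rw [sq_lt_one_iff_abs_lt_one, abs_lt]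
    constructor <;> linarith
  · simp only [hk0]; norm_num
  · simp only [hk0]
    linarith [hk' r₀ le_rfl]
  · have ht0 := hr0.trans_le ht
    have h1 := hspos t ht0
    have : baseSlope α t + -s t - (t / √(1 + t ^ 2) + α / t ^ 3) = -s t := by
      rw [baseSlope]; ring
    rw [this, abs_neg, abs_of_pos h1, mul_assoc, show -4 + ε = -γ by rw [hγ]; ring,
      ← inv_div_rpow_eq hr0 ht0, ← div_eq_mul_inv]
    -- The constant comes from `A ≥ 1/2 - 1/3 = 1/6` and `s ≤ 1/(A x)`.
    change s t ≤ 6 / x t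
    rw [le_div_iff₀ (hxpos t ht0)]
    nlinarith [hsx t ht0, hxpos t ht0, mul_pos h1 (hxpos t ht0)]
  · have := hspos t (hr0.trans ht)
    linarith
  · have ht0 : 0 < t := hr0.trans ht
    have hp := hspos t ht0
    have hs3 := hs2 t ht.le
    refine ⟨-s t, γ * (s t - s t ^ 2 / 3), rfl, rfl, ?_, ?_, ?_⟩
    · rw [abs_neg, abs_of_pos hp]
      linarith
    · have h1 : 0 ≤ s t - s t ^ 2 / 3 := by nlinarith
      rw [abs_neg, abs_of_pos hp, abs_of_nonneg (mul_nonneg (by linarith) h1)]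
      refine mul_le_mul (by linarith) (by linarith [sq_nonneg (s t)]) h1 (by norm_num)
    · rw [abs_neg, abs_of_pos hp]
      -- From `x ≥ 1` and `A + 1/3 ≤ 1` one gets `A x + 1/3 ≤ x`, so `s ≥ 1/x ≥ (r₀/t)⁴`.
      have h1 : r₀ ^ 4 * t⁻¹ ^ 4 ≤ s t := by
        refine (inv_pow_four_le hr0 ht.le (by linarith : γ ≤ 4)).trans ?_
        have := hx1 t ht.le
        simp only [hs]
        gcongr
        change A * x t + 1 / 3 ≤ x t
        nlinarith
      generalize s t = σ at *
      have h2 : r₀ * t⁻¹ ≤ 1 := by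
        rw [← div_eq_mul_inv]; exact (div_le_one ht0).mpr ht.le
      have hi : 0 < t⁻¹ := inv_pos.mpr ht0
      have h3 : r₀ * t⁻¹ ^ 4 ≤ σ := by
        refine le_trans ?_ h1
        gcongr
        exact le_self_pow₀ hr1 (by norm_num)
      have h7 : r₀ * (L * (t⁻¹ ^ 4 + t⁻¹ * σ)) ≤ L * (2 * σ) := by
        have : r₀ * t⁻¹ * σ ≤ 1 * σ := by gcongr
        calc _ = L * (r₀ * t⁻¹ ^ 4 + r₀ * t⁻¹ * σ) := by ring
          _ ≤ L * (σ + 1 * σ) := by gcongr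
          _ = _ := by ring
      have h8 : L * (2 * σ) < r₀ * (ε * σ) := by nlinarith
      have h9 : L * (t⁻¹ ^ 4 + t⁻¹ * σ) < ε * σ := lt_of_mul_lt_mul_left (h7.trans_lt h8) hr0.le
      -- With `σ` standing for `s t`, the defect is `D + 4d + d² = -ε σ - (1-ε) σ²/3`.
      nlinarith [sq_nonneg σ]

/-- The pure power `d = e (t/r₀)^(-γ)` with `γ = 4 - ε` satisfies `D = -γ d`, so `D + 4d + d² = ε d
+ d²` is positive. The amplitude `e` makes `k r₀ = 1`, and `γ ≥ 3` with `one_sub_baseSlope_lt` keeps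
`k < 1` afterwards. -/
lemma exists_lower_barrierSlope (hε : 0 < ε) (hε1 : ε ≤ 1 / 2) (hL : 0 ≤ L)
    (hr : 100 * (1 + |α|) ≤ r₀) (hrL : 5 * L < ε * r₀) :
    ∃ k k', BarrierSlope (-1) α ε L r₀ k k' := by
  have hα := abs_nonneg α
  have hr1 : 1 ≤ r₀ := by linarith
  have hr0 : 0 < r₀ := by linarith
  set γ := 4 - ε with hγ
  have hγ3 : 3 ≤ γ := by linarith
  set e := 1 - baseSlope α r₀ with he
  obtain ⟨b0, b1, b2, b3⟩ := baseSlope_bounds (α := α) hr le_rfl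
  have he0 : 0 < e := lt_of_lt_of_le (by positivity) b1
  have hx0 : (r₀ / r₀) ^ γ = 1 := by rw [div_self hr0.ne', Real.one_rpow]
  have hd : ∀ t, 0 < t → HasDerivAt (fun t => e * ((t / r₀) ^ γ)⁻¹)
      (-γ * (e * ((t / r₀) ^ γ)⁻¹) / t) t := by
    intro t ht
    have hx : 0 < (t / r₀) ^ γ := Real.rpow_pos_of_pos (div_pos ht hr0) _
    refine (((hasDerivAt_div_rpow (γ := γ) hr0 ht).inv hx.ne').const_mul e).congr_deriv ?_
    field_simp
  have hxpos : ∀ t, r₀ ≤ t → 0 < ((t / r₀) ^ γ)⁻¹ := fun t ht =>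
    inv_pos.mpr (Real.rpow_pos_of_pos (div_pos (hr0.trans_le ht) hr0) _)
  have hx1 : ∀ t, r₀ ≤ t → ((t / r₀) ^ γ)⁻¹ ≤ 1 := fun t ht =>
    inv_le_one_of_one_le₀ (one_le_div_rpow hr0 ht (by linarith))
  have hk0 : baseSlope α r₀ + e * ((r₀ / r₀) ^ γ)⁻¹ = 1 := by rw [hx0, he]; ring
  refine ⟨fun t => baseSlope α t + e * ((t / r₀) ^ γ)⁻¹,
    fun t => baseSlopeDeriv α t + -γ * (e * ((t / r₀) ^ γ)⁻¹) / t,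
    ⟨hr0, fun t ht => (hasDerivAt_baseSlope ht).add (hd t ht), ?_, fun t ht => ?_, ?_, ?_,
      e * r₀ ^ γ, fun t ht => ?_⟩, ?_, fun t ht => ?_, fun t ht => ?_⟩
  · refine continuousOn_baseSlopeDeriv.add (ContinuousOn.div (continuousOn_const.mul
      (continuousOn_const.mul ((continuousOn_div_rpow hr0).inv₀ fun t ht => ?_))) continuousOn_id
      fun t ht => (ne_of_gt ht))
    exact (Real.rpow_pos_of_pos (div_pos ht hr0) _).ne'
  · have h1 := one_sub_baseSlope_lt (α := α) hr0 ht
    have h2 := mul_le_mul_of_nonneg_left (inv_rpow_le hr0 ht.le hγ3) he0.le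
    have h3 := (baseSlope_bounds (α := α) hr ht.le).1
    have h4 := mul_pos he0 (hxpos t ht.le)
    rw [sq_lt_one_iff_abs_lt_one, abs_lt]
    constructor <;> linarith
  · simp only [hk0]; norm_num
  · simp only [hx0]
    rw [inv_one, mul_one, show baseSlope α r₀ + e = 1 by rw [he]; ring, one_mul]
    have hρ2 : √(1 + r₀ ^ 2) ^ 2 = 1 + r₀ ^ 2 := Real.sq_sqrt (by positivity)
    have hρ : r₀ < √(1 + r₀ ^ 2) := Real.lt_sqrt_of_sq_lt (by linarith)
    have hρ0 : 0 < √(1 + r₀ ^ 2) := by positivity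
    -- This gives `k' r₀ < 0`, since `γ ≥ 3`. The terms with `α` agree on both sides, which leaves
    -- an inequality about `t/√(1+t²)` alone.
    have h1 : baseSlopeDeriv α r₀ < 3 * e / r₀ := by
      rw [baseSlopeDeriv, he, baseSlope]
      set ρ := √(1 + r₀ ^ 2)
      have : 1 / ρ ^ 3 < 3 * (1 - r₀ / ρ) / r₀ := by
        have h5 : (ρ - r₀) * (ρ + r₀) = 1 := by linear_combination hρ2
        have h6 : r₀ * (ρ + r₀) < 3 * ρ ^ 2 := by nlinarith
        have h7 : r₀ < 3 * ρ ^ 2 * (ρ - r₀) := by nlinarith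
        rw [show 3 * (1 - r₀ / ρ) / r₀ = 3 * (ρ - r₀) / (ρ * r₀) by field_simp,
          div_lt_div_iff₀ (by positivity) (by positivity)]
        nlinarith
      have h8 : 3 * (1 - (r₀ / ρ + α / r₀ ^ 3)) / r₀ = 3 * (1 - r₀ / ρ) / r₀ - 3 * α / r₀ ^ 4 := by
        field_simp
        ring
      linarith
    have h2 : 3 * e / r₀ ≤ γ * e / r₀ := by gcongr
    rw [neg_mul, neg_div]
    linarith
  · have : baseSlope α t + e * ((t / r₀) ^ γ)⁻¹ - (t / √(1 + t ^ 2) + α / t ^ 3) =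
        e * ((t / r₀) ^ γ)⁻¹ := by rw [baseSlope]; ring
    rw [this, abs_of_pos (mul_pos he0 (hxpos t ht)), inv_div_rpow_eq hr0 (hr0.trans_le ht), hγ,
      neg_sub, mul_assoc, show ε - 4 = -4 + ε by ring]
  · simp only [hk0]; norm_num
  · have := mul_pos he0 (hxpos t ht.le)
    linarith
  · have hp := mul_pos he0 (hxpos t ht.le)
    have ht0 : 0 < t := hr0.trans ht
    refine ⟨e * ((t / r₀) ^ γ)⁻¹, -γ * (e * ((t / r₀) ^ γ)⁻¹), rfl, rfl, ?_, ?_, ?_⟩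
    · rw [abs_of_pos hp]
      have := mul_le_of_le_one_right he0.le (hx1 t ht.le)
      linarith
    · rw [neg_mul, abs_neg, abs_mul, abs_of_pos (by linarith : 0 < γ)]
      gcongr
      linarith
    · rw [abs_of_pos hp]
      have h1 := inv_pow_four_le hr0 ht.le (by linarith : γ ≤ 4)
      set x := ((t / r₀) ^ γ)⁻¹
      have h2 : r₀ * t⁻¹ ≤ 1 := by
        rw [← div_eq_mul_inv]; exact (div_le_one ht0).mpr ht.le
      have hi : 0 < t⁻¹ := inv_pos.mpr ht0
      -- `e ≥ r₀⁻²/4` and `x ≥ (r₀/t)⁴`; the resulting factor `r₀²` is weakened to `r₀`. With the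
      -- term `t⁻¹|d|` this produces the `5 = 4 + 1` in the condition on `r₀`.
      have h3 : r₀ * t⁻¹ ^ 4 ≤ 4 * (e * x) := by
        have h4 : r₀⁻¹ ^ 2 * (r₀ ^ 4 * t⁻¹ ^ 4) ≤ 4 * e * x :=
          mul_le_mul (by linarith) h1 (by positivity) (by positivity)
        have h5 : r₀⁻¹ ^ 2 * (r₀ ^ 4 * t⁻¹ ^ 4) = r₀ * (r₀ * t⁻¹ ^ 4) := by field_simp
        have h6 : 1 * (r₀ * t⁻¹ ^ 4) ≤ r₀ * (r₀ * t⁻¹ ^ 4) := by gcongr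
        linarith
      have h7 : r₀ * (L * (t⁻¹ ^ 4 + t⁻¹ * (e * x))) ≤ L * (5 * (e * x)) := by
        have : r₀ * t⁻¹ * (e * x) ≤ 1 * (e * x) := by gcongr
        calc _ = L * (r₀ * t⁻¹ ^ 4 + r₀ * t⁻¹ * (e * x)) := by ring
          _ ≤ L * (4 * (e * x) + 1 * (e * x)) := by gcongr
          _ = _ := by ring
      have h8 : L * (5 * (e * x)) < r₀ * (ε * (e * x)) := by nlinarith
      have h9 : L * (t⁻¹ ^ 4 + t⁻¹ * (e * x)) < ε * (e * x) :=
        lt_of_mul_lt_mul_left (h7.trans_lt h8) hr0.le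
      have h10 : -(-1) * (-γ * (e * x) + 4 * (e * x) + (e * x) ^ 2) = ε * (e * x) + (e * x) ^ 2 := by
        rw [hγ]; ring
      rw [h10]
      linarith [sq_nonneg (e * x)]

/-! ### Barriers -/

section Sign

lemma PointBounds.mono {G K : E3 → Bil} {m p : Bil} {C C' : ℝ} {x : E3}
    (h : PointBounds G K m p C x) (hC : C ≤ C') : PointBounds G K m p C' x where
  nonneg := h.nonneg.trans hC
  diff := h.diff
  symm := h.symm
  fderiv_symm := h.fderiv_symm
  radial := h.radial
  fderiv_radial := h.fderiv_radial
  metric v w hv hw := (h.metric v w hv hw).trans (by gcongr)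
  fderiv_normal v w hv hw := (h.fderiv_normal v w hv hw).trans (by gcongr)
  fderiv_tangent z v w hz hv hw := (h.fderiv_tangent z v w hz hv hw).trans (by gcongr)
  K_normal := h.K_normal.trans (by gcongr)
  K_mixed v hv := (h.K_mixed v hv).trans (by gcongr)
  K_mixed' v hv := (h.K_mixed' v hv).trans (by gcongr)
  K_tangent v w hv hw := (h.K_tangent v w hv hw).trans (by gcongr)
  m_bound v w := (h.m_bound v w).trans (by gcongr)
  p_bound v w := (h.p_bound v w).trans (by gcongr)

lemma ExtBounds.mono {ψ Θ : S2 → ℝ} {C C' : ℝ} (h : ExtBounds ψ Θ C) (hC : C ≤ C') :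
    ExtBounds ψ Θ C' where
  nonneg := h.nonneg.trans hC
  diff := h.diff
  diff2 := h.diff2
  radial := h.radial
  bound1 x hx v := (h.bound1 x hx v).trans (by gcongr)
  radial_left := h.radial_left
  radial_right := h.radial_right
  bound2 x hx v w := (h.bound2 x hx v w).trans (by gcongr)
  laplacian := h.laplacian

lemma abs_sum_diag_le {m : Bil} {C : ℝ} (h : ∀ v w, |m v w| ≤ C * ‖v‖ * ‖w‖) :
    |∑ a, m (stdVec a) (stdVec a)| ≤ 3 * C := by
  refine (Finset.abs_sum_le_sum_abs _ _).trans ?_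
  have : ∀ a, |m (stdVec a) (stdVec a)| ≤ C := fun a => by
    simpa [stdVec] using h (stdVec a) (stdVec a)
  calc _ ≤ ∑ _a : Fin 3, C := Finset.sum_le_sum fun a _ => this a
    _ = _ := by simp

/-- The constant in the error estimate of the Jang operator. -/
def jangConst (C : ℝ) : ℝ :=
  30 * (600 * C ^ 4) ^ 2 * (9 * (6 * C) + 1) + 15 * (6 * C) ^ 3

/-- The errors of `jang_estimate` and `radial_estimate` add up to at most `jangConst C` times `y⁴ +
y|d|`, which the strict defect of the barrier slope dominates. -/
lemma BarrierSlope.jang_sign {σ α ε r₀ C : ℝ} {k k' : ℝ → ℝ}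
    (hb : BarrierSlope σ α ε (jangConst C) r₀ k k') (hσ : |σ| = 1) (hε : 0 ≤ ε) (hε1 : ε ≤ 1 / 2)
    {G K : E3 → Bil} {m p : Bil} {ψ Θ : S2 → ℝ} {x : E3}
    (h : PointBounds G K m p C x) (hψ : ExtBounds ψ Θ C) (hC : 1 ≤ C) (hα : |α| ≤ C)
    (hm : ∀ v, m x v = 0) (hp : ∀ v, p x v = 0)
    (hΘ : 1 / 2 * ∑ a, m (stdVec a) (stdVec a) + ∑ a, p (stdVec a) (stdVec a)
      = Θ (sphereDir x) + α)
    (hrC : 24 * C ≤ r₀) (hx : r₀ < ‖x‖) :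
    σ * jang G K (fun y => radialProfile α r₀ k ‖y‖ + ext ψ y) x < 0 := by
  have hx1 : 1 ≤ ‖x‖ := by linarith
  have hx0 : 0 < ‖x‖ := by linarith
  have hy0 : 0 < ‖x‖⁻¹ := inv_pos.mpr hx0
  have hy1 : ‖x‖⁻¹ ≤ 1 := inv_le_one_of_one_le₀ hx1
  have hsmall : 24 * C * ‖x‖⁻¹ ^ 3 ≤ 1 := by
    calc _ ≤ ‖x‖ * ‖x‖⁻¹ ^ 3 := by gcongr; linarith
      _ = ‖x‖⁻¹ ^ 2 := by field_simp
      _ ≤ 1 := pow_le_one₀ hy0.le hy1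
  obtain ⟨φ₂, hφ⟩ := hb.profile.radialSlope hε hε1 hx
  obtain ⟨d, D, hk, hk', hd, hD, hlt⟩ := hb.defect _ hx
  have e1 := jang_estimate h hψ hC hx1 hsmall hm hp hφ
  have hz0 : 0 < √(1 + ‖x‖ ^ 2) * ‖x‖⁻¹ := by positivity
  have hz2 := hypRatio_sq hx0
  have hC6 : 1 ≤ 6 * C := by linarith
  have hα6 : |α| ≤ 6 * C := by linarith
  -- `Θ` is half the trace of `m` plus the trace of `p` minus `α`, hence at most `(3/2 + 3 + 1) C`.
  have hΘ6 : |Θ (sphereDir x)| ≤ 6 * C := by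
    have h1 := abs_le.mp (abs_sum_diag_le h.m_bound)
    have h2 := abs_le.mp (abs_sum_diag_le h.p_bound)
    have h3 := abs_le.mp hα
    rw [abs_le]
    constructor <;> linarith
  have hkeq : k ‖x‖ = (√(1 + ‖x‖ ^ 2) * ‖x‖⁻¹)⁻¹ + α * ‖x‖⁻¹ ^ 3 + d := by
    rw [hk, baseSlope_eq hx0]
  have hk1eq := mul_baseSlopeDeriv_add (α := α) hx0 D
  rw [← hk'] at hk1eq
  have e2 := radial_estimate hy0 hy1 hz0 hz2 hC6 hα6 hΘ6 hd hD hkeq hk1eq hφ.pos hφ.sq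
  have e3 := slope_error_le hy0 hy1 hz0 hz2 hC6 hα6 hD hkeq hk1eq
  rw [hΘ] at e1
  generalize jang G K (fun y => radialProfile α r₀ k ‖y‖ + ext ψ y) x = J at e1 ⊢
  set y := ‖x‖⁻¹
  set E := √(1 + ‖x‖ ^ 2) * k' ‖x‖ - √(1 - k ‖x‖ ^ 2) ^ 2 + 2 * k ‖x‖ * (√(1 + ‖x‖ ^ 2) * y) - 2
    + √(1 - k ‖x‖ ^ 2) * y ^ 2 * Θ (sphereDir x) - y ^ 3 * (Θ (sphereDir x) + α)
  have hyd : 0 ≤ y * |d| := by positivity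
  have e4 : |J - (D + 4 * d + d ^ 2)| ≤ jangConst C * (y ^ 4 + y * |d|) := by
    have h1 : |J - E| ≤ 30 * (600 * C ^ 4) ^ 2 * ((9 * (6 * C) + 1) * (y ^ 4 + y * |d|)) := by
      refine e1.trans ?_
      gcongr
      linarith
    calc _ ≤ |J - E| + |E - (D + 4 * d + d ^ 2)| := abs_sub_le _ _ _
      _ ≤ _ := add_le_add h1 e2
      _ = _ := by rw [jangConst]; ring
  have e5 : σ * (J - (D + 4 * d + d ^ 2)) ≤ jangConst C * (y ^ 4 + y * |d|) := by
    refine (le_abs_self _).trans ?_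
    rwa [abs_mul, hσ, one_mul]
  linarith

/-- The operator depends only on the germ of the function. This is needed because a pulled back
function has its coordinate expression only on the target of the chart. -/
lemma jang_congr {G K : E3 → Bil} {f g : E3 → ℝ} {x : E3} (h : f =ᶠ[𝓝 x] g) :
    jang G K f x = jang G K g x := by
  have h1 : ∀ i, pd i f x = pd i g x := fun i => by rw [pd, pd, h.fderiv_eq]
  have h2 : ∀ i j, pd i (pd j f) x = pd i (pd j g) x := fun i j => by
    have : pd j f =ᶠ[𝓝 x] pd j g := h.fderiv.mono fun y hy => by rw [pd, pd, hy]
    rw [pd, pd, this.fderiv_eq]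
  simp only [jang, gradUp, normSqDf, hess, h1, h2]

end Sign

/-! ### Transfer of coordinate functions to the end of the manifold. -/

section Chart

variable {M : Type*} [TopologicalSpace M] [ChartedSpace E3 M]

/-- The function on the end of `M` that has the coordinate expression `F`. -/
def ChartAtInfinity.pullback (X : ChartAtInfinity M) (F : E3 → ℝ) (q : M) : ℝ := F (X.Φ q)

variable {D : InitialData M} {X : ChartAtInfinity M} {F : E3 → ℝ} {r₀ : ℝ}

lemma ChartAtInfinity.pullback_symm {x : E3} (hx : X.R < ‖x‖) :
    X.pullback F (X.Φ.symm x) = F x := by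
  rw [pullback, X.Φ.right_inv (by rw [X.target_eq]; exact hx)]

lemma ChartAtInfinity.lt_norm {q : M} (hq : q ∈ X.Φ.source) : X.R < ‖X.Φ q‖ := by
  have := X.Φ.map_source hq
  rwa [X.target_eq] at this

lemma jangAt_pullback {q : M} (hq : q ∈ X.Φ.source) :
    jangAt D X (X.pullback F) q
      = jang (pushTensor X.Φ D.g) (pushTensor X.Φ D.K) F (X.Φ q) := by
  refine jang_congr ?_
  have : {x : E3 | X.R < ‖x‖} ∈ 𝓝 (X.Φ q) :=
    (isOpen_lt continuous_const continuous_norm).mem_nhds (X.lt_norm hq)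
  filter_upwards [this] with x hx
  exact X.pullback_symm hx

lemma isBarrierRegular_pullback [IsManifold 𝓘(ℝ, E3) ∞ M]
    (hF : ContinuousOn F {x | r₀ ≤ ‖x‖}) (hF2 : ContDiffOn ℝ 2 F {x | r₀ < ‖x‖}) :
    IsBarrierRegular X r₀ (X.pullback F) := by
  refine ⟨hF.comp (X.Φ.continuousOn.mono fun q hq => hq.1) fun q hq => hq.2, ?_⟩
  have h1 : ContMDiffOn 𝓘(ℝ, E3) 𝓘(ℝ, E3) 2 X.Φ X.Φ.source :=
    (contMDiffOn_of_mem_maximalAtlas X.smooth).of_le (by norm_cast)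
  exact hF2.contMDiffOn.comp (h1.mono fun q hq => hq.1) fun q hq => hq.2

lemma norm_smul_sphere {s : ℝ} (hs : 0 < s) (θ : S2) : ‖s • (θ : E3)‖ = s := by
  rw [norm_smul, norm_eq_of_mem_sphere, mul_one, Real.norm_eq_abs, abs_of_pos hs]

lemma radialDeriv_pullback {φ : ℝ → ℝ} {ψ : S2 → ℝ} (θ : S2) {r d : ℝ} (hr : X.R < r)
    (hφ : HasDerivAt φ d r) :
    radialDeriv X (X.pullback fun x => φ ‖x‖ + ext ψ x) θ r = d := by
  refine (HasDerivAt.congr_of_eventuallyEq (hφ.add_const (ψ θ)) ?_).deriv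
  filter_upwards [Ioi_mem_nhds hr] with s hs
  have hs0 : 0 < s := X.R_pos.trans hs
  have hθ : (θ : E3) ≠ 0 := ne_zero_of_mem_unit_sphere θ
  rw [X.pullback_symm (by rwa [norm_smul_sphere hs0]), norm_smul_sphere hs0, ext,
    sphereDir_smul hs0 hθ, sphereDir_sphere]

end Chart

/-! ### Regularity, asymptotics and boundary slope of the pulled back graphs. -/

section Barrier

variable {M : Type*} [TopologicalSpace M] [ChartedSpace E3 M]
  {X : ChartAtInfinity M} {α ε r₀ : ℝ} {k k' : ℝ → ℝ} {ψ : S2 → ℝ}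

lemma SlopeProfile.isBarrierRegular [IsManifold 𝓘(ℝ, E3) ∞ M] (h : SlopeProfile α ε r₀ k k') (hε : 0 ≤ ε)
    (hε1 : ε ≤ 1 / 2) (hψ : ContDiffOn ℝ 2 (ext ψ) {0}ᶜ) :
    IsBarrierRegular X r₀ (X.pullback fun x => radialProfile α r₀ k ‖x‖ + ext ψ x) := by
  have h0 : ∀ x : E3, r₀ ≤ ‖x‖ → x ∈ ({0}ᶜ : Set E3) := fun x hx =>
    norm_pos_iff.mp (h.pos.trans_le hx)
  refine isBarrierRegular_pullback ?_ ?_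
  · exact ((h.continuousOn_radialProfile hε hε1).comp continuous_norm.continuousOn
      fun x hx => hx).add (hψ.continuousOn.mono fun x hx => h0 x hx)
  · have hn : ContDiffOn ℝ 2 (fun x : E3 => ‖x‖) {x | r₀ < ‖x‖} := fun x hx =>
      (contDiffAt_norm ℝ (h0 x (le_of_lt hx))).contDiffWithinAt
    exact ((h.contDiffOn_radialProfile hε hε1).comp hn fun x hx => hx).add
      (hψ.mono fun x hx => h0 x (le_of_lt hx))

lemma SlopeProfile.hasBarrierAsymptotics (h : SlopeProfile α ε r₀ k k') (hε : 0 ≤ ε)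
    (hε1 : ε ≤ 1 / 2) {ε' : ℝ} (hε' : ε ≤ ε') : HasBarrierAsymptotics X α ψ ε'
      (X.pullback fun x => radialProfile α r₀ k ‖x‖ + ext ψ x) := by
  obtain ⟨C, R, hR, hC⟩ := h.radialProfile_asymptotics hε hε1
  refine ⟨|C|, R, fun q hq => ?_⟩
  have hq2 : R ≤ ‖X.Φ q‖ := hq.2
  have hq1 : 1 ≤ ‖X.Φ q‖ := hR.trans hq2
  rw [ChartAtInfinity.pullback, ext, add_sub_add_right_eq_sub]
  refine (hC _ hq2).trans ?_
  gcongr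
  · exact le_abs_self C

lemma SlopeProfile.tendsto_radialDeriv (h : SlopeProfile α ε r₀ k k') (hε : 0 ≤ ε)
    (hε1 : ε ≤ 1 / 2) (hr : X.R < r₀) (θ : S2) {l : Filter ℝ}
    (hl : Tendsto (slopeOf k) (𝓝[>] r₀) l) :
    Tendsto (radialDeriv X (X.pullback fun x => radialProfile α r₀ k ‖x‖ + ext ψ x) θ)
      (𝓝[>] r₀) l := by
  refine hl.congr' ?_
  filter_upwards [self_mem_nhdsWithin] with r hrr
  have hrr : r₀ < r := hrr
  exact (radialDeriv_pullback θ (hr.trans hrr) (h.hasDerivAt_radialProfile hε hε1 hrr)).symm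

end Barrier

end Jang

end

/-! ### Choice of the constants and assembly of the two barriers. -/

theorem proposition3p5 {M : Type*} [TopologicalSpace M] [T2Space M] [SecondCountableTopology M]
    [ChartedSpace Jang.E3 M] [IsManifold 𝓘(ℝ, Jang.E3) ∞ M]
    (D : Jang.InitialData M) (X : Jang.ChartAtInfinity M) (l : ℕ) (β τ₀ : ℝ)
    (m p : Jang.S2 → Jang.Bil) (hWang : Jang.HasWangAsymptotics D X l β τ₀ m p)
    (ψ : Jang.S2 → ℝ) (hψ : Jang.IsPsi m p ψ) (ε : ℝ) (hε : 0 < ε) :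
    ∃ r₀ : ℝ, X.R < r₀ ∧ ∃ f_plus f_minus : M → ℝ,
      Jang.IsUpperBarrier D X r₀ f_plus ∧
      Jang.IsLowerBarrier D X r₀ f_minus ∧
      Jang.HasBarrierAsymptotics X (Jang.alpha m p) ψ ε f_plus ∧
      Jang.HasBarrierAsymptotics X (Jang.alpha m p) ψ ε f_minus ∧
      ∀ q ∈ X.outer r₀, f_minus q ≤ f_plus q := by
  open Jang in
  set α := alpha m p with hα
  -- A smaller exponent only strengthens the asymptotics, so `ε` may be capped at `1/2`.
  obtain ⟨ε', hε0, hε1, hεε⟩ : ∃ ε', 0 < ε' ∧ ε' ≤ 1 / 2 ∧ ε' ≤ ε :=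
    ⟨min ε (1 / 2), by positivity, min_le_right _ _, min_le_left _ _⟩
  have hl := hWang.ah.two_le_l
  have hGd : ∀ x : E3, X.R < ‖x‖ → DifferentiableAt ℝ (pushTensor X.Φ D.g) x := by
    intro x hx
    have hx : x ∈ X.Φ.target := by rw [X.target_eq]; exact hx
    have h1 := (hWang.ah.g_regular X.Φ X.smooth).1.contDiffAt (X.Φ.open_target.mem_nhds hx)
    exact h1.differentiableAt (by norm_cast; omega)
  obtain ⟨C₁, R₁, -, hR₁, hpt⟩ := exists_pointBounds hl X.R_pos hGd
    (fun x v w => D.g_symm _ _ _) hWang.g_radial hWang.m_tensor hWang.p_tensor hWang.ah.K_decay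
    hWang.g_expansion hWang.K_expansion
  obtain ⟨C₂, hext⟩ := exists_extBounds hψ.1
  set C := max (max 1 |α|) (max C₁ C₂) with hC
  have hC1 : 1 ≤ C := (le_max_left _ _).trans (le_max_left _ _)
  have hCα : |α| ≤ C := (le_max_right _ _).trans (le_max_left _ _)
  have hCC₁ : C₁ ≤ C := (le_max_left _ _).trans (le_max_right _ _)
  have hCC₂ : C₂ ≤ C := (le_max_right _ _).trans (le_max_right _ _)
  set L := jangConst C with hL
  have hL0 : 0 ≤ L := by
    rw [hL, jangConst]
    positivity
  -- The summands serve, in turn, the pointwise bounds on the data, the bounds on `baseSlope`, the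
  -- smallness required for the frame, and the absorption of the error by the defect.
  set r₀ := R₁ + 100 * (1 + |α|) + 24 * C + (5 * L / ε' + 1) with hr₀
  have hLε : 0 ≤ 5 * L / ε' := by positivity
  have hα0 := abs_nonneg α
  have hR₁0 : 0 < R₁ := X.R_pos.trans hR₁
  have hr1 : R₁ ≤ r₀ := by linarith
  have hr2 : 100 * (1 + |α|) ≤ r₀ := by linarith
  have hr3 : 24 * C ≤ r₀ := by linarith
  have hr4 : 5 * L < ε' * r₀ := by
    have : 5 * L / ε' < r₀ := by linarith
    rw [div_lt_iff₀ hε0] at this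
    linarith
  have hXr : X.R < r₀ := hR₁.trans_le hr1
  obtain ⟨k₁, k₁', hk₁⟩ := exists_upper_barrierSlope hε0 hε1 hL0 hr2 hr4
  obtain ⟨k₂, k₂', hk₂⟩ := exists_lower_barrierSlope hε0 hε1 hL0 hr2 hr4
  have sign : ∀ (σ : ℝ) (k k' : ℝ → ℝ), |σ| = 1 → BarrierSlope σ α ε' L r₀ k k' →
      ∀ q ∈ X.strictOuter r₀,
        σ * jangAt D X (X.pullback fun x => radialProfile α r₀ k ‖x‖ + ext ψ x) q < 0 := by
    intro σ k k' hσ hk q hq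
    have hq2 : r₀ < ‖X.Φ q‖ := hq.2
    have hq0 : X.Φ q ≠ 0 := norm_pos_iff.mp (X.R_pos.trans (hXr.trans hq2))
    -- Tangentiality is stated at the unit vector `x/|x|`; rescaling gives it at `x`.
    have tang : ∀ {j : ℕ} {T : S2 → Bil}, IsSphereTensor j β T → ∀ v,
        T (sphereDir (X.Φ q)) (X.Φ q) v = 0 := by
      intro j T hT v
      have h1 := hT.tangential (sphereDir (X.Φ q)) v
      rw [sphereDir_coe hq0, map_smul, smul_apply, smul_eq_mul] at h1
      exact (mul_eq_zero.mp h1).resolve_left (inv_ne_zero (norm_ne_zero_iff.mpr hq0))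
    rw [jangAt_pullback hq.1]
    refine hk.jang_sign hσ hε0.le hε1 ((hpt _ (hr1.trans hq2.le)).mono hCC₁) (hext.mono hCC₂) hC1
      hCα (tang hWang.m_tensor) (tang hWang.p_tensor) ?_ hr3 hq2
    rw [hψ.2, sphereTrace, sphereTrace, ← hα]
    ring
  refine ⟨r₀, hXr, X.pullback fun x => radialProfile α r₀ k₁ ‖x‖ + ext ψ x,
    X.pullback fun x => radialProfile α r₀ k₂ ‖x‖ + ext ψ x,
    ⟨hk₁.profile.isBarrierRegular hε0.le hε1 hψ.1, fun θ => ?_, fun q hq => ?_⟩,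
    ⟨hk₂.profile.isBarrierRegular hε0.le hε1 hψ.1, fun θ => ?_, fun q hq => ?_⟩,
    hk₁.profile.hasBarrierAsymptotics hε0.le hε1 hεε,
    hk₂.profile.hasBarrierAsymptotics hε0.le hε1 hεε, fun q hq => ?_⟩
  · exact hk₁.profile.tendsto_radialDeriv hε0.le hε1 hXr θ
      (hk₁.profile.tendsto_slopeOf_atBot hk₁.boundary)
  · simpa using sign 1 k₁ k₁' (by simp) hk₁ q hq
  · exact hk₂.profile.tendsto_radialDeriv hε0.le hε1 hXr θ
      (hk₂.profile.tendsto_slopeOf_atTop (by rw [hk₂.boundary, neg_neg]))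
  · have := sign (-1) k₂ k₂' (by simp) hk₂ q hq
    linarith
  · refine add_le_add ?_ le_rfl
    -- The slope parameters lie on opposite sides of `baseSlope`, the upper barrier having the
    -- smaller one.
    refine hk₁.profile.radialProfile_le hk₂.profile hε0.le hε1 (fun t ht => ?_) hq.2
    have h1 := hk₁.le t ht
    have h2 := hk₂.le t ht
    linarith
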